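/- **Setting.** Let $L>0$, $0<\delta<L/2$, $q>0$. For $N\ge 1$ let $\Omega=\bigcup_{j=1}^N\Omega_j$, $\Omega_j=(a_j,b_j)\times(0,1)$, $a_j=(j-1)L$, $b_j=jL+2\delta$. Consider $-\Delta u=f$ in $\Omega$, $u=0$ on the vertical sides $x=a_1$ and $x=b_N$, and $\mathcal B_b(u)=0$ at $y=0$, $\mathcal B_t(u)=0$ at $y=1$, where each condition is of Dirichlet type (D: $u=0$), Neumann type (N: $\partial_yu=0$) or Robin type (R: $qu-\partial_yu=0$ at the bottom, $qu+\partial_yu=0$ at the top); the pair (bottom, top) is one of DD, DR, DN, RR, NR, NN. The parallel Schwarz method computes $u_j^n$ in $\Omega_j$ from $-\Delta u^n_j=f$, the conditions $\mathcal B_b(u_j^n)=\mathcal B_t(u_j^n)=0$, $u_1^n=0$ at $x=a_1$, $u^n_N=0$ at $x=b_N$, and the transmission conditions $\mathcal T_\ell(u_j^n)=\mathcal T_\ell(u_{j-1}^{n-1})$ at $x=a_j$ ($2\le j\le N$), $\mathcal T_r(u_j^n)=\mathcal T_r(u_{j+1}^{n-1})$ at $x=b_j$ ($1\le j\le N-1$).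 For PSM, $\mathcal T_\ell(u)=\mathcal T_r(u)=u$; for OSM with parameter $p>0$, $\mathcal T_\ell(u)=pu-\partial_xu$ and $\mathcal T_r(u)=pu+\partial_xu$. Solutions are continuous (PSM) or $C^1$ (OSM) functions of $x$, up to the vertical sides, with values in $L^2(0,1)$, and satisfy the equation weakly in $y$, i.e. after testing with every $C^2$ function $\psi(y)$ that satisfies the two external conditions. For $\lambda\ge0$ put $$\rho(\lambda,\delta)=\frac{e^{2\sqrt\lambda\,\delta}+e^{\sqrt\lambda\,L}}{e^{2\sqrt\lambda\,\delta+\sqrt\lambda\,L}+1}.$$ Let $\mu_1(q)\in(\pi/2,\pi)$, $\tau_1(q)\in(0,\pi)$, $\nu_1(q)\in(0,\pi/2)$ be the unique roots in these intervals of $q\sin x+x\cos x$, of $2qx\cos x+(q^2-x^2)\sin x$ and of $x\sin x-q\cos x$ respectively. **Theorem 3 (Convergence of PSM and OSM).** These roots exist and are unique, and the smallest eigenvalue $\lambda_1$ of $-\varphi''=\lambda\varphi$ on $(0,1)$ with the external conditions is $\pi^2$ (DD), $\mu_1(q)^2$ (DR), $\pi^2/4$ (DN), $\tau_1(q)^2$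 (RR), $\nu_1(q)^2$ (NR), $0$ (NN). Write $\rho_{\rm DD},\dots,\rho_{\rm NN}$ for the corresponding values $\rho(\lambda_1,\delta)$. (i) For PSM and OSM, for each of the six configurations and every $N\ge1$, the homogeneous subdomain problems are uniquely solvable for all interface data in $L^2(0,1)$, and the map $T$ from the $L^2$ interface data of the error at one iteration to those at the next one is a well-defined bounded linear operator on $L^2(0,1)^{2(N-1)}$. Its contraction factor, i.e. its spectral radius, and also its norm $\|T\|$, are at most $\rho(\lambda_1,\delta)$. Consequently, for every $f$, every exact solution $u$ and every initial guess, from the first iteration on the $L^2$ norm of the interface data of the error is multiplied by at most $\rho(\lambda_1,\delta)$ per iteration, and $\|(u-u^n_j)(x,\cdot)\|_{L^2(0,1)}\le C\rho(\lambda_1,\delta)^n E_1$ for all $n\ge1$, all $j$ and all $x\in[a_j,b_j]$, where $E_1$ is the $L^2$ norm of the interface data of the error at iteration $1$ and $C$ does not depend on $N,n,j,x,f$ or the initial guess. (ii) For all $\delta>0$ (also for $\delta\ge L/2$): $\rho_{\rm DD}<\rho_{\rm DR}<\rho_{\rm DN}<\rho_{\rm NR}<\rho_{\rm NN}=1$ and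 $\rho_{\rm DD}<\rho_{\rm RR}<\rho_{\rm NN}=1$. (iii) Both methods are weakly scalable (for some $c<1$ the contraction factor is at most $c$ for all $N$) in all cases except NN, and they are not weakly scalable in the case NN. -/

import Mathlib

open MeasureTheory Set
open scoped ENNReal

noncomputable section

namespace SchwarzChain

/-- `L²(0,1)` (complex-valued), the space in which a function of `y` on a vertical line lives. -/
abbrev L2Y : Type := Lp ℂ 2 (volume.restrict (Ioo (0 : ℝ) 1))

/-- The three kinds of condition that can be imposed on a horizontal side. -/
inductive Kind
  | dirichlet
  | robin
  | neumann

/-- The bottom operator `B_b`, acting on a function of `y` at `y = 0`. -/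
def bottomOp (q : ℝ) : Kind → (ℝ → ℂ) → ℂ
  | .dirichlet, φ => φ 0
  | .robin, φ => (q : ℂ) * φ 0 - deriv φ 0
  | .neumann, φ => deriv φ 0

/-- The top operator `B_t`, acting on a function of `y` at `y = 1`. -/
def topOp (q : ℝ) : Kind → (ℝ → ℂ) → ℂ
  | .dirichlet, φ => φ 1
  | .robin, φ => (q : ℂ) * φ 1 + deriv φ 1
  | .neumann, φ => deriv φ 1

/-- The six configurations of external conditions (first letter: bottom, second letter: top). -/
inductive External
  | DD
  | DR
  | DN
  | RR
  | NR
  | NN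

/-- The kind of the bottom condition. -/
def External.bottom : External → Kind
  | .DD => .dirichlet
  | .DR => .dirichlet
  | .DN => .dirichlet
  | .RR => .robin
  | .NR => .neumann
  | .NN => .neumann

/-- The kind of the top condition. -/
def External.top : External → Kind
  | .DD => .dirichlet
  | .DR => .robin
  | .DN => .neumann
  | .RR => .robin
  | .NR => .robin
  | .NN => .neumann

/-- `φ` is twice continuously differentiable and satisfies the external conditions. -/
def IsAdmissible (bc : External) (q : ℝ) (φ : ℝ → ℂ) : Prop :=
  ContDiff ℝ 2 φ ∧ bottomOp q bc.bottom φ = 0 ∧ topOp q bc.top φ = 0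

/-- The eigenvalues of `φ'' = -λ φ` on `(0,1)` with the external conditions. -/
def eigenvalues (bc : External) (q : ℝ) : Set ℝ :=
  {l | ∃ φ : ℝ → ℂ, IsAdmissible bc q φ ∧
    (∀ y ∈ Ioo (0 : ℝ) 1, deriv (deriv φ) y = -(l : ℂ) * φ y) ∧
    ∃ y ∈ Ioo (0 : ℝ) 1, φ y ≠ 0}

/-- The set whose only element is `μ₁(q)`. -/
def muRoots (q : ℝ) : Set ℝ :=
  {x | x ∈ Ioo (Real.pi / 2) Real.pi ∧ q * Real.sin x + x * Real.cos x = 0}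

/-- The set whose only element is `τ₁(q)`. -/
def tauRoots (q : ℝ) : Set ℝ :=
  {x | x ∈ Ioo 0 Real.pi ∧ 2 * q * x * Real.cos x + (q ^ 2 - x ^ 2) * Real.sin x = 0}

/-- The set whose only element is `ν₁(q)`. -/
def nuRoots (q : ℝ) : Set ℝ :=
  {x | x ∈ Ioo 0 (Real.pi / 2) ∧ x * Real.sin x - q * Real.cos x = 0}

def mu1 (q : ℝ) : ℝ := sInf (muRoots q)

def tau1 (q : ℝ) : ℝ := sInf (tauRoots q)

def nu1 (q : ℝ) : ℝ := sInf (nuRoots q)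

/-- The smallest eigenvalue for each configuration. -/
def lambda1 : External → ℝ → ℝ
  | .DD, _ => Real.pi ^ 2
  | .DR, q => mu1 q ^ 2
  | .DN, _ => Real.pi ^ 2 / 4
  | .RR, q => tau1 q ^ 2
  | .NR, q => nu1 q ^ 2
  | .NN, _ => 0

/-- The bound `ρ(λ, δ)` as a function of the eigenvalue `λ ≥ 0`, whose frequency is `√λ`. -/
def rho (L δ l : ℝ) : ℝ :=
  (Real.exp (2 * √l * δ) + Real.exp (√l * L)) / (Real.exp (2 * √l * δ + √l * L) + 1)

/-- `ρ_DD`, `ρ_DR`, …: the value of `ρ` at the smallest eigenvalue. -/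
def rhoExt (bc : External) (L δ q : ℝ) : ℝ := rho L δ (lambda1 bc q)

/-- The (bilinear) pairing `∫₀¹ ψ(y) v(y) dy`. -/
def pair (ψ : ℝ → ℂ) (v : L2Y) : ℂ := ∫ y in Ioo (0 : ℝ) 1, ψ y * v y

/-- `u : x ↦ u(x, ·)` solves `-Δu = f` in `(a,b) × (0,1)` with the external conditions at the
bottom and at the top: weakly in `y`, that is, after multiplication by an admissible `ψ` and two
integrations by parts in `y`, in which the boundary terms cancel because of the external
conditions; and pointwise in `x`:  `-∂ₓₓ⟨ψ, u(x)⟩ - ⟨ψ'', u(x)⟩ = ⟨ψ, f(x)⟩`. -/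
def SolvesPoisson (bc : External) (q a b : ℝ) (f u : ℝ → L2Y) : Prop :=
  ∀ ψ : ℝ → ℂ, IsAdmissible bc q ψ →
    ∃ V : ℝ → ℂ, ∀ x ∈ Ioo a b,
      HasDerivAt (fun s => pair ψ (u s)) (V x) x ∧
      HasDerivAt V (-pair (deriv (deriv ψ)) (u x) - pair ψ (f x)) x

/-- The two Schwarz methods: PSM (Dirichlet transmission) and OSM (Robin transmission with
parameter `p > 0`). -/
inductive Method
  | PSM
  | OSM (p : ℝ) (hp : 0 < p)

/-- Enough smoothness in `x`, up to the vertical sides, for the transmission traces to be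
functions in `L²(0,1)`: `C([a,b]; L²)` for PSM and `C¹([a,b]; L²)` for OSM. -/
def Regular : Method → ℝ → ℝ → (ℝ → L2Y) → Prop
  | .PSM, a, b, u => ContinuousOn u (Icc a b)
  | .OSM _ _, a, b, u => ContDiffOn ℝ 1 u (Icc a b)

/-- The left transmission operator at the line of abscissa `x`, for `u` living on `[a,b]`. -/
def leftTrace : Method → ℝ → ℝ → (ℝ → L2Y) → ℝ → L2Y
  | .PSM, _, _, u, x => u x
  | .OSM p _, a, b, u, x => p • u x - derivWithin u (Icc a b) x

/-- The right transmission operator at the line of abscissa `x`, for `u` living on `[a,b]`. -/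
def rightTrace : Method → ℝ → ℝ → (ℝ → L2Y) → ℝ → L2Y
  | .PSM, _, _, u, x => u x
  | .OSM p _, a, b, u, x => p • u x + derivWithin u (Icc a b) x

/-- Left end of the subdomain with index `j`; subdomains are numbered `0, …, N - 1`. -/
def aPt (L : ℝ) (j : ℕ) : ℝ := j * L

/-- Right end of the subdomain with index `j`. -/
def bPt (L δ : ℝ) (j : ℕ) : ℝ := (j + 1) * L + 2 * δ

/-- The `L²` space of interface data of a chain of `N` subdomains: `Sum.inl j` is the datum on the
left side of subdomain `j + 1`, `Sum.inr j` is the datum on the right side of subdomain `j`. -/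
abbrev TraceSpace (N : ℕ) : Type := PiLp 2 (fun _ : Fin (N - 1) ⊕ Fin (N - 1) => L2Y)

/-- The transmission data that the members of a family `v` take on their own sides. -/
def ownTraces (m : Method) (L δ : ℝ) (N : ℕ) (v : ℕ → ℝ → L2Y) : TraceSpace N :=
  WithLp.toLp 2 (Sum.elim
    (fun j : Fin (N - 1) => leftTrace m (aPt L (j + 1)) (bPt L δ (j + 1)) (v (j + 1))
      (aPt L (j + 1)))
    (fun j : Fin (N - 1) => rightTrace m (aPt L j) (bPt L δ j) (v j) (bPt L δ j)))

/-- The transmission data that the members of a family `v` hand to their neighbours: subdomain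
`j + 1` receives on its left side the left trace of `v j`, subdomain `j` receives on its right
side the right trace of `v (j + 1)`. -/
def neighbourTraces (m : Method) (L δ : ℝ) (N : ℕ) (v : ℕ → ℝ → L2Y) : TraceSpace N :=
  WithLp.toLp 2 (Sum.elim
    (fun j : Fin (N - 1) => leftTrace m (aPt L j) (bPt L δ j) (v j) (aPt L (j + 1)))
    (fun j : Fin (N - 1) => rightTrace m (aPt L (j + 1)) (bPt L δ (j + 1)) (v (j + 1))
      (bPt L δ j)))

/-- The family `v` solves the `N` subdomain problems with source `f` and interface data `g`. -/
structure SolvesLocal (m : Method) (bc : External) (q L δ : ℝ) (N : ℕ) (f : ℝ → L2Y)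
    (g : TraceSpace N) (v : ℕ → ℝ → L2Y) : Prop where
  regular : ∀ j < N, Regular m (aPt L j) (bPt L δ j) (v j)
  poisson : ∀ j < N, SolvesPoisson bc q (aPt L j) (bPt L δ j) f (v j)
  left_end : v 0 (aPt L 0) = 0
  right_end : v (N - 1) (bPt L δ (N - 1)) = 0
  traces : ownTraces m L δ N v = g

/-- The family `U n j` (iteration `n`, subdomain `j`) is produced by the Schwarz method with
source `f`, from an initial guess `U 0`. -/
structure IsSchwarzRun (m : Method) (bc : External) (q L δ : ℝ) (N : ℕ) (f : ℝ → L2Y)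
    (U : ℕ → ℕ → ℝ → L2Y) : Prop where
  initial : ∀ j < N, Regular m (aPt L j) (bPt L δ j) (U 0 j)
  step : ∀ n, SolvesLocal m bc q L δ N f (neighbourTraces m L δ N (U n)) (U (n + 1))

/-- `u` solves the global problem on the union of the `N` subdomains. -/
structure IsExactSolution (m : Method) (bc : External) (q L δ : ℝ) (N : ℕ) (f u : ℝ → L2Y) :
    Prop where
  regular : Regular m (aPt L 0) (bPt L δ (N - 1)) u
  poisson : SolvesPoisson bc q (aPt L 0) (bPt L δ (N - 1)) f u
  left_end : u (aPt L 0) = 0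
  right_end : u (bPt L δ (N - 1)) = 0

/-- The interface data of the error at iteration `n`. -/
def errorTraces (m : Method) (L δ : ℝ) (N : ℕ) (u : ℝ → L2Y) (U : ℕ → ℕ → ℝ → L2Y) (n : ℕ) :
    TraceSpace N :=
  ownTraces m L δ N (fun j x => u x - U n j x)

/-- The homogeneous subdomain problems are uniquely solvable for all interface data in `L²`. -/
def WellPosed (m : Method) (bc : External) (q L δ : ℝ) (N : ℕ) : Prop :=
  ∀ g : TraceSpace N, ∃ v : ℕ → ℝ → L2Y, SolvesLocal m bc q L δ N 0 g v ∧
    ∀ w : ℕ → ℝ → L2Y, SolvesLocal m bc q L δ N 0 g w →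
      ∀ j < N, EqOn (w j) (v j) (Icc (aPt L j) (bPt L δ j))

/-- `T` is the iteration operator of the Schwarz method for the error: it maps the interface data
of an error to those of the next error. -/
def IsIterationOperator (m : Method) (bc : External) (q L δ : ℝ) (N : ℕ)
    (T : TraceSpace N →L[ℂ] TraceSpace N) : Prop :=
  ∀ (g : TraceSpace N) (v : ℕ → ℝ → L2Y), SolvesLocal m bc q L δ N 0 g v →
    T g = neighbourTraces m L δ N v

/-- The contraction factor: the spectral radius of the (unique) iteration operator. -/
def contractionFactor (m : Method) (bc : External) (q L δ : ℝ) (N : ℕ) : ℝ≥0∞ :=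
  ⨆ (T : TraceSpace N →L[ℂ] TraceSpace N) (_ : IsIterationOperator m bc q L δ N T),
    spectralRadius ℂ T

/-- Weak scalability: the contraction factor stays away from `1`, uniformly in the number `N` of
subdomains of fixed size. -/
def WeaklyScalable (m : Method) (bc : External) (q L δ : ℝ) : Prop :=
  ∃ c : ℝ≥0∞, c < 1 ∧ ∀ N : ℕ, 1 ≤ N → contractionFactor m bc q L δ N ≤ c

end SchwarzChain

end

namespace SchwarzChain

/-! ### Fundamental solutions of `y'' = l y` for every real `l` -/

/-- The solution of `y'' = l y`, `y(0) = 1`, `y'(0) = 0`. -/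
noncomputable def gcosh (l x : ℝ) : ℝ :=
  if l = 0 then 1 else if 0 < l then Real.cosh (√l * x) else Real.cos (√(-l) * x)

/-- The solution of `y'' = l y`, `y(0) = 0`, `y'(0) = 1`. -/
noncomputable def gsinh (l x : ℝ) : ℝ :=
  if l = 0 then x else if 0 < l then Real.sinh (√l * x) / √l else Real.sin (√(-l) * x) / √(-l)

lemma gcosh_zero_left (x : ℝ) : gcosh 0 x = 1 := by simp [gcosh]

lemma gsinh_zero_left (x : ℝ) : gsinh 0 x = x := by simp [gsinh]

lemma gcosh_sq {w : ℝ} (hw : 0 < w) (x : ℝ) : gcosh (w ^ 2) x = Real.cosh (w * x) := by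
  have h : 0 < w ^ 2 := by positivity
  simp [gcosh, h, hw.ne', Real.sqrt_sq hw.le]

lemma gsinh_sq {w : ℝ} (hw : 0 < w) (x : ℝ) : gsinh (w ^ 2) x = Real.sinh (w * x) / w := by
  have h : 0 < w ^ 2 := by positivity
  simp [gsinh, h, hw.ne', Real.sqrt_sq hw.le]

lemma gcosh_neg_sq {w : ℝ} (hw : 0 < w) (x : ℝ) : gcosh (-w ^ 2) x = Real.cos (w * x) := by
  have h : ¬ (0 < -w ^ 2) := by have : 0 < w ^ 2 := by positivity
                                linarith
  simp [gcosh, h, hw.ne', Real.sqrt_sq hw.le]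

lemma gsinh_neg_sq {w : ℝ} (hw : 0 < w) (x : ℝ) : gsinh (-w ^ 2) x = Real.sin (w * x) / w := by
  have h : ¬ (0 < -w ^ 2) := by have : 0 < w ^ 2 := by positivity
                                linarith
  simp [gsinh, h, hw.ne', Real.sqrt_sq hw.le]

/-- One pair of functions serves both signs: `l ≥ 0` for the modes in `x`, `l = -λ` for the
eigenfunctions in `y`. This trichotomy reduces every identity between them to a hyperbolic, a
trigonometric or a polynomial one. -/
lemma eq_zero_or_sq_or_neg_sq (l : ℝ) :
    l = 0 ∨ (∃ w : ℝ, 0 < w ∧ l = w ^ 2) ∨ ∃ w : ℝ, 0 < w ∧ l = -w ^ 2 := by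
  rcases lt_trichotomy l 0 with h | h | h
  · exact Or.inr (Or.inr ⟨√(-l), Real.sqrt_pos.2 (by linarith), by
      rw [Real.sq_sqrt (by linarith)]; ring⟩)
  · exact Or.inl h
  · exact Or.inr (Or.inl ⟨√l, Real.sqrt_pos.2 h, by rw [Real.sq_sqrt h.le]⟩)

lemma eq_zero_or_sq {l : ℝ} (hl : 0 ≤ l) : l = 0 ∨ ∃ w : ℝ, 0 < w ∧ l = w ^ 2 := by
  rcases hl.eq_or_lt with h | h
  · exact Or.inl h.symm
  · exact Or.inr ⟨√l, Real.sqrt_pos.2 h, by rw [Real.sq_sqrt h.le]⟩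

@[simp] lemma gcosh_zero (l : ℝ) : gcosh l 0 = 1 := by simp [gcosh]

@[simp] lemma gsinh_zero (l : ℝ) : gsinh l 0 = 0 := by simp [gsinh]

lemma hasDerivAt_gcosh (l x : ℝ) : HasDerivAt (gcosh l) (l * gsinh l x) x := by
  rcases eq_zero_or_sq_or_neg_sq l with rfl | ⟨w, hw, rfl⟩ | ⟨w, hw, rfl⟩
  · rw [zero_mul]
    exact (hasDerivAt_const x (1 : ℝ)).congr_of_eventuallyEq (.of_forall gcosh_zero_left)
  · have h := ((Real.hasDerivAt_cosh (w * x)).comp x ((hasDerivAt_id x).const_mul w))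
    rw [gsinh_sq hw, show gcosh (w ^ 2) = Real.cosh ∘ (fun y => w * id y) from
      funext fun y => gcosh_sq hw y]
    convert! h using 1
    field_simp
  · have h := ((Real.hasDerivAt_cos (w * x)).comp x ((hasDerivAt_id x).const_mul w))
    rw [gsinh_neg_sq hw, show gcosh (-w ^ 2) = Real.cos ∘ (fun y => w * id y) from
      funext fun y => gcosh_neg_sq hw y]
    convert! h using 1
    field_simp

lemma hasDerivAt_gsinh (l x : ℝ) : HasDerivAt (gsinh l) (gcosh l x) x := by
  rcases eq_zero_or_sq_or_neg_sq l with rfl | ⟨w, hw, rfl⟩ | ⟨w, hw, rfl⟩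
  · rw [gcosh_zero_left]
    exact (hasDerivAt_id x).congr_of_eventuallyEq (.of_forall gsinh_zero_left)
  · have h := ((Real.hasDerivAt_sinh (w * x)).comp x ((hasDerivAt_id x).const_mul w)).div_const w
    rw [gcosh_sq hw, show gsinh (w ^ 2) = (fun y => (Real.sinh ∘ (fun y => w * id y)) y / w) from
      funext fun y => gsinh_sq hw y]
    convert! h using 1
    field_simp
  · have h := ((Real.hasDerivAt_sin (w * x)).comp x ((hasDerivAt_id x).const_mul w)).div_const w
    rw [gcosh_neg_sq hw,
      show gsinh (-w ^ 2) = (fun y => (Real.sin ∘ (fun y => w * id y)) y / w) from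
      funext fun y => gsinh_neg_sq hw y]
    convert! h using 1
    field_simp

lemma gcosh_sq_sub (l x : ℝ) : gcosh l x ^ 2 - l * gsinh l x ^ 2 = 1 := by
  rcases eq_zero_or_sq_or_neg_sq l with rfl | ⟨w, hw, rfl⟩ | ⟨w, hw, rfl⟩
  · simp [gcosh_zero_left]
  · rw [gcosh_sq hw, gsinh_sq hw, Real.cosh_sq]; field_simp; ring
  · rw [gcosh_neg_sq hw, gsinh_neg_sq hw]; field_simp
    linarith [Real.sin_sq_add_cos_sq (w * x)]

lemma gcosh_add (l x y : ℝ) :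
    gcosh l (x + y) = gcosh l x * gcosh l y + l * (gsinh l x * gsinh l y) := by
  rcases eq_zero_or_sq_or_neg_sq l with rfl | ⟨w, hw, rfl⟩ | ⟨w, hw, rfl⟩
  · simp [gcosh_zero_left]
  · simp only [gcosh_sq hw, gsinh_sq hw, mul_add, Real.cosh_add]; field_simp
  · simp only [gcosh_neg_sq hw, gsinh_neg_sq hw, mul_add, Real.cos_add]; field_simp; ring

lemma gsinh_add (l x y : ℝ) :
    gsinh l (x + y) = gsinh l x * gcosh l y + gcosh l x * gsinh l y := by
  rcases eq_zero_or_sq_or_neg_sq l with rfl | ⟨w, hw, rfl⟩ | ⟨w, hw, rfl⟩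
  · simp [gcosh_zero_left, gsinh_zero_left]
  · simp only [gcosh_sq hw, gsinh_sq hw, mul_add, Real.sinh_add]; field_simp
  · simp only [gcosh_neg_sq hw, gsinh_neg_sq hw, mul_add, Real.sin_add]; field_simp

lemma gcosh_neg (l x : ℝ) : gcosh l (-x) = gcosh l x := by simp [gcosh]

lemma gsinh_neg (l x : ℝ) : gsinh l (-x) = -gsinh l x := by
  simp only [gsinh, mul_neg, Real.sinh_neg, Real.sin_neg, neg_div]; split_ifs <;> rfl

lemma continuous_gcosh (l : ℝ) : Continuous (gcosh l) :=
  continuous_iff_continuousAt.2 fun x => (hasDerivAt_gcosh l x).continuousAt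

lemma continuous_gsinh (l : ℝ) : Continuous (gsinh l) :=
  continuous_iff_continuousAt.2 fun x => (hasDerivAt_gsinh l x).continuousAt

section Nonneg

variable {l : ℝ}

lemma one_le_gcosh (hl : 0 ≤ l) (x : ℝ) : 1 ≤ gcosh l x := by
  rcases eq_zero_or_sq hl with rfl | ⟨w, hw, rfl⟩
  · rw [gcosh_zero_left]
  · rw [gcosh_sq hw]; exact Real.one_le_cosh _

lemma gcosh_pos (hl : 0 ≤ l) (x : ℝ) : 0 < gcosh l x := one_pos.trans_le (one_le_gcosh hl x)

lemma strictMono_gsinh (hl : 0 ≤ l) : StrictMono (gsinh l) :=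
  strictMono_of_hasDerivAt_pos (hasDerivAt_gsinh l) (gcosh_pos hl)

lemma gsinh_nonneg (hl : 0 ≤ l) {x : ℝ} (hx : 0 ≤ x) : 0 ≤ gsinh l x := by
  simpa using (strictMono_gsinh hl).monotone hx

lemma gsinh_pos (hl : 0 ≤ l) {x : ℝ} (hx : 0 < x) : 0 < gsinh l x := by
  simpa using strictMono_gsinh hl hx

lemma gcosh_le_gcosh (hl : 0 ≤ l) {x y : ℝ} (h : |x| ≤ |y|) : gcosh l x ≤ gcosh l y := by
  rcases eq_zero_or_sq hl with rfl | ⟨w, hw, rfl⟩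
  · simp [gcosh_zero_left]
  · rw [gcosh_sq hw, gcosh_sq hw, Real.cosh_le_cosh, abs_mul, abs_mul]; gcongr

lemma abs_gsinh (hl : 0 ≤ l) (x : ℝ) : |gsinh l x| = gsinh l |x| := by
  rcases le_total 0 x with h | h
  · rw [abs_of_nonneg h, abs_of_nonneg (gsinh_nonneg hl h)]
  · rw [abs_of_nonpos h, gsinh_neg, abs_of_nonpos]
    have := gsinh_nonneg hl (neg_nonneg.2 h)
    rw [gsinh_neg] at this; linarith

lemma abs_gsinh_le (hl : 0 ≤ l) {x h : ℝ} (hx : |x| ≤ h) : |gsinh l x| ≤ gsinh l h := by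
  rw [abs_gsinh hl]; exact (strictMono_gsinh hl).monotone hx

lemma abs_gcosh_le (hl : 0 ≤ l) {x h : ℝ} (hx : |x| ≤ h) : |gcosh l x| ≤ gcosh l h := by
  rw [abs_of_pos (gcosh_pos hl x)]
  exact gcosh_le_gcosh hl (hx.trans (le_abs_self h))

/-- Expand `0 ≤ gsinh l (h - k)` by the addition formula; this is the monotonicity of tanh, free of
divisions. -/
lemma gsinh_mul_gcosh_le (hl : 0 ≤ l) {k h : ℝ} (hkh : k ≤ h) :
    gsinh l k * gcosh l h ≤ gcosh l k * gsinh l h := by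
  have h1 := gsinh_nonneg hl (sub_nonneg.2 hkh)
  rw [sub_eq_add_neg, gsinh_add, gcosh_neg, gsinh_neg] at h1
  nlinarith

lemma le_gsinh (hl : 0 ≤ l) {x : ℝ} (hx : 0 ≤ x) : x ≤ gsinh l x := by
  rcases eq_zero_or_sq hl with rfl | ⟨w, hw, rfl⟩
  · rw [gsinh_zero_left]
  · rw [gsinh_sq hw, le_div_iff₀ hw, mul_comm]
    exact Real.self_le_sinh_iff.2 (by positivity)

lemma gsinh_le_mul_gcosh (hl : 0 ≤ l) {x : ℝ} (hx : 0 ≤ x) : gsinh l x ≤ x * gcosh l x := by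
  have hmono : MonotoneOn (fun y => y * gcosh l y - gsinh l y) (Ici 0) := by
    apply monotoneOn_of_deriv_nonneg (convex_Ici 0)
    · exact (by have := continuous_gcosh l; have := continuous_gsinh l; fun_prop :
        Continuous _).continuousOn
    · intro y _
      exact (((hasDerivAt_id y).mul (hasDerivAt_gcosh l y)).sub
        (hasDerivAt_gsinh l y)).differentiableAt.differentiableWithinAt
    · intro y hy
      have hd := ((hasDerivAt_id y).mul (hasDerivAt_gcosh l y)).sub (hasDerivAt_gsinh l y)
      have : deriv (fun y => y * gcosh l y - gsinh l y) y = _ := hd.deriv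
      rw [this]
      rw [interior_Ici] at hy
      have := gsinh_nonneg hl (le_of_lt hy)
      have hy' : 0 < y := hy
      simp only [id]
      nlinarith [mul_nonneg hl this, mul_nonneg hy'.le (mul_nonneg hl this)]
  have := hmono (Set.mem_Ici.2 le_rfl) (show x ∈ Ici (0 : ℝ) from hx) hx
  simp at this; linarith

/-- Compare squares: `gcosh² = 1 + l * gsinh²`, where `1 ≤ gsinh l h / h` and `l ≤ (1 + l)²`. The
bound lets the derivative of an odd mode be controlled by its value at the end, at the cost of a
factor of order `1 + l`, which a smooth test function absorbs. -/
lemma gcosh_le_mul_gsinh (hl : 0 ≤ l) {h : ℝ} (hh : 0 < h) :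
    gcosh l h ≤ (1 / h + 1 + l) * gsinh l h := by
  have hS := gsinh_pos hl hh
  have h1 : 1 ≤ (1 / h) * gsinh l h := by
    rw [one_div, ← div_eq_inv_mul, le_div_iff₀ hh, one_mul]; exact le_gsinh hl hh.le
  have hC := gcosh_sq_sub l h
  refine (pow_le_pow_iff_left₀ (gcosh_pos hl h).le (by positivity) two_ne_zero).1 ?_
  have h2 : 0 ≤ l * gsinh l h := by positivity
  have h3 : l ≤ (1 + l) ^ 2 := by nlinarith
  have h4 : l * gsinh l h ^ 2 ≤ (1 + l) ^ 2 * gsinh l h ^ 2 := by gcongr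
  have : ((1 / h + 1 + l) * gsinh l h) ^ 2 = ((1 / h) * gsinh l h) ^ 2
    + 2 * ((1 / h) * gsinh l h) * ((1 + l) * gsinh l h) + (1 + l) ^ 2 * gsinh l h ^ 2 := by ring
  rw [this]
  have h5 : 0 ≤ 2 * ((1 / h) * gsinh l h) * ((1 + l) * gsinh l h) := by positivity
  nlinarith

end Nonneg

/-- Solutions of `z'' = l z` are combinations of `gcosh` and `gsinh`. -/
lemma exists_eq_gcosh_gsinh {l a b : ℝ} (hab : a < b) (c : ℝ) {z V : ℝ → ℂ}
    (hz : ContinuousOn z (Icc a b)) (h1 : ∀ x ∈ Ioo a b, HasDerivAt z (V x) x)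
    (h2 : ∀ x ∈ Ioo a b, HasDerivAt V (l * z x) x) :
    ∃ A B : ℂ, ∀ x ∈ Icc a b, z x = A * gcosh l (x - c) + B * gsinh l (x - c) := by
  have dC (x : ℝ) : HasDerivAt (fun x => (gcosh l (x - c) : ℂ)) (l * gsinh l (x - c) : ℂ) x := by
    have := ((hasDerivAt_gcosh l (x - c)).comp x ((hasDerivAt_id x).sub_const c)).ofReal_comp
    convert! this using 1; simp
  have dS (x : ℝ) : HasDerivAt (fun x => (gsinh l (x - c) : ℂ)) (gcosh l (x - c) : ℂ) x := by
    have := ((hasDerivAt_gsinh l (x - c)).comp x ((hasDerivAt_id x).sub_const c)).ofReal_comp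
    convert! this using 1; simp
  -- Variation of constants: `F` and `G` invert the fundamental matrix, whose determinant is `1`, so
  -- they recover the coefficients `A` and `B` and are constant along a solution.
  set F : ℝ → ℂ := fun x => z x * gcosh l (x - c) - V x * gsinh l (x - c)
  set G : ℝ → ℂ := fun x => V x * gcosh l (x - c) - l * z x * gsinh l (x - c)
  have dF : ∀ x ∈ Ioo a b, HasDerivAt F 0 x := fun x hx => by
    convert! ((h1 x hx).mul (dC x)).sub ((h2 x hx).mul (dS x)) using 1; ring
  have dG : ∀ x ∈ Ioo a b, HasDerivAt G 0 x := fun x hx => by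
    convert! ((h2 x hx).mul (dC x)).sub (((h1 x hx).const_mul (l : ℂ)).mul (dS x)) using 1; ring
  have key : ∀ H : ℝ → ℂ, (∀ x ∈ Ioo a b, HasDerivAt H 0 x) →
      ∀ x ∈ Ioo a b, H x = H ((a + b) / 2) := fun H dH x hx =>
    isOpen_Ioo.is_const_of_deriv_eq_zero isPreconnected_Ioo
      (fun y hy => (dH y hy).differentiableAt.differentiableWithinAt)
      (fun y hy => (dH y hy).deriv) hx ⟨by linarith, by linarith⟩
  refine ⟨F ((a + b) / 2), G ((a + b) / 2), ?_⟩
  have hIoo : EqOn z (fun x => F ((a + b) / 2) * gcosh l (x - c)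
      + G ((a + b) / 2) * gsinh l (x - c)) (Ioo a b) := by
    intro x hx
    simp only
    rw [← key F dF x hx, ← key G dG x hx]
    have := gcosh_sq_sub l (x - c)
    have h' : (gcosh l (x - c) : ℂ) ^ 2 - l * (gsinh l (x - c) : ℂ) ^ 2 = 1 := by exact_mod_cast this
    simp only [F, G]
    linear_combination -z x * h'
  intro x hx
  refine hIoo.of_subset_closure hz ?_ Ioo_subset_Icc_self (by rw [closure_Ioo hab.ne]) hx
  exact (((continuous_const).mul (continuous_iff_continuousAt.2 fun x => (dC x).continuousAt)).add
    ((continuous_const).mul (continuous_iff_continuousAt.2 fun x => (dS x).continuousAt))).continuousOn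

/-! ### The function `rho` and its monotonicity in the eigenvalue -/

/-- Divide numerator and denominator of `rho` by the geometric mean `exp (√l * (L / 2 + δ))` of the
two terms of the denominator. In this form `rho` compares an even mode at the handover line with the
same mode at the end of the subdomain. -/
lemma rho_eq (L δ : ℝ) {l : ℝ} (hl : 0 ≤ l) :
    rho L δ l = gcosh l (L / 2 - δ) / gcosh l (L / 2 + δ) := by
  rcases eq_zero_or_sq hl with rfl | ⟨w, hw, rfl⟩
  · norm_num [rho, gcosh_zero_left]
  · rw [rho, Real.sqrt_sq hw.le, gcosh_sq hw, gcosh_sq hw, Real.cosh_eq, Real.cosh_eq,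
      show w * (L / 2 - δ) = w * L / 2 - w * δ by ring,
      show w * (L / 2 + δ) = w * L / 2 + w * δ by ring,
      show 2 * w * δ = w * δ + w * δ by ring]
    have : w * L = w * L / 2 + w * L / 2 := by ring
    rw [this, show (w * L / 2 + w * L / 2) / 2 = w * L / 2 by ring]
    simp only [Real.exp_add, Real.exp_neg, Real.exp_sub]
    have h1 := Real.exp_pos (w * δ)
    have h2 := Real.exp_pos (w * L / 2)
    rw [div_eq_div_iff (by positivity) (by positivity)]
    field_simp
    ring

/-- Both products become sums of two cosh. The arguments `w' k ± w h` are smaller in absolute value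
than `w' h ± w k`, since the relevant sums and differences factor as `(w' ± w) * (h ± k)`. Only `|k|
< h` enters, whence the validity for `δ ≥ L / 2`. -/
lemma gcosh_mul_gcosh_lt {k h l l' : ℝ} (hk : |k| < h) (hl : 0 ≤ l) (hll : l < l') :
    gcosh l' k * gcosh l h < gcosh l k * gcosh l' h := by
  have hh : 0 < h := (abs_nonneg k).trans_lt hk
  rw [abs_lt] at hk
  rcases eq_zero_or_sq (hl.trans hll.le) with rfl | ⟨w', hw', rfl⟩
  · linarith
  rcases eq_zero_or_sq hl with rfl | ⟨w, hw, rfl⟩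
  · rw [gcosh_zero_left, gcosh_zero_left, mul_one, one_mul, gcosh_sq hw', gcosh_sq hw',
      Real.cosh_lt_cosh, abs_mul, abs_mul, abs_of_pos hw', abs_of_pos hh]
    exact mul_lt_mul_of_pos_left (abs_lt.2 hk) hw'
  · have hww : w < w' := (pow_lt_pow_iff_left₀ hw.le hw'.le two_ne_zero).1 hll
    rw [gcosh_sq hw', gcosh_sq hw', gcosh_sq hw, gcosh_sq hw]
    have e1 : 2 * (Real.cosh (w' * k) * Real.cosh (w * h))
        = Real.cosh (w' * k + w * h) + Real.cosh (w' * k - w * h) := by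
      rw [Real.cosh_add, Real.cosh_sub]; ring
    have e2 : 2 * (Real.cosh (w * k) * Real.cosh (w' * h))
        = Real.cosh (w' * h + w * k) + Real.cosh (w' * h - w * k) := by
      rw [Real.cosh_add, Real.cosh_sub]; ring
    have p1 : 0 < (w' - w) * (h - k) := mul_pos (by linarith) (by linarith)
    have p2 : 0 < (w' - w) * (h + k) := mul_pos (by linarith) (by linarith)
    have p3 : 0 < (w' + w) * (h - k) := mul_pos (by linarith) (by linarith)
    have p4 : 0 < (w' + w) * (h + k) := mul_pos (by linarith) (by linarith)
    have i1 : Real.cosh (w' * k + w * h) < Real.cosh (w' * h + w * k) := by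
      rw [Real.cosh_lt_cosh]
      exact (abs_lt.2 ⟨by nlinarith, by nlinarith⟩).trans_le (le_abs_self _)
    have i2 : Real.cosh (w' * k - w * h) < Real.cosh (w' * h - w * k) := by
      rw [Real.cosh_lt_cosh]
      exact (abs_lt.2 ⟨by nlinarith, by nlinarith⟩).trans_le (le_abs_self _)
    linarith

lemma rho_lt_rho {L δ : ℝ} (hL : 0 < L) (hδ : 0 < δ) {l l' : ℝ} (hl : 0 ≤ l) (hll : l < l') :
    rho L δ l' < rho L δ l := by
  rw [rho_eq L δ hl, rho_eq L δ (hl.trans hll.le),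
    div_lt_div_iff₀ (gcosh_pos (hl.trans hll.le) _) (gcosh_pos hl _)]
  exact gcosh_mul_gcosh_lt (abs_lt.2 ⟨by linarith, by linarith⟩) hl hll

lemma rho_le_rho {L δ : ℝ} (hL : 0 < L) (hδ : 0 < δ) {l l' : ℝ} (hl : 0 ≤ l) (hll : l ≤ l') :
    rho L δ l' ≤ rho L δ l := by
  rcases hll.eq_or_lt with rfl | h
  · rfl
  · exact (rho_lt_rho hL hδ hl h).le

lemma rho_pos (L δ l : ℝ) : 0 < rho L δ l := by unfold rho; positivity

lemma rho_zero (L δ : ℝ) : rho L δ 0 = 1 := by norm_num [rho]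

/-! ### The roots `μ₁`, `τ₁`, `ν₁` and the ordering of the bounds -/

lemma eq_singleton_sInf_of_strictAntiOn {a b : ℝ} (hab : a < b) {f : ℝ → ℝ} (hf : Continuous f)
    (hanti : StrictAntiOn f (Icc a b)) (ha : 0 < f a) (hb : f b < 0) {S : Set ℝ}
    (hS : ∀ x, x ∈ S ↔ x ∈ Ioo a b ∧ f x = 0) : S = {sInf S} := by
  obtain ⟨x, hx, hfx⟩ := intermediate_value_Ioo' hab.le hf.continuousOn (show (0 : ℝ) ∈ Ioo (f b) (f a)
    from ⟨hb, ha⟩)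
  have : S = {x} := by
    ext y
    rw [hS, mem_singleton_iff]
    constructor
    · rintro ⟨hy, hfy⟩
      exact hanti.injOn (Ioo_subset_Icc_self hy) (Ioo_subset_Icc_self hx) (hfy.trans hfx.symm)
    · rintro rfl
      exact ⟨hx, hfx⟩
  rw [this, csInf_singleton]

lemma muRoots_eq {q : ℝ} (hq : 0 < q) : muRoots q = {mu1 q} := by
  have hpi := Real.pi_pos
  refine eq_singleton_sInf_of_strictAntiOn (f := fun x => q * Real.sin x + x * Real.cos x)
    (by linarith : Real.pi / 2 < Real.pi) (by fun_prop) ?_ (by simpa) (by simpa) (fun x => Iff.rfl)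
  refine strictAntiOn_of_deriv_neg (convex_Icc _ _) (by fun_prop) fun x hx => ?_
  rw [interior_Icc] at hx
  have hd : deriv (fun x => q * Real.sin x + x * Real.cos x) x = _ :=
    (((Real.hasDerivAt_sin x).const_mul q).add
      ((hasDerivAt_id x).mul (Real.hasDerivAt_cos x))).deriv
  rw [hd]
  have hc : Real.cos x < 0 := Real.cos_neg_of_pi_div_two_lt_of_lt hx.1 (by linarith [hx.2])
  have hs : 0 < Real.sin x := Real.sin_pos_of_pos_of_lt_pi (by linarith [hx.1]) hx.2
  have hx0 : 0 < x := by linarith [hx.1]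
  simp only [id]
  nlinarith [mul_pos hx0 hs, mul_pos hq (neg_pos.2 hc)]

lemma nuRoots_eq {q : ℝ} (hq : 0 < q) : nuRoots q = {nu1 q} := by
  have hpi := Real.pi_pos
  refine eq_singleton_sInf_of_strictAntiOn (f := fun x => q * Real.cos x - x * Real.sin x)
    (by linarith : 0 < Real.pi / 2) (by fun_prop) ?_ (by simpa) (by simpa)
    (fun x => and_congr_right fun _ => by constructor <;> intro h <;> linarith)
  refine strictAntiOn_of_deriv_neg (convex_Icc _ _) (by fun_prop) fun x hx => ?_
  rw [interior_Icc] at hx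
  have hd : deriv (fun x => q * Real.cos x - x * Real.sin x) x = _ :=
    (((Real.hasDerivAt_cos x).const_mul q).sub
      ((hasDerivAt_id x).mul (Real.hasDerivAt_sin x))).deriv
  rw [hd]
  have hc : 0 < Real.cos x := Real.cos_pos_of_mem_Ioo ⟨by linarith [hx.1], hx.2⟩
  have hs : 0 < Real.sin x := Real.sin_pos_of_pos_of_lt_pi hx.1 (by linarith [hx.2])
  simp only [id]
  nlinarith [mul_pos hx.1 hc, mul_pos hq hs]

/-- The Robin–Robin problem is symmetric about `y = 1/2`, so its characteristic function splits into
an even and an odd factor. On `(0, π)` the odd factor is positive, and the even one is strictly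
decreasing. -/
lemma tau_char_eq (q x : ℝ) : 2 * q * x * Real.cos x + (q ^ 2 - x ^ 2) * Real.sin x =
    2 * (q * Real.cos (x / 2) - x * Real.sin (x / 2)) *
      (x * Real.cos (x / 2) + q * Real.sin (x / 2)) := by
  have h1 : Real.cos x = Real.cos (x / 2) ^ 2 - Real.sin (x / 2) ^ 2 := by
    rw [← Real.cos_two_mul']; ring_nf
  have h2 : Real.sin x = 2 * Real.sin (x / 2) * Real.cos (x / 2) := by
    rw [← Real.sin_two_mul]; ring_nf
  rw [h1, h2]; ring

lemma tauRoots_eq {q : ℝ} (hq : 0 < q) : tauRoots q = {tau1 q} := by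
  have hpi := Real.pi_pos
  refine eq_singleton_sInf_of_strictAntiOn
    (f := fun x => q * Real.cos (x / 2) - x * Real.sin (x / 2)) hpi (by fun_prop) ?_ (by simpa)
    (by simpa) (fun x => and_congr_right fun hx => ?_)
  · refine strictAntiOn_of_deriv_neg (convex_Icc _ _) (by fun_prop) fun x hx => ?_
    rw [interior_Icc] at hx
    have hd2 : HasDerivAt (fun x : ℝ => x / 2) (1 / 2) x := (hasDerivAt_id x).div_const 2
    have hd : HasDerivAt (fun x => q * Real.cos (x / 2) - x * Real.sin (x / 2))
        (q * (-Real.sin (x / 2) * (1 / 2))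
          - (1 * Real.sin (x / 2) + x * (Real.cos (x / 2) * (1 / 2)))) x :=
      (hd2.cos.const_mul q).sub ((hasDerivAt_id' x).mul hd2.sin)
    rw [hd.deriv]
    have hc : 0 < Real.cos (x / 2) := Real.cos_pos_of_mem_Ioo
      ⟨by linarith [hx.1], by linarith [hx.2]⟩
    have hs : 0 < Real.sin (x / 2) := Real.sin_pos_of_pos_of_lt_pi (by linarith [hx.1])
      (by linarith [hx.2])
    nlinarith [mul_pos hx.1 hc, mul_pos hq hs]
  · have hc : 0 < Real.cos (x / 2) := Real.cos_pos_of_mem_Ioo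
      ⟨by linarith [hx.1], by linarith [hx.2]⟩
    have hs : 0 < Real.sin (x / 2) := Real.sin_pos_of_pos_of_lt_pi (by linarith [hx.1])
      (by linarith [hx.2])
    have hp : 0 < x * Real.cos (x / 2) + q * Real.sin (x / 2) :=
      add_pos (mul_pos hx.1 hc) (mul_pos hq hs)
    rw [tau_char_eq]
    simp [hp.ne']

lemma mu1_mem {q : ℝ} (hq : 0 < q) : mu1 q ∈ muRoots q := by rw [muRoots_eq hq]; rfl

lemma tau1_mem {q : ℝ} (hq : 0 < q) : tau1 q ∈ tauRoots q := by rw [tauRoots_eq hq]; rfl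

lemma nu1_mem {q : ℝ} (hq : 0 < q) : nu1 q ∈ nuRoots q := by rw [nuRoots_eq hq]; rfl

lemma lambda1_nonneg (bc : External) (q : ℝ) : 0 ≤ lambda1 bc q := by
  cases bc <;> simp only [lambda1] <;> positivity

lemma rhoExt_chain {L δ q : ℝ} (hL : 0 < L) (hδ : 0 < δ) (hq : 0 < q) :
    (rhoExt .DD L δ q < rhoExt .DR L δ q ∧ rhoExt .DR L δ q < rhoExt .DN L δ q ∧
      rhoExt .DN L δ q < rhoExt .NR L δ q ∧ rhoExt .NR L δ q < rhoExt .NN L δ q ∧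
      rhoExt .NN L δ q = 1) ∧
    (rhoExt .DD L δ q < rhoExt .RR L δ q ∧ rhoExt .RR L δ q < rhoExt .NN L δ q) := by
  have hpi := Real.pi_pos
  have hm := (mu1_mem hq).1
  have ht := (tau1_mem hq).1
  have hn := (nu1_mem hq).1
  have key : ∀ b b' : External, lambda1 b' q < lambda1 b q → rhoExt b L δ q < rhoExt b' L δ q :=
    fun b b' h => rho_lt_rho hL hδ (lambda1_nonneg b' q) h
  refine ⟨⟨key _ _ ?_, key _ _ ?_, key _ _ ?_, key _ _ ?_, rho_zero L δ⟩, key _ _ ?_, key _ _ ?_⟩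
  · exact pow_lt_pow_left₀ hm.2 (by linarith [hm.1]) two_ne_zero
  · have := pow_lt_pow_left₀ hm.1 (by linarith) two_ne_zero
    simp only [lambda1]; nlinarith
  · have := pow_lt_pow_left₀ hn.2 hn.1.le two_ne_zero
    simp only [lambda1]; nlinarith
  · exact pow_pos hn.1 2
  · exact pow_lt_pow_left₀ ht.2 ht.1.le two_ne_zero
  · exact pow_pos ht.1 2

lemma rhoExt_lt_one {L δ q : ℝ} (hL : 0 < L) (hδ : 0 < δ) (hq : 0 < q) {bc : External}
    (hbc : bc ≠ .NN) : rhoExt bc L δ q < 1 := by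
  obtain ⟨⟨h1, h2, h3, h4, h5⟩, h6, h7⟩ := rhoExt_chain hL hδ hq
  cases bc
  · linarith
  · linarith
  · linarith
  · linarith
  · linarith
  · exact absurd rfl hbc

/-! ### The characteristic function and the smallest eigenvalue -/

/-- Coefficient of the value in an external condition. -/
def Kind.valCoeff (q : ℝ) : Kind → ℝ
  | .dirichlet => 1
  | .robin => q
  | .neumann => 0

/-- Coefficient of the inward or outward derivative in an external condition. -/
def Kind.derivCoeff : Kind → ℝ
  | .dirichlet => 0
  | .robin => 1
  | .neumann => 1

/-- A common form `s φ - t φ' = 0` with `(s, t) ≠ 0` lets the six configurations be treated without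
distinguishing cases until the final root analysis. -/
lemma bottomOp_eq_zero_iff (q : ℝ) (k : Kind) (φ : ℝ → ℂ) :
    bottomOp q k φ = 0 ↔ (k.valCoeff q : ℂ) * φ 0 - (k.derivCoeff : ℂ) * deriv φ 0 = 0 := by
  cases k <;> simp [bottomOp, Kind.valCoeff, Kind.derivCoeff]

lemma topOp_eq_zero_iff (q : ℝ) (k : Kind) (φ : ℝ → ℂ) :
    topOp q k φ = 0 ↔ (k.valCoeff q : ℂ) * φ 1 + (k.derivCoeff : ℂ) * deriv φ 1 = 0 := by
  cases k <;> simp [topOp, Kind.valCoeff, Kind.derivCoeff]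

/-- The characteristic function: its zeros `l` are the negatives of the eigenvalues. -/
noncomputable def charFn (bc : External) (q l : ℝ) : ℝ :=
  bc.top.valCoeff q *
      (bc.bottom.derivCoeff * gcosh l 1 + bc.bottom.valCoeff q * gsinh l 1)
    + bc.top.derivCoeff *
      (bc.bottom.derivCoeff * (l * gsinh l 1) + bc.bottom.valCoeff q * gcosh l 1)

lemma hasDerivAt_gcosh_ofReal (l x : ℝ) :
    HasDerivAt (fun y => (gcosh l y : ℂ)) (l * gsinh l x : ℂ) x := by
  simpa using (hasDerivAt_gcosh l x).ofReal_comp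

lemma hasDerivAt_gsinh_ofReal (l x : ℝ) :
    HasDerivAt (fun y => (gsinh l y : ℂ)) (gcosh l x : ℂ) x :=
  (hasDerivAt_gsinh l x).ofReal_comp

lemma hasDerivAt_comb (A B : ℂ) (l x : ℝ) :
    HasDerivAt (fun y => A * gcosh l y + B * gsinh l y)
      (B * gcosh l x + (l * A) * gsinh l x) x := by
  convert! ((hasDerivAt_gcosh_ofReal l x).const_mul A).add
    ((hasDerivAt_gsinh_ofReal l x).const_mul B) using 1
  ring

lemma deriv_comb (A B : ℂ) (l : ℝ) : deriv (fun y => A * gcosh l y + B * gsinh l y) =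
    fun y => B * gcosh l y + (l * A) * gsinh l y :=
  funext fun x => (hasDerivAt_comb A B l x).deriv

lemma contDiff_comb (A B : ℂ) (l : ℝ) :
    ContDiff ℝ 2 (fun y => A * gcosh l y + B * gsinh l y) := by
  have hd : ∀ A B : ℂ, Differentiable ℝ (fun y => A * (gcosh l y : ℂ) + B * gsinh l y) :=
    fun A B x => (hasDerivAt_comb A B l x).differentiableAt
  rw [show (2 : WithTop ℕ∞) = 1 + 1 by norm_num, contDiff_succ_iff_deriv]
  refine ⟨hd A B, by simp, ?_⟩
  rw [deriv_comb, contDiff_one_iff_deriv]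
  refine ⟨hd _ _, ?_⟩
  rw [deriv_comb]
  exact (hd _ _).continuous

lemma coeff_sq_pos {q : ℝ} (hq : 0 < q) (k : Kind) :
    0 < k.valCoeff q ^ 2 + k.derivCoeff ^ 2 := by
  cases k <;> simp [Kind.valCoeff, Kind.derivCoeff]; positivity

lemma charFn_neg_eq_zero_of_mem {bc : External} {q l : ℝ} (hq : 0 < q)
    (h : l ∈ eigenvalues bc q) : charFn bc q (-l) = 0 := by
  obtain ⟨φ, ⟨hC2, hb, ht⟩, hode, y, hy, hne⟩ := h
  have hd : Differentiable ℝ φ := hC2.differentiable (by norm_num)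
  have hC1 : ContDiff ℝ 1 (deriv φ) :=
    ((contDiff_succ_iff_deriv (n := 1)).1 (by norm_num; exact hC2)).2.2
  have hdd : Differentiable ℝ (deriv φ) := hC1.differentiable (by norm_num)
  obtain ⟨A, B, hAB⟩ := exists_eq_gcosh_gsinh (l := -l) zero_lt_one 0 (z := φ) (V := deriv φ)
    hd.continuous.continuousOn (fun x _ => (hd x).hasDerivAt)
    (fun x hx => by
      have := (hdd x).hasDerivAt
      rw [hode x hx] at this
      push_cast; exact this)
  simp only [sub_zero] at hAB
  -- The formula for `φ` is known only on `[0,1]`, while the external conditions use two-sided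
  -- derivatives at `0` and `1`; differentiability of `φ` lets these be computed as one-sided ones.
  have hD : ∀ x ∈ Icc (0 : ℝ) 1, deriv φ x = B * gcosh (-l) x + ((-l : ℝ) * A) * gsinh (-l) x := by
    intro x hx
    have hu : UniqueDiffWithinAt ℝ (Icc (0 : ℝ) 1) x := uniqueDiffOn_Icc zero_lt_one x hx
    rw [← (hd x).derivWithin hu, derivWithin_congr hAB (hAB x hx),
      (hasDerivAt_comb A B (-l) x).hasDerivWithinAt.derivWithin hu]
  rw [bottomOp_eq_zero_iff] at hb
  rw [topOp_eq_zero_iff] at ht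
  rw [hAB 0 (by simp), hD 0 (by simp)] at hb
  rw [hAB 1 (by simp), hD 1 (by simp)] at ht
  simp only [gcosh_zero, gsinh_zero, Complex.ofReal_one, Complex.ofReal_zero, mul_one, mul_zero,
    add_zero] at hb
  set s := bc.bottom.valCoeff q
  set t := bc.bottom.derivCoeff
  have hst : 0 < s ^ 2 + t ^ 2 := coeff_sq_pos hq bc.bottom
  have hstC : ((s : ℂ) ^ 2 + (t : ℂ) ^ 2) ≠ 0 := by exact_mod_cast hst.ne'
  -- The bottom condition `s A = t B` says that `(A, B)` is a multiple of `(t, s)`; the factor `c`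
  -- is found by projecting on that vector.
  set c : ℂ := (t * A + s * B) / (s ^ 2 + t ^ 2)
  have hA : A = c * t := by
    simp only [c]; field_simp; linear_combination (s : ℂ) * hb
  have hB : B = c * s := by
    simp only [c]; field_simp; linear_combination (-(t : ℂ)) * hb
  have hc : c ≠ 0 := by
    rintro hc
    apply hne
    rw [hAB y (Ioo_subset_Icc_self hy), hA, hB, hc]; simp
  have : c * (charFn bc q (-l) : ℂ) = 0 := by
    rw [← ht, hA, hB, charFn]; push_cast; ring
  exact_mod_cast (mul_eq_zero.1 this).resolve_left hc

lemma mem_eigenvalues_of_charFn {bc : External} {q l : ℝ} (hq : 0 < q)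
    (h : charFn bc q (-l) = 0) : l ∈ eigenvalues bc q := by
  set s := bc.bottom.valCoeff q
  set t := bc.bottom.derivCoeff
  have hst : 0 < s ^ 2 + t ^ 2 := coeff_sq_pos hq bc.bottom
  refine ⟨fun y => (t : ℂ) * gcosh (-l) y + (s : ℂ) * gsinh (-l) y, ⟨contDiff_comb _ _ _, ?_, ?_⟩,
    ?_, ?_⟩
  · rw [bottomOp_eq_zero_iff, deriv_comb]; simp [s, t]; ring
  · rw [topOp_eq_zero_iff, deriv_comb]
    have : (charFn bc q (-l) : ℂ) = 0 := by exact_mod_cast h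
    rw [← this, charFn]; push_cast; simp only [s, t]; ring
  · intro y _
    rw [deriv_comb, deriv_comb]; push_cast; ring
  · by_contra! hcon
    have hz : ∀ y ∈ Ioo (0 : ℝ) 1, t * gcosh (-l) y + s * gsinh (-l) y = 0 :=
      fun y hy => by exact_mod_cast hcon y hy
    have hz' : ∀ y ∈ Ioo (0 : ℝ) 1, t * (-l * gsinh (-l) y) + s * gcosh (-l) y = 0 := by
      intro y hy
      have hd := ((hasDerivAt_gcosh (-l) y).const_mul t).add
        ((hasDerivAt_gsinh (-l) y).const_mul s)
      have h0 : (fun y => t * gcosh (-l) y + s * gsinh (-l) y) =ᶠ[nhds y] fun _ => 0 :=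
        Filter.eventually_of_mem (isOpen_Ioo.mem_nhds hy) hz
      exact hd.unique ((hasDerivAt_const y (0 : ℝ)).congr_of_eventuallyEq h0)
    have hy : (1 / 2 : ℝ) ∈ Ioo (0 : ℝ) 1 := by norm_num
    have e1 := hz _ hy
    have e2 := hz' _ hy
    have e3 := gcosh_sq_sub (-l) (1 / 2)
    -- The vanishing of the function and of its derivative is a linear system for `(t, s)` whose
    -- determinant is `1`, by `e3`.
    have ht : t = 0 := by
      linear_combination gcosh (-l) (1 / 2) * e1 - gsinh (-l) (1 / 2) * e2 - t * e3
    have hs : s = 0 := by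
      linear_combination gcosh (-l) (1 / 2) * e2 + l * gsinh (-l) (1 / 2) * e1 - s * e3
    rw [ht, hs] at hst; norm_num at hst

/-- For `l > 0` every term of `charFn` is nonnegative and at least one is positive: the Robin sign
makes the boundary energy nonnegative. This rules out negative eigenvalues. -/
lemma charFn_pos_of_pos {bc : External} {q l : ℝ} (hq : 0 < q) (hl : 0 < l) :
    0 < charFn bc q l := by
  have h1 := gcosh_pos hl.le 1
  have h2 := gsinh_pos hl.le zero_lt_one
  cases bc <;> simp [charFn, External.bottom, External.top, Kind.valCoeff, Kind.derivCoeff] <;>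
    positivity

lemma charFn_zero_pos {bc : External} {q : ℝ} (hq : 0 < q) (hbc : bc ≠ .NN) :
    0 < charFn bc q 0 := by
  cases bc <;> simp [charFn, External.bottom, External.top, Kind.valCoeff, Kind.derivCoeff,
    gcosh_zero_left, gsinh_zero_left] at hbc ⊢ <;> positivity

lemma isLeast_eigenvalues_of {bc : External} {q w₁ : ℝ} (hq : 0 < q) (hbc : bc ≠ .NN)
    (hw₁ : 0 < w₁) (hroot : charFn bc q (-w₁ ^ 2) = 0)
    (hlt : ∀ w, 0 < w → w < w₁ → charFn bc q (-w ^ 2) ≠ 0) :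
    IsLeast (eigenvalues bc q) (w₁ ^ 2) := by
  refine ⟨mem_eigenvalues_of_charFn hq hroot, fun l hl => ?_⟩
  have h0 := charFn_neg_eq_zero_of_mem hq hl
  by_contra! hlw
  rcases lt_trichotomy l 0 with h | rfl | h
  · exact (charFn_pos_of_pos hq (neg_pos.2 h)).ne' h0
  · rw [neg_zero] at h0
    exact (charFn_zero_pos hq hbc).ne' h0
  · refine hlt (√l) (Real.sqrt_pos.2 h) ?_ (by rwa [Real.sq_sqrt h.le])
    rw [Real.sqrt_lt h.le hw₁.le]; exact hlw

lemma isLeast_eigenvalues {q : ℝ} (hq : 0 < q) (bc : External) :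
    IsLeast (eigenvalues bc q) (lambda1 bc q) := by
  have hpi := Real.pi_pos
  cases bc
  case NN =>
    refine ⟨mem_eigenvalues_of_charFn hq ?_, fun l hl => ?_⟩
    · simp [lambda1, charFn, External.bottom, External.top, Kind.valCoeff, Kind.derivCoeff]
    · by_contra! h
      exact (charFn_pos_of_pos hq (neg_pos.2 h)).ne' (charFn_neg_eq_zero_of_mem hq hl)
  case DD =>
    refine isLeast_eigenvalues_of hq (by simp) hpi ?_ fun w hw hw' => ?_
    · simp [charFn, External.bottom, External.top, Kind.valCoeff, Kind.derivCoeff,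
        gsinh_neg_sq hpi]
    · simp [charFn, External.bottom, External.top, Kind.valCoeff, Kind.derivCoeff,
        gsinh_neg_sq hw, hw.ne', (Real.sin_pos_of_pos_of_lt_pi hw hw').ne']
  case DN =>
    rw [lambda1, show Real.pi ^ 2 / 4 = (Real.pi / 2) ^ 2 by ring]
    refine isLeast_eigenvalues_of hq (by simp) (by positivity) ?_ fun w hw hw' => ?_
    · rw [charFn, gcosh_neg_sq (by positivity)]
      simp [External.bottom, External.top, Kind.valCoeff, Kind.derivCoeff]
    · rw [charFn, gcosh_neg_sq hw]
      simp [External.bottom, External.top, Kind.valCoeff, Kind.derivCoeff,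
        (Real.cos_pos_of_mem_Ioo ⟨by linarith, hw'⟩).ne']
  case DR =>
    obtain ⟨hm, hr⟩ := mu1_mem hq
    have h0 : 0 < mu1 q := by linarith [hm.1]
    have e : ∀ w, 0 < w → w * charFn .DR q (-w ^ 2) = q * Real.sin w + w * Real.cos w := by
      intro w hw
      rw [charFn, gcosh_neg_sq hw, gsinh_neg_sq hw]
      simp [External.bottom, External.top, Kind.valCoeff, Kind.derivCoeff]
      field_simp
    refine isLeast_eigenvalues_of hq (by simp) h0 ?_ fun w hw hw' h => ?_
    · exact (mul_eq_zero.1 ((e _ h0).trans hr)).resolve_left h0.ne'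
    · have := e w hw
      rw [h, mul_zero] at this
      have hs := Real.sin_pos_of_pos_of_lt_pi hw (by linarith [hm.2])
      -- Uniqueness of `mu1` concerns `(π/2, π)` only; for smaller `w` the sine term is positive and
      -- the cosine term nonnegative.
      rcases le_or_gt w (Real.pi / 2) with h2 | h2
      · have hc := Real.cos_nonneg_of_neg_pi_div_two_le_of_le (by linarith) h2
        nlinarith [mul_pos hq hs, mul_nonneg hw.le hc]
      · have : w ∈ muRoots q := ⟨⟨h2, by linarith [hm.2]⟩, this.symm⟩
        rw [muRoots_eq hq] at this
        exact hw'.ne this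
  case RR =>
    obtain ⟨hm, hr⟩ := tau1_mem hq
    have h0 := hm.1
    have e : ∀ w, 0 < w → w * charFn .RR q (-w ^ 2) =
        2 * q * w * Real.cos w + (q ^ 2 - w ^ 2) * Real.sin w := by
      intro w hw
      rw [charFn, gcosh_neg_sq hw, gsinh_neg_sq hw]
      simp [External.bottom, External.top, Kind.valCoeff, Kind.derivCoeff]
      field_simp; ring
    refine isLeast_eigenvalues_of hq (by simp) h0 ?_ fun w hw hw' h => ?_
    · exact (mul_eq_zero.1 ((e _ h0).trans hr)).resolve_left h0.ne'
    · have := e w hw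
      rw [h, mul_zero] at this
      have : w ∈ tauRoots q := ⟨⟨hw, by linarith [hm.2]⟩, this.symm⟩
      rw [tauRoots_eq hq] at this
      exact hw'.ne this
  case NR =>
    obtain ⟨hm, hr⟩ := nu1_mem hq
    have h0 := hm.1
    have e : ∀ w, 0 < w → charFn .NR q (-w ^ 2) =
        -(w * Real.sin w - q * Real.cos w) := by
      intro w hw
      rw [charFn, gcosh_neg_sq hw, gsinh_neg_sq hw]
      simp [External.bottom, External.top, Kind.valCoeff, Kind.derivCoeff]
      field_simp; ring
    refine isLeast_eigenvalues_of hq (by simp) h0 ?_ fun w hw hw' h => ?_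
    · rw [e _ h0, hr, neg_zero]
    · have := e w hw
      rw [h] at this
      have : w ∈ nuRoots q := ⟨⟨hw, by linarith [hm.2]⟩, by linarith⟩
      rw [nuRoots_eq hq] at this
      exact hw'.ne this

/-! ### Integral operators with continuous kernels: compactness and symmetry -/

lemma integrable_L2Y (u : L2Y) : Integrable u (volume.restrict (Ioo (0 : ℝ) 1)) :=
  (Lp.memLp u).integrable one_le_two

lemma integral_norm_le_norm (u : L2Y) : ∫ y in Ioo (0 : ℝ) 1, ‖u y‖ ≤ ‖u‖ := by
  have : IsProbabilityMeasure (volume.restrict (Ioo (0 : ℝ) 1)) := ⟨by simp⟩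
  rw [integral_norm_eq_lintegral_enorm (Lp.aestronglyMeasurable u), ← eLpNorm_one_eq_lintegral_enorm,
    Lp.norm_def]
  exact ENNReal.toReal_mono (Lp.eLpNorm_ne_top u)
    (eLpNorm_le_eLpNorm_of_exponent_le one_le_two (Lp.aestronglyMeasurable u))

/-- The value at `y` of the integral operator on `(0,1)` with kernel `G`. -/
noncomputable def kerFun (G : ℝ → ℝ → ℝ) (u : ℝ → ℂ) (y : ℝ) : ℂ :=
  ∫ t in Ioo (0 : ℝ) 1, (G y t : ℂ) * u t

section Kernel

variable {G : ℝ → ℝ → ℝ}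

lemma integrable_kernel_mul (hG : Continuous (Function.uncurry G)) {M : ℝ}
    (hM : ∀ y t, |G y t| ≤ M) (u : L2Y) (y : ℝ) :
    Integrable (fun t => (G y t : ℂ) * u t) (volume.restrict (Ioo (0 : ℝ) 1)) := by
  refine (integrable_L2Y u).bdd_mul (c := M) ?_ (Filter.Eventually.of_forall fun t => ?_)
  · have : Continuous fun t => (G y t : ℂ) :=
      Complex.continuous_ofReal.comp (hG.comp (Continuous.prodMk_right y))
    exact this.aestronglyMeasurable
  · simpa using hM y t

lemma norm_kerFun_le (hG : Continuous (Function.uncurry G)) {M : ℝ}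
    (hM : ∀ y t, |G y t| ≤ M) (u : L2Y) (y : ℝ) : ‖kerFun G u y‖ ≤ M * ‖u‖ := by
  have hM0 : 0 ≤ M := (abs_nonneg _).trans (hM 0 0)
  calc ‖kerFun G u y‖ ≤ ∫ t in Ioo (0 : ℝ) 1, ‖(G y t : ℂ) * u t‖ := norm_integral_le_integral_norm _
    _ ≤ ∫ t in Ioo (0 : ℝ) 1, M * ‖u t‖ := by
      refine integral_mono (integrable_kernel_mul hG hM u y).norm
        ((integrable_L2Y u).norm.const_mul M) fun t => ?_
      simp only [norm_mul, Complex.norm_real, Real.norm_eq_abs]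
      exact mul_le_mul_of_nonneg_right (hM y t) (norm_nonneg _)
    _ ≤ M * ‖u‖ := by
      rw [integral_const_mul]
      exact mul_le_mul_of_nonneg_left (integral_norm_le_norm u) hM0

lemma norm_kerFun_sub_le (hG : Continuous (Function.uncurry G)) {M : ℝ}
    (hM : ∀ y t, |G y t| ≤ M) (u : L2Y) {y y' ε : ℝ} (hε : 0 ≤ ε)
    (h : ∀ t ∈ Ioo (0 : ℝ) 1, |G y t - G y' t| ≤ ε) :
    ‖kerFun G u y - kerFun G u y'‖ ≤ ε * ‖u‖ := by
  have hi := (integrable_kernel_mul hG hM u y).sub (integrable_kernel_mul hG hM u y')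
  rw [kerFun, kerFun, ← integral_sub (integrable_kernel_mul hG hM u y)
    (integrable_kernel_mul hG hM u y')]
  calc _ ≤ ∫ t in Ioo (0 : ℝ) 1, ‖(G y t : ℂ) * u t - (G y' t : ℂ) * u t‖ :=
        norm_integral_le_integral_norm _
    _ ≤ ∫ t in Ioo (0 : ℝ) 1, ε * ‖u t‖ := by
      refine setIntegral_mono_on hi.norm ((integrable_L2Y u).norm.const_mul ε)
        measurableSet_Ioo fun t ht => ?_
      rw [← sub_mul, norm_mul, ← Complex.ofReal_sub, Complex.norm_real, Real.norm_eq_abs]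
      exact mul_le_mul_of_nonneg_right (h t ht) (norm_nonneg _)
    _ ≤ ε * ‖u‖ := by
      rw [integral_const_mul]
      exact mul_le_mul_of_nonneg_left (integral_norm_le_norm u) hε

/-- Values of the kernel operator vary with `y` uniformly on bounded sets of `L²`. -/
lemma exists_nhds_norm_kerFun_sub_le (hG : Continuous (Function.uncurry G)) {M : ℝ}
    (hM : ∀ y t, |G y t| ≤ M) (y₀ : Icc (0 : ℝ) 1) {ε : ℝ} (hε : 0 < ε) :
    ∀ᶠ y : Icc (0 : ℝ) 1 in nhds y₀, ∀ u : L2Y, ‖kerFun G u y - kerFun G u y₀‖ ≤ ε * ‖u‖ := by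
  -- Currying the kernel on the compact square gives a continuous map into the sup-norm space, so `G
  -- y t` is close to `G y₀ t` uniformly in `t`; this makes the estimate uniform in `u`.
  let g : C(Icc (0 : ℝ) 1 × Icc (0 : ℝ) 1, ℝ) :=
    ⟨fun p => G p.1 p.2, hG.comp (by fun_prop : Continuous fun p : Icc (0 : ℝ) 1 × Icc (0 : ℝ) 1 =>
      ((p.1 : ℝ), (p.2 : ℝ)))⟩
  have hc : Continuous g.curry := g.curry.continuous
  have := Metric.tendsto_nhds.1 (hc.tendsto y₀) ε hε
  filter_upwards [this] with y hy u
  refine norm_kerFun_sub_le hG hM u hε.le fun t ht => ?_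
  have h1 := ContinuousMap.dist_apply_le_dist (f := g.curry y) (g := g.curry y₀)
    ⟨t, Ioo_subset_Icc_self ht⟩
  rw [Real.dist_eq] at h1
  exact h1.trans hy.le

lemma continuous_kerFun_Icc (hG : Continuous (Function.uncurry G)) {M : ℝ}
    (hM : ∀ y t, |G y t| ≤ M) (u : L2Y) : Continuous fun y : Icc (0 : ℝ) 1 => kerFun G u y := by
  refine continuous_iff_continuousAt.2 fun y₀ => Metric.tendsto_nhds.2 fun ε hε => ?_
  have hpos : 0 < ‖u‖ + 1 := by positivity
  filter_upwards [exists_nhds_norm_kerFun_sub_le hG hM y₀ (div_pos hε hpos)] with y hy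
  rw [dist_eq_norm]
  refine (hy u).trans_lt ?_
  rw [div_mul_eq_mul_div, div_lt_iff₀ hpos]
  nlinarith

/-- The kernel operator, with values in the continuous functions on `[0,1]`. -/
noncomputable def kerBCF (hG : Continuous (Function.uncurry G)) {M : ℝ}
    (hM : ∀ y t, |G y t| ≤ M) : L2Y →L[ℂ] BoundedContinuousFunction (Icc (0 : ℝ) 1) ℂ :=
  LinearMap.mkContinuous
    { toFun := fun u => BoundedContinuousFunction.mkOfCompact
        ⟨fun y : Icc (0 : ℝ) 1 => kerFun G u y, continuous_kerFun_Icc hG hM u⟩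
      map_add' := fun u v => by
        ext y
        simp only [BoundedContinuousFunction.mkOfCompact_apply, ContinuousMap.coe_mk,
          BoundedContinuousFunction.coe_add, Pi.add_apply]
        rw [kerFun, kerFun, kerFun, ← integral_add (integrable_kernel_mul hG hM u y)
          (integrable_kernel_mul hG hM v y)]
        refine integral_congr_ae ?_
        filter_upwards [Lp.coeFn_add u v] with t ht
        rw [ht, Pi.add_apply, mul_add]
      map_smul' := fun c u => by
        ext y
        simp only [BoundedContinuousFunction.mkOfCompact_apply, ContinuousMap.coe_mk,
          BoundedContinuousFunction.coe_smul, RingHom.id_apply, smul_eq_mul]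
        rw [kerFun, kerFun, ← integral_const_mul]
        refine integral_congr_ae ?_
        filter_upwards [Lp.coeFn_smul c u] with t ht
        rw [ht, Pi.smul_apply, smul_eq_mul]; ring }
    M fun u => by
      have hM0 : 0 ≤ M := (abs_nonneg _).trans (hM 0 0)
      exact (BoundedContinuousFunction.norm_le (by positivity)).2 fun y => norm_kerFun_le hG hM u y

lemma kerBCF_apply (hG : Continuous (Function.uncurry G)) {M : ℝ}
    (hM : ∀ y t, |G y t| ≤ M) (u : L2Y) (y : Icc (0 : ℝ) 1) :
    kerBCF hG hM u y = kerFun G u y := rfl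

lemma memLp_of_bcf (f : BoundedContinuousFunction (Icc (0 : ℝ) 1) ℂ) :
    MemLp (fun y => f (projIcc 0 1 zero_le_one y)) 2 (volume.restrict (Ioo (0 : ℝ) 1)) :=
  MemLp.of_bound (f.continuous.comp continuous_projIcc).aestronglyMeasurable ‖f‖
    (Filter.Eventually.of_forall fun _ => f.norm_coe_le_norm _)

/-- The embedding of the continuous functions on `[0,1]` into `L²(0,1)`. -/
noncomputable def bcfToL2 : BoundedContinuousFunction (Icc (0 : ℝ) 1) ℂ →L[ℂ] L2Y :=
  LinearMap.mkContinuous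
    { toFun := fun f => (memLp_of_bcf f).toLp
      map_add' := fun f g => (MemLp.toLp_add (memLp_of_bcf f) (memLp_of_bcf g))
      map_smul' := fun c f => (MemLp.toLp_const_smul c (memLp_of_bcf f)) }
    1 fun f => by
      have : IsProbabilityMeasure (volume.restrict (Ioo (0 : ℝ) 1)) := ⟨by simp⟩
      have h := Lp.norm_le_of_ae_bound (f := (memLp_of_bcf f).toLp) (C := ‖f‖) (norm_nonneg f) (by
        filter_upwards [(memLp_of_bcf f).coeFn_toLp] with y hy
        rw [hy]; exact f.norm_coe_le_norm _)
      have h1 : measureUnivNNReal (volume.restrict (Ioo (0 : ℝ) 1)) = 1 := by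
        simp [measureUnivNNReal]
      rw [h1] at h
      simpa using h

/-- The integral operator on `L²(0,1)` with a continuous bounded kernel. -/
noncomputable def kerOp (hG : Continuous (Function.uncurry G)) {M : ℝ}
    (hM : ∀ y t, |G y t| ≤ M) : L2Y →L[ℂ] L2Y := bcfToL2.comp (kerBCF hG hM)

lemma kerOp_ae (hG : Continuous (Function.uncurry G)) {M : ℝ}
    (hM : ∀ y t, |G y t| ≤ M) (u : L2Y) :
    kerOp hG hM u =ᵐ[volume.restrict (Ioo (0 : ℝ) 1)] kerFun G u := by
  filter_upwards [(memLp_of_bcf (kerBCF hG hM u)).coeFn_toLp, ae_restrict_mem measurableSet_Ioo]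
    with y hy hy'
  have : kerOp hG hM u = (memLp_of_bcf (kerBCF hG hM u)).toLp := rfl
  rw [this, hy, kerBCF_apply, projIcc_of_mem _ (Ioo_subset_Icc_self hy')]

lemma isCompactOperator_kerOp (hG : Continuous (Function.uncurry G)) {M : ℝ}
    (hM : ∀ y t, |G y t| ≤ M) : IsCompactOperator (kerOp hG hM) := by
  have hM0 : 0 ≤ M := (abs_nonneg _).trans (hM 0 0)
  -- Compactness is proved in the sup norm by Arzelà–Ascoli, then carried to `L²` by the continuous
  -- embedding through which `kerOp` factors.
  have hcomp : IsCompact (closure (kerBCF hG hM '' Metric.closedBall 0 1)) := by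
    refine BoundedContinuousFunction.arzela_ascoli (Metric.closedBall 0 M)
      (isCompact_closedBall _ _) _ ?_ ?_
    · rintro _ x ⟨u, hu, rfl⟩
      rw [mem_closedBall_zero_iff] at hu ⊢
      exact (norm_kerFun_le hG hM u x).trans (mul_le_of_le_one_right hM0 hu)
    · intro y₀
      rw [Metric.equicontinuousAt_iff_right]
      intro ε hε
      filter_upwards [exists_nhds_norm_kerFun_sub_le hG hM y₀ (half_pos hε)] with y hy
      rintro ⟨_, u, hu, rfl⟩
      rw [mem_closedBall_zero_iff] at hu
      rw [dist_comm, dist_eq_norm]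
      exact ((hy u).trans (mul_le_of_le_one_right (half_pos hε).le hu)).trans_lt (half_lt_self hε)
  rw [isCompactOperator_iff_exists_mem_nhds_image_subset_compact]
  refine ⟨Metric.closedBall 0 1, Metric.closedBall_mem_nhds _ one_pos,
    bcfToL2 '' closure (kerBCF hG hM '' Metric.closedBall 0 1), hcomp.image bcfToL2.continuous, ?_⟩
  rintro _ ⟨u, hu, rfl⟩
  exact ⟨_, subset_closure ⟨u, hu, rfl⟩, rfl⟩

lemma isSymmetric_kerOp (hG : Continuous (Function.uncurry G)) {M : ℝ}
    (hM : ∀ y t, |G y t| ≤ M) (hsymm : ∀ y t, G y t = G t y) :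
    (kerOp hG hM : L2Y →ₗ[ℂ] L2Y).IsSymmetric := by
  intro u v
  have e1 : inner ℂ (kerOp hG hM u) v = ∫ y in Ioo (0 : ℝ) 1, ∫ t in Ioo (0 : ℝ) 1,
      (G y t : ℂ) * (starRingEnd ℂ (u t) * v y) := by
    rw [L2.inner_def]
    refine integral_congr_ae ?_
    filter_upwards [kerOp_ae hG hM u] with y hy
    rw [hy, RCLike.inner_apply, kerFun, ← integral_conj, ← integral_const_mul]
    refine integral_congr_ae (Filter.Eventually.of_forall fun t => ?_)
    simp; ring
  have e2 : inner ℂ u (kerOp hG hM v) = ∫ t in Ioo (0 : ℝ) 1, ∫ y in Ioo (0 : ℝ) 1,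
      (G y t : ℂ) * (starRingEnd ℂ (u t) * v y) := by
    rw [L2.inner_def]
    refine integral_congr_ae ?_
    filter_upwards [kerOp_ae hG hM v] with t ht
    rw [ht, RCLike.inner_apply, kerFun, ← integral_mul_const]
    refine integral_congr_ae (Filter.Eventually.of_forall fun y => ?_)
    simp only [hsymm t y]; ring
  change inner ℂ (kerOp hG hM u) v = inner ℂ u (kerOp hG hM v)
  rw [e1, e2]
  refine integral_integral_swap ?_
  have hu : Integrable (fun t => starRingEnd ℂ (u t)) (volume.restrict (Ioo (0 : ℝ) 1)) :=
    (Complex.conjLIE.integrable_comp_iff (φ := u)).2 (integrable_L2Y u)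
  have hint := (Integrable.mul_prod (integrable_L2Y v) hu)
  refine (hint.bdd_mul (c := M) (f := fun p : ℝ × ℝ => (G p.1 p.2 : ℂ))
    (Complex.continuous_ofReal.comp hG).aestronglyMeasurable
    (Filter.Eventually.of_forall fun p => by simpa using hM p.1 p.2)).congr
    (Filter.Eventually.of_forall fun p => ?_)
  simp only [Function.uncurry]; ring

end Kernel

/-! ### The Green operator of `-φ'' + φ` with the external conditions -/

/-- The solution of `A'' = A` that satisfies the bottom condition. -/
noncomputable def greenBot (bc : External) (q y : ℝ) : ℝ :=
  bc.bottom.derivCoeff * gcosh 1 y + bc.bottom.valCoeff q * gsinh 1 y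

/-- The derivative of `greenBot`. -/
noncomputable def greenBot' (bc : External) (q y : ℝ) : ℝ :=
  bc.bottom.derivCoeff * gsinh 1 y + bc.bottom.valCoeff q * gcosh 1 y

/-- The solution of `B'' = B` that satisfies the top condition. -/
noncomputable def greenTop (bc : External) (q y : ℝ) : ℝ :=
  bc.top.derivCoeff * gcosh 1 (1 - y) + bc.top.valCoeff q * gsinh 1 (1 - y)

/-- The derivative of `greenTop`. -/
noncomputable def greenTop' (bc : External) (q y : ℝ) : ℝ :=
  -(bc.top.derivCoeff * gsinh 1 (1 - y) + bc.top.valCoeff q * gcosh 1 (1 - y))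

section Green

variable (bc : External) (q : ℝ)

lemma hasDerivAt_greenBot (y : ℝ) : HasDerivAt (greenBot bc q) (greenBot' bc q y) y := by
  convert! ((hasDerivAt_gcosh 1 y).const_mul bc.bottom.derivCoeff).add
    ((hasDerivAt_gsinh 1 y).const_mul (bc.bottom.valCoeff q)) using 1
  rw [one_mul]; rfl

lemma hasDerivAt_greenBot' (y : ℝ) : HasDerivAt (greenBot' bc q) (greenBot bc q y) y := by
  convert! ((hasDerivAt_gsinh 1 y).const_mul bc.bottom.derivCoeff).add
    ((hasDerivAt_gcosh 1 y).const_mul (bc.bottom.valCoeff q)) using 1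
  rw [one_mul]; rfl

lemma hasDerivAt_greenTop (y : ℝ) : HasDerivAt (greenTop bc q) (greenTop' bc q y) y := by
  have h : HasDerivAt (fun y : ℝ => 1 - y) (-1) y := by
    simpa using (hasDerivAt_id y).const_sub 1
  convert! (((hasDerivAt_gcosh 1 (1 - y)).comp y h).const_mul bc.top.derivCoeff).add
    (((hasDerivAt_gsinh 1 (1 - y)).comp y h).const_mul (bc.top.valCoeff q)) using 1
  rw [greenTop']; ring

lemma hasDerivAt_greenTop' (y : ℝ) : HasDerivAt (greenTop' bc q) (greenTop bc q y) y := by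
  have h : HasDerivAt (fun y : ℝ => 1 - y) (-1) y := by
    simpa using (hasDerivAt_id y).const_sub 1
  convert! ((((hasDerivAt_gsinh 1 (1 - y)).comp y h).const_mul bc.top.derivCoeff).add
    (((hasDerivAt_gcosh 1 (1 - y)).comp y h).const_mul (bc.top.valCoeff q))).neg using 1
  rw [greenTop]; ring

/-- The addition formulas at `y + (1 - y) = 1` make the Wronskian constant, with value the
characteristic function at `l = 1`. It is positive for all six configurations, so dividing by it is
legitimate even for NN. -/
lemma green_wronskian (y : ℝ) :
    greenBot' bc q y * greenTop bc q y - greenBot bc q y * greenTop' bc q y = charFn bc q 1 := by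
  have h1 := gcosh_add 1 y (1 - y)
  have h2 := gsinh_add 1 y (1 - y)
  rw [add_sub_cancel] at h1 h2
  simp only [greenBot, greenBot', greenTop, greenTop', charFn]
  rw [h1, h2]; ring

lemma continuous_greenBot : Continuous (greenBot bc q) :=
  continuous_iff_continuousAt.2 fun y => (hasDerivAt_greenBot bc q y).continuousAt

lemma continuous_greenTop : Continuous (greenTop bc q) :=
  continuous_iff_continuousAt.2 fun y => (hasDerivAt_greenTop bc q y).continuousAt

/-- The Green kernel of `-φ'' + φ` on `[0,1]`, extended by constants. -/
noncomputable def greenKer (y t : ℝ) : ℝ :=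
  greenBot bc q (min (projIcc 0 1 zero_le_one y : ℝ) (projIcc 0 1 zero_le_one t : ℝ)) *
    greenTop bc q (max (projIcc 0 1 zero_le_one y : ℝ) (projIcc 0 1 zero_le_one t : ℝ)) /
      charFn bc q 1

lemma greenKer_symm (y t : ℝ) : greenKer bc q y t = greenKer bc q t y := by
  rw [greenKer, greenKer, min_comm, max_comm]

lemma continuous_greenKer : Continuous (Function.uncurry (greenKer bc q)) := by
  have h1 := continuous_greenBot bc q
  have h2 := continuous_greenTop bc q
  have h3 : Continuous fun y : ℝ => (projIcc (0 : ℝ) 1 zero_le_one y : ℝ) :=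
    continuous_subtype_val.comp continuous_projIcc
  unfold greenKer Function.uncurry
  fun_prop

lemma exists_abs_greenKer_le : ∃ M, ∀ y t, |greenKer bc q y t| ≤ M := by
  obtain ⟨M, hM⟩ := (isCompact_Icc.prod isCompact_Icc : IsCompact (Icc (0 : ℝ) 1 ×ˢ Icc (0 : ℝ) 1)).exists_bound_of_continuousOn
    (continuous_greenKer bc q).continuousOn
  refine ⟨M, fun y t => ?_⟩
  have := hM ((projIcc (0 : ℝ) 1 zero_le_one y : ℝ), (projIcc (0 : ℝ) 1 zero_le_one t : ℝ))
    ⟨Subtype.coe_prop _, Subtype.coe_prop _⟩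
  simpa [Function.uncurry, greenKer, abs_mul, abs_div] using this

/-- The solution of `-φ'' + φ = u` with the external conditions, by variation of constants. -/
noncomputable def greenFun (u : ℝ → ℂ) (y : ℝ) : ℂ :=
  (greenTop bc q y * (∫ t in (0 : ℝ)..y, (greenBot bc q t : ℂ) * u t)
    + greenBot bc q y * (∫ t in y..1, (greenTop bc q t : ℂ) * u t)) / charFn bc q 1

/-- The derivative of `greenFun`. -/
noncomputable def greenFun' (u : ℝ → ℂ) (y : ℝ) : ℂ :=
  (greenTop' bc q y * (∫ t in (0 : ℝ)..y, (greenBot bc q t : ℂ) * u t)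
    + greenBot' bc q y * (∫ t in y..1, (greenTop bc q t : ℂ) * u t)) / charFn bc q 1

lemma hasDerivAt_greenFun {u : ℝ → ℂ} (hu : Continuous u) (y : ℝ) :
    HasDerivAt (greenFun bc q u) (greenFun' bc q u y) y := by
  have cA : Continuous fun t => (greenBot bc q t : ℂ) * u t :=
    (Complex.continuous_ofReal.comp (continuous_greenBot bc q)).mul hu
  have cB : Continuous fun t => (greenTop bc q t : ℂ) * u t :=
    (Complex.continuous_ofReal.comp (continuous_greenTop bc q)).mul hu
  have d1 := intervalIntegral.integral_hasDerivAt_right (cA.intervalIntegrable 0 y)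
    (cA.stronglyMeasurableAtFilter _ _) cA.continuousAt
  have d2 := intervalIntegral.integral_hasDerivAt_left (cB.intervalIntegrable y 1)
    (cB.stronglyMeasurableAtFilter _ _) cB.continuousAt
  convert! (((hasDerivAt_greenTop bc q y).ofReal_comp.mul d1).add
    ((hasDerivAt_greenBot bc q y).ofReal_comp.mul d2)).div_const (charFn bc q 1 : ℂ) using 1
  rw [greenFun']; ring

lemma hasDerivAt_greenFun' {q : ℝ} (hq : 0 < q) {u : ℝ → ℂ} (hu : Continuous u) (y : ℝ) :
    HasDerivAt (greenFun' bc q u) (greenFun bc q u y - u y) y := by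
  have cA : Continuous fun t => (greenBot bc q t : ℂ) * u t :=
    (Complex.continuous_ofReal.comp (continuous_greenBot bc q)).mul hu
  have cB : Continuous fun t => (greenTop bc q t : ℂ) * u t :=
    (Complex.continuous_ofReal.comp (continuous_greenTop bc q)).mul hu
  have d1 := intervalIntegral.integral_hasDerivAt_right (cA.intervalIntegrable 0 y)
    (cA.stronglyMeasurableAtFilter _ _) cA.continuousAt
  have d2 := intervalIntegral.integral_hasDerivAt_left (cB.intervalIntegrable y 1)
    (cB.stronglyMeasurableAtFilter _ _) cB.continuousAt
  have hW : (charFn bc q 1 : ℂ) ≠ 0 := by exact_mod_cast (charFn_pos_of_pos hq one_pos).ne'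
  have hw : (greenBot' bc q y : ℂ) * greenTop bc q y - greenBot bc q y * greenTop' bc q y
      = charFn bc q 1 := by exact_mod_cast green_wronskian bc q y
  convert! (((hasDerivAt_greenTop' bc q y).ofReal_comp.mul d1).add
    ((hasDerivAt_greenBot' bc q y).ofReal_comp.mul d2)).div_const (charFn bc q 1 : ℂ) using 1
  rw [greenFun]
  field_simp
  linear_combination u y * hw

lemma isAdmissible_greenFun {q : ℝ} (hq : 0 < q) {u : ℝ → ℂ} (hu : Continuous u) :
    IsAdmissible bc q (greenFun bc q u) := by
  have hd : deriv (greenFun bc q u) = greenFun' bc q u :=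
    funext fun y => (hasDerivAt_greenFun bc q hu y).deriv
  have hd' : deriv (greenFun' bc q u) = fun y => greenFun bc q u y - u y :=
    funext fun y => (hasDerivAt_greenFun' bc hq hu y).deriv
  have h1 : Differentiable ℝ (greenFun bc q u) :=
    fun y => (hasDerivAt_greenFun bc q hu y).differentiableAt
  refine ⟨?_, ?_, ?_⟩
  · rw [show (2 : WithTop ℕ∞) = 1 + 1 by norm_num, contDiff_succ_iff_deriv]
    refine ⟨h1, by simp, ?_⟩
    rw [hd, contDiff_one_iff_deriv]
    refine ⟨fun y => (hasDerivAt_greenFun' bc hq hu y).differentiableAt, ?_⟩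
    rw [hd']
    exact h1.continuous.sub hu
  · rw [bottomOp_eq_zero_iff, hd]
    simp [greenFun, greenFun', greenBot, greenBot']
    ring
  · rw [topOp_eq_zero_iff, hd]
    simp [greenFun, greenFun', greenTop, greenTop']
    ring

lemma kerFun_greenKer {u : ℝ → ℂ} (hu : Integrable u (volume.restrict (Ioo (0 : ℝ) 1))) {y : ℝ}
    (hy : y ∈ Icc (0 : ℝ) 1) : kerFun (greenKer bc q) u y = greenFun bc q u y := by
  obtain ⟨M, hM⟩ := exists_abs_greenKer_le bc q
  have hint : Integrable (fun t => (greenKer bc q y t : ℂ) * u t)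
      (volume.restrict (Ioo (0 : ℝ) 1)) := by
    refine hu.bdd_mul (c := M) ?_ (Filter.Eventually.of_forall fun t => by simpa using hM y t)
    exact (Complex.continuous_ofReal.comp ((continuous_greenKer bc q).comp
      (Continuous.prodMk_right y))).aestronglyMeasurable
  have hint' : IntervalIntegrable (fun t => (greenKer bc q y t : ℂ) * u t) volume 0 1 := by
    rw [intervalIntegrable_iff_integrableOn_Ioo_of_le zero_le_one]; exact hint
  have i1 := hint'.mono_set (c := 0) (d := y) (by
    rw [uIcc_of_le hy.1, uIcc_of_le zero_le_one]; exact Icc_subset_Icc_right hy.2)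
  have i2 := hint'.mono_set (c := y) (d := 1) (by
    rw [uIcc_of_le hy.2, uIcc_of_le zero_le_one]; exact Icc_subset_Icc_left hy.1)
  rw [kerFun, ← integral_Ioc_eq_integral_Ioo, ← intervalIntegral.integral_of_le zero_le_one,
    ← intervalIntegral.integral_add_adjacent_intervals i1 i2, greenFun]
  have e1 : ∫ t in (0 : ℝ)..y, (greenKer bc q y t : ℂ) * u t
      = (greenTop bc q y / charFn bc q 1 : ℂ) * ∫ t in (0 : ℝ)..y, (greenBot bc q t : ℂ) * u t := by
    rw [← intervalIntegral.integral_const_mul]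
    refine intervalIntegral.integral_congr fun t ht => ?_
    rw [uIcc_of_le hy.1] at ht
    simp only [greenKer]
    rw [projIcc_of_mem _ hy, projIcc_of_mem _ ⟨ht.1, ht.2.trans hy.2⟩, min_eq_right ht.2,
      max_eq_left ht.2]
    push_cast; ring
  have e2 : ∫ t in y..1, (greenKer bc q y t : ℂ) * u t
      = (greenBot bc q y / charFn bc q 1 : ℂ) * ∫ t in y..1, (greenTop bc q t : ℂ) * u t := by
    rw [← intervalIntegral.integral_const_mul]
    refine intervalIntegral.integral_congr fun t ht => ?_
    rw [uIcc_of_le hy.2] at ht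
    simp only [greenKer]
    rw [projIcc_of_mem _ hy, projIcc_of_mem _ ⟨hy.1.trans ht.1, ht.2⟩, min_eq_left ht.1,
      max_eq_right ht.1]
    push_cast; ring
  rw [e1, e2]; ring

/-- Green's representation of an admissible function. -/
lemma greenFun_sub_deriv_deriv {bc : External} {q : ℝ} (hq : 0 < q) {ψ : ℝ → ℂ}
    (hψ : IsAdmissible bc q ψ) (y : ℝ) :
    greenFun bc q (fun t => ψ t - deriv (deriv ψ) t) y = ψ y := by
  obtain ⟨hC2, hb, ht⟩ := hψ
  have hd : Differentiable ℝ ψ := hC2.differentiable (by norm_num)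
  have hC1 : ContDiff ℝ 1 (deriv ψ) :=
    ((contDiff_succ_iff_deriv (n := 1)).1 (by norm_num; exact hC2)).2.2
  have hdd : Differentiable ℝ (deriv ψ) := hC1.differentiable (by norm_num)
  have hc : Continuous (deriv (deriv ψ)) := hC1.continuous_deriv (by norm_num)
  have cw : Continuous fun t => ψ t - deriv (deriv ψ) t := hd.continuous.sub hc
  have cA : Continuous fun t => (greenBot bc q t : ℂ) * (ψ t - deriv (deriv ψ) t) :=
    (Complex.continuous_ofReal.comp (continuous_greenBot bc q)).mul cw
  have cB : Continuous fun t => (greenTop bc q t : ℂ) * (ψ t - deriv (deriv ψ) t) :=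
    (Complex.continuous_ofReal.comp (continuous_greenTop bc q)).mul cw
  -- Lagrange's identity: since `greenBot'' = greenBot`, the integrand is the derivative of a
  -- Wronskian with `ψ`. Its value at `0` vanishes by the bottom condition; the contributions at `y`
  -- from `e1` and `e2` combine to the Wronskian of `greenBot` and `greenTop`, times `ψ y`.
  have e1 := intervalIntegral.integral_eq_sub_of_hasDerivAt (a := 0) (b := y)
    (f := fun t => (greenBot' bc q t : ℂ) * ψ t - greenBot bc q t * deriv ψ t)
    (f' := fun t => (greenBot bc q t : ℂ) * (ψ t - deriv (deriv ψ) t))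
    (fun t _ => by
      convert! ((hasDerivAt_greenBot' bc q t).ofReal_comp.mul (hd t).hasDerivAt).sub
        ((hasDerivAt_greenBot bc q t).ofReal_comp.mul (hdd t).hasDerivAt) using 1
      ring) (cA.intervalIntegrable _ _)
  have e2 := intervalIntegral.integral_eq_sub_of_hasDerivAt (a := y) (b := 1)
    (f := fun t => (greenTop' bc q t : ℂ) * ψ t - greenTop bc q t * deriv ψ t)
    (f' := fun t => (greenTop bc q t : ℂ) * (ψ t - deriv (deriv ψ) t))
    (fun t _ => by
      convert! ((hasDerivAt_greenTop' bc q t).ofReal_comp.mul (hd t).hasDerivAt).sub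
        ((hasDerivAt_greenTop bc q t).ofReal_comp.mul (hdd t).hasDerivAt) using 1
      ring) (cB.intervalIntegrable _ _)
  rw [bottomOp_eq_zero_iff] at hb
  rw [topOp_eq_zero_iff] at ht
  have hb' : (greenBot' bc q 0 : ℂ) * ψ 0 - greenBot bc q 0 * deriv ψ 0 = 0 := by
    rw [← hb]; simp [greenBot, greenBot']
  have ht' : (greenTop' bc q 1 : ℂ) * ψ 1 - greenTop bc q 1 * deriv ψ 1 = 0 := by
    rw [← neg_eq_zero, ← ht]; simp [greenTop, greenTop']; ring
  have hW : (charFn bc q 1 : ℂ) ≠ 0 := by exact_mod_cast (charFn_pos_of_pos hq one_pos).ne'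
  have hw : (greenBot' bc q y : ℂ) * greenTop bc q y - greenBot bc q y * greenTop' bc q y
      = charFn bc q 1 := by exact_mod_cast green_wronskian bc q y
  rw [greenFun, e1, e2, hb', ht', div_eq_iff hW, ← hw]
  ring

end Green

lemma IsAdmissible.differentiable {bc : External} {q : ℝ} {ψ : ℝ → ℂ}
    (h : IsAdmissible bc q ψ) : Differentiable ℝ ψ := h.1.differentiable (by norm_num)

lemma IsAdmissible.contDiff_deriv {bc : External} {q : ℝ} {ψ : ℝ → ℂ}
    (h : IsAdmissible bc q ψ) : ContDiff ℝ 1 (deriv ψ) :=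
  ((contDiff_succ_iff_deriv (n := 1)).1 (by norm_num; exact h.1)).2.2

lemma IsAdmissible.differentiable_deriv {bc : External} {q : ℝ} {ψ : ℝ → ℂ}
    (h : IsAdmissible bc q ψ) : Differentiable ℝ (deriv ψ) :=
  h.contDiff_deriv.differentiable (by norm_num)

lemma IsAdmissible.continuous_deriv_deriv {bc : External} {q : ℝ} {ψ : ℝ → ℂ}
    (h : IsAdmissible bc q ψ) : Continuous (deriv (deriv ψ)) :=
  h.contDiff_deriv.continuous_deriv (by norm_num)

lemma memLp_of_continuous {f : ℝ → ℂ} (hf : Continuous f) :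
    MemLp f 2 (volume.restrict (Ioo (0 : ℝ) 1)) := by
  obtain ⟨M, hM⟩ := (isCompact_Icc (a := (0 : ℝ)) (b := 1)).exists_bound_of_continuousOn
    hf.continuousOn
  refine MemLp.of_bound hf.aestronglyMeasurable M ?_
  filter_upwards [ae_restrict_mem measurableSet_Ioo] with y hy using hM y (Ioo_subset_Icc_self hy)

/-- The Green operator of `-φ'' + φ` on `L²(0,1)`. -/
noncomputable def greenOp (bc : External) (q : ℝ) : L2Y →L[ℂ] L2Y :=
  kerOp (continuous_greenKer bc q) (exists_abs_greenKer_le bc q).choose_spec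

lemma greenOp_ae (bc : External) (q : ℝ) (u : L2Y) :
    greenOp bc q u =ᵐ[volume.restrict (Ioo (0 : ℝ) 1)] kerFun (greenKer bc q) u :=
  kerOp_ae _ _ u

lemma isCompactOperator_greenOp (bc : External) (q : ℝ) : IsCompactOperator (greenOp bc q) :=
  isCompactOperator_kerOp _ _

lemma isSymmetric_greenOp (bc : External) (q : ℝ) :
    (greenOp bc q : L2Y →ₗ[ℂ] L2Y).IsSymmetric := isSymmetric_kerOp _ _ (greenKer_symm bc q)

lemma kerFun_congr_ae {G : ℝ → ℝ → ℝ} {u v : ℝ → ℂ}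
    (h : u =ᵐ[volume.restrict (Ioo (0 : ℝ) 1)] v) (y : ℝ) : kerFun G u y = kerFun G v y :=
  integral_congr_ae (h.mono fun t ht => by simp only [ht])

/-- The Green operator is injective. -/
lemma eq_zero_of_greenOp_eq_zero {bc : External} {q : ℝ} (hq : 0 < q) {u : L2Y}
    (hu : greenOp bc q u = 0) : u = 0 := by
  have key : ∀ g : ℝ → ℝ, ContDiff ℝ ((⊤ : ℕ∞) : WithTop ℕ∞) g → HasCompactSupport g → tsupport g ⊆ Ioo (0 : ℝ) 1 →
      ∫ x in Ioo (0 : ℝ) 1, g x • u x = 0 := by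
    intro g hg _ hsupp
    set ψ : ℝ → ℂ := fun x => (g x : ℂ)
    have hψs : tsupport ψ ⊆ Ioo (0 : ℝ) 1 := by
      refine subset_trans (closure_mono fun x hx => ?_) hsupp
      simpa [ψ] using hx
    have h0 : ∀ x, x ∉ Ioo (0 : ℝ) 1 → ψ x = 0 ∧ deriv ψ x = 0 := by
      intro x hx
      have hx' : x ∉ tsupport ψ := fun h => hx (hψs h)
      exact ⟨image_eq_zero_of_notMem_tsupport hx', by
        have := (notMem_tsupport_iff_eventuallyEq.1 hx').deriv_eq
        simpa using this⟩
    have hψ : IsAdmissible bc q ψ := by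
      refine ⟨by exact_mod_cast contDiff_infty.1 (Complex.ofRealCLM.contDiff.comp hg) 2, ?_, ?_⟩
      · rw [bottomOp_eq_zero_iff, (h0 0 (by simp)).1, (h0 0 (by simp)).2]; simp
      · rw [topOp_eq_zero_iff, (h0 1 (by simp)).1, (h0 1 (by simp)).2]; simp
    have hw : Continuous fun t => ψ t - deriv (deriv ψ) t :=
      hψ.differentiable.continuous.sub hψ.continuous_deriv_deriv
    set w : L2Y := (memLp_of_continuous hw).toLp
    have hKw : greenOp bc q w =ᵐ[volume.restrict (Ioo (0 : ℝ) 1)] ψ := by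
      filter_upwards [greenOp_ae bc q w, ae_restrict_mem measurableSet_Ioo] with y hy hy'
      rw [hy, kerFun_congr_ae (memLp_of_continuous hw).coeFn_toLp,
        kerFun_greenKer bc q ((memLp_of_continuous hw).integrable one_le_two)
          (Ioo_subset_Icc_self hy'), greenFun_sub_deriv_deriv hq hψ]
    -- A test function is itself in the range, `ψ = greenOp w` with `w = ψ - ψ''`. By symmetry its
    -- integral against `u` equals the inner product of `w` with `greenOp u = 0`, and test functions
    -- determine `u`.
    have hs : inner ℂ (greenOp bc q w) u = inner ℂ w (greenOp bc q u) :=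
      isSymmetric_greenOp bc q w u
    rw [hu, inner_zero_right, L2.inner_def] at hs
    rw [← hs]
    refine integral_congr_ae ?_
    filter_upwards [hKw] with y hy
    rw [hy, RCLike.inner_apply]
    simp [ψ, mul_comm]
  have h := isOpen_Ioo.ae_eq_zero_of_integral_contDiff_smul_eq_zero (f := u)
    (μ := volume.restrict (Ioo (0 : ℝ) 1))
    ((integrable_L2Y u).locallyIntegrable.locallyIntegrableOn _) key
  rw [Lp.eq_zero_iff_ae_eq_zero]
  filter_upwards [h, ae_restrict_mem measurableSet_Ioo] with y hy hy' using hy hy'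

/-- An eigenvector of the Green operator is represented by an admissible eigenfunction. -/
lemma exists_eigenfunction {bc : External} {q : ℝ} (hq : 0 < q) {u : L2Y} {μ : ℂ} (hμ : μ ≠ 0)
    (hu : greenOp bc q u = μ • u) : ∃ φ : ℝ → ℂ, IsAdmissible bc q φ ∧
      u =ᵐ[volume.restrict (Ioo (0 : ℝ) 1)] φ ∧
      ∀ y ∈ Ioo (0 : ℝ) 1, deriv (deriv φ) y = -(μ⁻¹ - 1) * φ y := by
  -- A continuous representative of `u`. Being constant outside `[0,1]`, it need not be smooth
  -- across the ends, so one more application of `greenFun` below supplies a representative that is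
  -- `C²` on the whole line and satisfies the external conditions.
  set φ₁ : ℝ → ℂ := fun y => μ⁻¹ * kerFun (greenKer bc q) u (projIcc (0 : ℝ) 1 zero_le_one y)
  have hc : Continuous φ₁ := continuous_const.mul ((continuous_kerFun_Icc
    (continuous_greenKer bc q) (exists_abs_greenKer_le bc q).choose_spec u).comp continuous_projIcc)
  have hu1 : u =ᵐ[volume.restrict (Ioo (0 : ℝ) 1)] φ₁ := by
    filter_upwards [greenOp_ae bc q u, Lp.coeFn_smul μ u, ae_restrict_mem measurableSet_Ioo]
      with y h1 h2 hy
    simp only [φ₁]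
    rw [projIcc_of_mem _ (Ioo_subset_Icc_self hy), ← h1, hu, h2, Pi.smul_apply, smul_eq_mul,
      inv_mul_cancel_left₀ hμ]
  have heq : ∀ y ∈ Icc (0 : ℝ) 1, greenFun bc q φ₁ y = μ * φ₁ y := by
    intro y hy
    rw [← kerFun_greenKer bc q ((memLp_of_continuous hc).integrable one_le_two) hy,
      ← kerFun_congr_ae hu1]
    simp only [φ₁]
    rw [projIcc_of_mem _ hy, mul_inv_cancel_left₀ hμ]
  have hadm := isAdmissible_greenFun bc hq hc
  have hd : deriv (greenFun bc q φ₁) = greenFun' bc q φ₁ :=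
    funext fun y => (hasDerivAt_greenFun bc q hc y).deriv
  have hd' : deriv (greenFun' bc q φ₁) = fun y => greenFun bc q φ₁ y - φ₁ y :=
    funext fun y => (hasDerivAt_greenFun' bc hq hc y).deriv
  have hdc : deriv (fun y => μ⁻¹ * greenFun bc q φ₁ y) = fun y => μ⁻¹ * greenFun' bc q φ₁ y :=
    funext fun y => ((hasDerivAt_greenFun bc q hc y).const_mul μ⁻¹).deriv
  refine ⟨fun y => μ⁻¹ * greenFun bc q φ₁ y, ⟨contDiff_const.mul hadm.1, ?_, ?_⟩, ?_, ?_⟩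
  · have := (bottomOp_eq_zero_iff _ _ _).1 hadm.2.1
    rw [hd] at this
    rw [bottomOp_eq_zero_iff, hdc]
    linear_combination μ⁻¹ * this
  · have := (topOp_eq_zero_iff _ _ _).1 hadm.2.2
    rw [hd] at this
    rw [topOp_eq_zero_iff, hdc]
    linear_combination μ⁻¹ * this
  · filter_upwards [hu1, ae_restrict_mem measurableSet_Ioo] with y h1 hy
    rw [h1, heq y (Ioo_subset_Icc_self hy), inv_mul_cancel_left₀ hμ]
  · intro y hy
    rw [hdc, deriv_const_mul _ (hasDerivAt_greenFun' bc hq hc y).differentiableAt, hd']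
    simp only
    rw [heq y (Ioo_subset_Icc_self hy)]
    field_simp; ring

/-! ### The Hilbert basis of eigenfunctions -/

/-- Eigenvectors of an injective compact symmetric operator contain a Hilbert basis. -/
lemma exists_hilbertBasis_eigenvectors {H : Type} [NormedAddCommGroup H] [InnerProductSpace ℂ H]
    [CompleteSpace H] {T : H →L[ℂ] H} (hT : IsCompactOperator T)
    (hs : (T : H →ₗ[ℂ] H).IsSymmetric) :
    ∃ (ι : Type) (e : HilbertBasis ι ℂ H) (μ : ι → ℝ), ∀ i, T (e i) = (μ i : ℂ) • e i := by
  let E : ℂ → Submodule ℂ H := fun μ => Module.End.eigenspace (T : Module.End ℂ H) μ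
  have hclosed : ∀ μ, IsClosed (E μ : Set H) := by
    intro μ
    have : (E μ : Set H) = {x | T x = μ • x} := by
      ext x; simp [E]
    rw [this]
    exact isClosed_eq T.continuous (continuous_const_smul μ)
  have hcomplete : ∀ μ, CompleteSpace (E μ) := fun μ => (hclosed μ).completeSpace_coe
  choose w b hb using fun μ => exists_hilbertBasis ℂ (E μ)
  -- Bases of the individual eigenspaces are glued: eigenspaces of a symmetric operator are mutually
  -- orthogonal, and by the spectral theorem for compact operators nothing is orthogonal to all of
  -- them.
  have ho : Orthonormal ℂ (fun a : Σ μ, w μ => ((b a.1 a.2 : E a.1) : H)) := hs.orthogonalFamily_eigenspaces.orthonormal_sigma_orthonormal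
    (fun μ => (b μ).orthonormal)
  have hperp : (Submodule.span ℂ (Set.range fun a : Σ μ, w μ => ((b a.1 a.2 : E a.1) : H)))ᗮ = ⊥ := by
    rw [eq_bot_iff, ← ContinuousLinearMap.orthogonalComplement_iSup_eigenspaces_eq_bot hT hs]
    intro x hx
    rw [Submodule.mem_orthogonal'] at hx ⊢
    intro y hy
    suffices (⨆ μ, E μ) ≤ LinearMap.ker ((innerSL ℂ x : H →L[ℂ] ℂ) : H →ₗ[ℂ] ℂ) from this hy
    refine iSup_le fun μ z hz => ?_
    have h1 : (innerSL ℂ x : H →L[ℂ] ℂ).comp (E μ).subtypeL = 0 := by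
      refine ContinuousLinearMap.ext_on (s := Set.range (b μ)) ?_ ?_
      · exact Submodule.dense_iff_topologicalClosure_eq_top.2 (b μ).dense_span
      · rintro _ ⟨i, rfl⟩
        exact hx _ (Submodule.subset_span ⟨⟨μ, i⟩, rfl⟩)
    exact DFunLike.congr_fun h1 ⟨z, hz⟩
  refine ⟨Σ μ, w μ, HilbertBasis.mkOfOrthogonalEqBot ho hperp, fun a => a.1.re, fun a => ?_⟩
  rw [HilbertBasis.coe_mkOfOrthogonalEqBot]
  have hmem := Module.End.mem_eigenspace_iff.1 (b a.1 a.2).2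
  have hne : ((b a.1 a.2 : E a.1) : H) ≠ 0 := by
    have := (b a.1).orthonormal.ne_zero a.2
    simpa using this
  have hev : Module.End.HasEigenvalue (T : Module.End ℂ H) a.1 :=
    Module.End.hasEigenvalue_of_hasEigenvector ⟨(b a.1 a.2).2, hne⟩
  have hre : ((a.1.re : ℝ) : ℂ) = a.1 := Complex.conj_eq_iff_re.1 (hs.conj_eigenvalue_eq_self hev)
  rw [hre]
  exact hmem

/-- `L²(0,1)` has a Hilbert basis of admissible eigenfunctions. -/
theorem exists_eigenbasis {q : ℝ} (hq : 0 < q) (bc : External) :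
    ∃ (ι : Type) (e : HilbertBasis ι ℂ L2Y) (lam : ι → ℝ) (φ : ι → ℝ → ℂ), ∀ i,
      lambda1 bc q ≤ lam i ∧ IsAdmissible bc q (φ i) ∧
      e i =ᵐ[volume.restrict (Ioo (0 : ℝ) 1)] φ i ∧
      ∀ y ∈ Ioo (0 : ℝ) 1, deriv (deriv (φ i)) y = -(lam i : ℂ) * φ i y := by
  obtain ⟨ι, e, μ, he⟩ := exists_hilbertBasis_eigenvectors (isCompactOperator_greenOp bc q)
    (isSymmetric_greenOp bc q)
  have hne : ∀ i, e i ≠ 0 := fun i => e.orthonormal.ne_zero i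
  have hμ : ∀ i, (μ i : ℂ) ≠ 0 := fun i h => hne i (eq_zero_of_greenOp_eq_zero hq (by
    rw [he i, h, zero_smul]))
  choose φ h1 h2 h3 using fun i => exists_eigenfunction hq (hμ i) (he i)
  -- The Green operator acts as `1 / (1 + λ)` on an eigenfunction, hence `λ = μ⁻¹ - 1`. The lower
  -- bound is the minimality of `lambda1`.
  refine ⟨ι, e, fun i => (μ i)⁻¹ - 1, φ, fun i => ⟨?_, h1 i, h2 i, ?_⟩⟩
  · refine (isLeast_eigenvalues hq bc).2 ⟨φ i, h1 i, ?_, ?_⟩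
    · intro y hy
      rw [h3 i y hy]; push_cast; rfl
    · by_contra! hcon
      apply hne i
      rw [Lp.eq_zero_iff_ae_eq_zero]
      filter_upwards [h2 i, ae_restrict_mem measurableSet_Ioo] with y hy hy'
      rw [hy, hcon y hy']; rfl
  · intro y hy
    rw [h3 i y hy]; push_cast; rfl

/-- A Hilbert basis of admissible eigenfunctions `φ i` with eigenvalues `lam i`. -/
structure IsEigenbasis (bc : External) (q : ℝ) {ι : Type} (e : HilbertBasis ι ℂ L2Y)
    (lam : ι → ℝ) (φ : ι → ℝ → ℂ) : Prop where
  le : ∀ i, lambda1 bc q ≤ lam i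
  adm : ∀ i, IsAdmissible bc q (φ i)
  ae : ∀ i, e i =ᵐ[volume.restrict (Ioo (0 : ℝ) 1)] φ i
  ode : ∀ i, ∀ y ∈ Ioo (0 : ℝ) 1, deriv (deriv (φ i)) y = -(lam i : ℂ) * φ i y

lemma IsEigenbasis.nonneg {bc : External} {q : ℝ} {ι : Type} {e : HilbertBasis ι ℂ L2Y}
    {lam : ι → ℝ} {φ : ι → ℝ → ℂ} (h : IsEigenbasis bc q e lam φ) (i : ι) : 0 ≤ lam i :=
  (lambda1_nonneg bc q).trans (h.le i)

/-! ### The bilinear pairing and Green's second identity -/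

section Pairing

lemma deriv_conj_comp {f : ℝ → ℂ} (hf : Differentiable ℝ f) :
    deriv (fun y => starRingEnd ℂ (f y)) = fun y => starRingEnd ℂ (deriv f y) :=
  funext fun y => (hf y).hasDerivAt.star.deriv

lemma IsAdmissible.conj {bc : External} {q : ℝ} {ψ : ℝ → ℂ} (h : IsAdmissible bc q ψ) :
    IsAdmissible bc q (fun y => starRingEnd ℂ (ψ y)) := by
  refine ⟨Complex.conjCLE.contDiff.comp h.1, ?_, ?_⟩
  · rw [bottomOp_eq_zero_iff, deriv_conj_comp h.differentiable]
    simpa using congrArg (starRingEnd ℂ) ((bottomOp_eq_zero_iff _ _ _).1 h.2.1)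
  · rw [topOp_eq_zero_iff, deriv_conj_comp h.differentiable]
    simpa using congrArg (starRingEnd ℂ) ((topOp_eq_zero_iff _ _ _).1 h.2.2)

/-- The inner product is conjugate-linear in its first argument, the pairing bilinear; hence the
conjugate. Linearity of the pairing in `v` is read off from here. -/
lemma pair_eq_inner {ψ : ℝ → ℂ} {w : L2Y}
    (h : w =ᵐ[volume.restrict (Ioo (0 : ℝ) 1)] fun y => starRingEnd ℂ (ψ y)) (v : L2Y) :
    pair ψ v = inner ℂ w v := by
  rw [pair, L2.inner_def]
  refine integral_congr_ae ?_
  filter_upwards [h] with y hy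
  rw [hy, RCLike.inner_apply]; simp [mul_comm]

lemma exists_pair_eq_inner {ψ : ℝ → ℂ} (hψ : Continuous ψ) :
    ∃ w : L2Y, ∀ v, pair ψ v = inner ℂ w v :=
  ⟨(memLp_of_continuous (Complex.continuous_conj.comp hψ)).toLp,
    pair_eq_inner (memLp_of_continuous (Complex.continuous_conj.comp hψ)).coeFn_toLp⟩

lemma pair_add {ψ : ℝ → ℂ} (hψ : Continuous ψ) (u v : L2Y) :
    pair ψ (u + v) = pair ψ u + pair ψ v := by
  obtain ⟨w, hw⟩ := exists_pair_eq_inner hψ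
  simp only [hw, inner_add_right]

lemma pair_smul {ψ : ℝ → ℂ} (hψ : Continuous ψ) (c : ℂ) (v : L2Y) :
    pair ψ (c • v) = c * pair ψ v := by
  obtain ⟨w, hw⟩ := exists_pair_eq_inner hψ
  simp only [hw, inner_smul_right]

lemma pair_zero {ψ : ℝ → ℂ} (hψ : Continuous ψ) : pair ψ 0 = 0 := by
  obtain ⟨w, hw⟩ := exists_pair_eq_inner hψ
  simp only [hw, inner_zero_right]

/-- Green's second identity for admissible functions. -/
lemma integral_deriv_deriv_mul {bc : External} {q : ℝ} (hq : 0 < q) {ψ φ : ℝ → ℂ}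
    (hψ : IsAdmissible bc q ψ) (hφ : IsAdmissible bc q φ) :
    ∫ y in Ioo (0 : ℝ) 1, deriv (deriv ψ) y * φ y = ∫ y in Ioo (0 : ℝ) 1, ψ y * deriv (deriv φ) y := by
  have c1 : Continuous fun y => deriv (deriv ψ) y * φ y :=
    hψ.continuous_deriv_deriv.mul hφ.differentiable.continuous
  have c2 : Continuous fun y => ψ y * deriv (deriv φ) y :=
    hψ.differentiable.continuous.mul hφ.continuous_deriv_deriv
  have e := intervalIntegral.integral_eq_sub_of_hasDerivAt (a := 0) (b := 1)
    (f := fun y => deriv ψ y * φ y - ψ y * deriv φ y)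
    (f' := fun y => deriv (deriv ψ) y * φ y - ψ y * deriv (deriv φ) y)
    (fun y _ => by
      convert! ((hψ.differentiable_deriv y).hasDerivAt.mul (hφ.differentiable y).hasDerivAt).sub
        ((hψ.differentiable y).hasDerivAt.mul (hφ.differentiable_deriv y).hasDerivAt) using 1
      ring) ((c1.sub c2).intervalIntegrable _ _)
  rw [intervalIntegral.integral_sub (c1.intervalIntegrable _ _) (c2.intervalIntegrable _ _)] at e
  have b1 := (bottomOp_eq_zero_iff _ _ _).1 hψ.2.1
  have b2 := (bottomOp_eq_zero_iff _ _ _).1 hφ.2.1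
  have t1 := (topOp_eq_zero_iff _ _ _).1 hψ.2.2
  have t2 := (topOp_eq_zero_iff _ _ _).1 hφ.2.2
  -- At an end, the boundary data of `ψ` and `φ` satisfy the same nontrivial linear condition, so
  -- they are proportional and their determinant vanishes.
  have zb : deriv ψ 0 * φ 0 - ψ 0 * deriv φ 0 = 0 := by
    have hst := coeff_sq_pos hq bc.bottom
    have hstC : ((bc.bottom.valCoeff q : ℂ) ^ 2 + (bc.bottom.derivCoeff : ℂ) ^ 2) ≠ 0 := by
      exact_mod_cast hst.ne'
    refine (mul_eq_zero.1 ?_).resolve_left hstC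
    linear_combination (bc.bottom.valCoeff q * deriv ψ 0 + bc.bottom.derivCoeff * ψ 0) * b2
      - (bc.bottom.valCoeff q * deriv φ 0 + bc.bottom.derivCoeff * φ 0) * b1
  have zt : deriv ψ 1 * φ 1 - ψ 1 * deriv φ 1 = 0 := by
    have hst := coeff_sq_pos hq bc.top
    have hstC : ((bc.top.valCoeff q : ℂ) ^ 2 + (bc.top.derivCoeff : ℂ) ^ 2) ≠ 0 := by
      exact_mod_cast hst.ne'
    refine (mul_eq_zero.1 ?_).resolve_left hstC
    linear_combination (bc.top.valCoeff q * deriv ψ 1 - bc.top.derivCoeff * ψ 1) * t2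
      - (bc.top.valCoeff q * deriv φ 1 - bc.top.derivCoeff * φ 1) * t1
  rw [zb, zt, sub_zero, sub_eq_zero] at e
  rwa [intervalIntegral.integral_of_le zero_le_one, intervalIntegral.integral_of_le zero_le_one,
    integral_Ioc_eq_integral_Ioo, integral_Ioc_eq_integral_Ioo] at e

end Pairing

/-! ### Modal coefficients of homogeneous solutions, and Parseval -/

section Modes

variable {bc : External} {q : ℝ} {ι : Type} {e : HilbertBasis ι ℂ L2Y} {lam : ι → ℝ}
  {φ : ι → ℝ → ℂ}

lemma IsEigenbasis.inner_eq_pair (he : IsEigenbasis bc q e lam φ) (i : ι) (v : L2Y) :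
    inner ℂ (e i) v = pair (fun y => starRingEnd ℂ (φ i y)) v :=
  (pair_eq_inner (by simpa using he.ae i) v).symm

lemma IsEigenbasis.pair_deriv_deriv (he : IsEigenbasis bc q e lam φ) (hq : 0 < q) {ψ : ℝ → ℂ}
    (hψ : IsAdmissible bc q ψ) (i : ι) :
    pair (deriv (deriv ψ)) (e i) = -(lam i : ℂ) * pair ψ (e i) := by
  have h1 : ∀ f : ℝ → ℂ, pair f (e i) = ∫ y in Ioo (0 : ℝ) 1, f y * φ i y := fun f =>
    integral_congr_ae ((he.ae i).mono fun y hy => by simp only [hy])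
  rw [h1, h1, integral_deriv_deriv_mul hq hψ (he.adm i), ← integral_const_mul]
  refine setIntegral_congr_fun measurableSet_Ioo fun y hy => ?_
  simp only [he.ode i y hy]; ring

/-- The coefficients of a solution of the homogeneous equation are combinations of `gcosh` and
`gsinh`. -/
lemma IsEigenbasis.exists_inner_eq (he : IsEigenbasis bc q e lam φ) {a b : ℝ} (hab : a < b)
    {u : ℝ → L2Y} (hc : ContinuousOn u (Icc a b)) (hu : SolvesPoisson bc q a b 0 u) (c : ℝ)
    (i : ι) : ∃ A B : ℂ, ∀ x ∈ Icc a b,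
      inner ℂ (e i) (u x) = A * gcosh (lam i) (x - c) + B * gsinh (lam i) (x - c) := by
  have hφ := (he.adm i).conj
  obtain ⟨V, hV⟩ := hu _ hφ
  refine exists_eq_gcosh_gsinh hab c (z := fun x => inner ℂ (e i) (u x)) (V := V)
    (continuousOn_const.inner hc) (fun x hx => ?_) fun x hx => ?_
  · simpa only [he.inner_eq_pair i] using (hV x hx).1
  · convert (hV x hx).2 using 1
    have h2 : pair (deriv (deriv fun y => starRingEnd ℂ (φ i y))) (u x)
        = -(lam i : ℂ) * pair (fun y => starRingEnd ℂ (φ i y)) (u x) := by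
      rw [deriv_conj_comp (he.adm i).differentiable,
        deriv_conj_comp (he.adm i).differentiable_deriv, pair, pair, ← integral_const_mul]
      refine setIntegral_congr_fun measurableSet_Ioo fun y hy => ?_
      simp only [he.ode i y hy, map_mul, map_neg, Complex.conj_ofReal]; ring
    rw [h2, Pi.zero_apply, pair_zero hφ.differentiable.continuous, he.inner_eq_pair i]
    ring

lemma hasSum_norm_inner_sq (e : HilbertBasis ι ℂ L2Y) (v : L2Y) :
    HasSum (fun i => ‖inner ℂ (e i) v‖ ^ 2) (‖v‖ ^ 2) := by
  have := lp.hasSum_norm (p := 2) (by norm_num) (e.repr v)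
  simpa [HilbertBasis.repr_apply_apply] using this

/-- Parseval turns modal estimates into `L²` ones. Vectors are taken in pairs because only the sum
over both sides of a subdomain separates even from odd modes; a one-sided estimate uses zero in the
second slot. -/
lemma norm_sq_add_norm_sq_le (e : HilbertBasis ι ℂ L2Y) {u₁ u₂ v₁ v₂ : L2Y} {C : ℝ}
    (h : ∀ i, ‖inner ℂ (e i) u₁‖ ^ 2 + ‖inner ℂ (e i) u₂‖ ^ 2
      ≤ C * (‖inner ℂ (e i) v₁‖ ^ 2 + ‖inner ℂ (e i) v₂‖ ^ 2)) :
    ‖u₁‖ ^ 2 + ‖u₂‖ ^ 2 ≤ C * (‖v₁‖ ^ 2 + ‖v₂‖ ^ 2) :=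
  hasSum_le h ((hasSum_norm_inner_sq e u₁).add (hasSum_norm_inner_sq e u₂))
    (((hasSum_norm_inner_sq e v₁).add (hasSum_norm_inner_sq e v₂)).mul_left C)

end Modes

/-! ### Transmission traces of a mode, for PSM and OSM together -/

/-- Coefficient of the value in a transmission condition. -/
def Method.valCoeff : Method → ℝ
  | .PSM => 1
  | .OSM p _ => p

/-- Coefficient of the derivative in a transmission condition. -/
def Method.derivCoeff : Method → ℝ
  | .PSM => 0
  | .OSM _ _ => 1

lemma Method.valCoeff_pos (m : Method) : 0 < m.valCoeff := by
  cases m with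
  | PSM => exact one_pos
  | OSM p hp => exact hp

lemma Method.derivCoeff_nonneg (m : Method) : 0 ≤ m.derivCoeff := by
  cases m <;> simp [Method.derivCoeff]

lemma Regular.continuousOn {m : Method} {a b : ℝ} {u : ℝ → L2Y} (h : Regular m a b u) :
    ContinuousOn u (Icc a b) := by
  cases m with
  | PSM => exact h
  | OSM p hp => exact ContDiffOn.continuousOn h

/-- Taking a coefficient is continuous and linear, so it commutes with the derivative in `x`;
uniqueness of one-sided derivatives on `[a,b]` identifies the result with `z'`. Both methods thus
act as `α z ∓ β z'`, with `(α, β)` equal to `(1, 0)` or `(p, 1)`. -/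
lemma inner_traces {m : Method} {a b : ℝ} (hab : a < b) {u : ℝ → L2Y} (hu : Regular m a b u)
    (w : L2Y) {z : ℝ → ℂ} {z' : ℂ} {x : ℝ} (hx : x ∈ Icc a b) (hz' : HasDerivAt z z' x)
    (hz : ∀ y ∈ Icc a b, inner ℂ w (u y) = z y) :
    inner ℂ w (leftTrace m a b u x) = m.valCoeff * z x - m.derivCoeff * z' ∧
    inner ℂ w (rightTrace m a b u x) = m.valCoeff * z x + m.derivCoeff * z' := by
  cases m with
  | PSM => simp [leftTrace, rightTrace, Method.valCoeff, Method.derivCoeff, hz x hx]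
  | OSM p hp =>
    have hu' : ContDiffOn ℝ 1 u (Icc a b) := hu
    have hd := ((hu'.differentiableOn (by norm_num)) x hx).hasDerivWithinAt
    have hud : UniqueDiffWithinAt ℝ (Icc a b) x := uniqueDiffOn_Icc hab x hx
    have h1 : HasDerivWithinAt (fun y => inner ℂ w (u y)) (inner ℂ w (derivWithin u (Icc a b) x))
        (Icc a b) x :=
      ((innerSL ℂ w).restrictScalars ℝ).hasFDerivAt.comp_hasDerivWithinAt x hd
    have h2 : inner ℂ w (derivWithin u (Icc a b) x) = z' :=
      hud.eq_deriv _ h1 (hz'.hasDerivWithinAt.congr hz (hz x hx))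
    simp only [leftTrace, rightTrace, Method.valCoeff, Method.derivCoeff, inner_sub_right,
      inner_add_right, RCLike.real_smul_eq_coe_smul (K := ℂ) p, inner_smul_right, h2, hz x hx]
    simp

/-! ### Contraction of a single mode -/

section Scalar

variable {l k h α β R : ℝ}

/-- Monotonicity of tanh upgrades `gcosh l k ≤ R * gcosh l h` to the same inequality for `gsinh`.
Both terms on the left are nonnegative, so their difference is bounded by either of them, and each
is at most `R` times its counterpart on the right. -/
lemma abs_even_factor_le (hl : 0 ≤ l) (hk : 0 ≤ k) (hkh : k ≤ h) (hα : 0 ≤ α) (hβ : 0 ≤ β)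
    (hR : gcosh l k ≤ R * gcosh l h) :
    |α * gcosh l k - β * (l * gsinh l k)| ≤ R * (α * gcosh l h + β * (l * gsinh l h)) := by
  have hCh := gcosh_pos hl h
  have hCk := gcosh_pos hl k
  have hSk := gsinh_nonneg hl hk
  have hSh := gsinh_nonneg hl (hk.trans hkh)
  have h1 := gsinh_mul_gcosh_le hl hkh
  have hR0 : 0 ≤ R := by
    by_contra! hcon
    nlinarith [mul_pos (neg_pos.2 hcon) hCh]
  have h2 : gsinh l k ≤ R * gsinh l h := by
    have : gsinh l k * gcosh l h ≤ (R * gsinh l h) * gcosh l h := by nlinarith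
    exact le_of_mul_le_mul_right this hCh
  have h3 : α * gcosh l k ≤ α * (R * gcosh l h) := mul_le_mul_of_nonneg_left hR hα
  have h4 : β * (l * gsinh l k) ≤ β * (l * (R * gsinh l h)) := by gcongr
  have h5 : 0 ≤ α * gcosh l k := by positivity
  have h6 : 0 ≤ β * (l * gsinh l k) := by positivity
  rw [abs_le]; constructor <;> nlinarith

lemma abs_odd_factor_le (hl : 0 ≤ l) (hk : 0 ≤ k) (hkh : k ≤ h) (hα : 0 ≤ α) (hβ : 0 ≤ β)
    (hR : gcosh l k ≤ R * gcosh l h) :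
    |α * gsinh l k - β * gcosh l k| ≤ R * (α * gsinh l h + β * gcosh l h) := by
  have hCh := gcosh_pos hl h
  have hCk := gcosh_pos hl k
  have hSk := gsinh_nonneg hl hk
  have hSh := gsinh_nonneg hl (hk.trans hkh)
  have h1 := gsinh_mul_gcosh_le hl hkh
  have hR0 : 0 ≤ R := by
    by_contra! hcon
    nlinarith [mul_pos (neg_pos.2 hcon) hCh]
  have h2 : gsinh l k ≤ R * gsinh l h := by
    have : gsinh l k * gcosh l h ≤ (R * gsinh l h) * gcosh l h := by nlinarith
    exact le_of_mul_le_mul_right this hCh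
  have h3 : α * gsinh l k ≤ α * (R * gsinh l h) := mul_le_mul_of_nonneg_left h2 hα
  have h4 : β * gcosh l k ≤ β * (R * gcosh l h) := by gcongr
  have h5 : 0 ≤ α * gsinh l k := by positivity
  have h6 : 0 ≤ β * gcosh l k := by positivity
  rw [abs_le]; constructor <;> nlinarith

/-- In an end subdomain distances are measured from the outer Dirichlet side: `h + k` to the
handover line, `h + h` to the interface. The addition formulas reduce this to the comparison of `k`
with `h`, without loss in the constant. -/
lemma abs_end_factor_le (hl : 0 ≤ l) (hk : 0 ≤ k) (hkh : k ≤ h) (hα : 0 ≤ α) (hβ : 0 ≤ β)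
    (hR : gcosh l k ≤ R * gcosh l h) :
    |α * gsinh l (h + k) - β * gcosh l (h + k)| ≤
      R * (α * gsinh l (h + h) + β * gcosh l (h + h)) := by
  have hCh := gcosh_pos hl h
  have hCk := gcosh_pos hl k
  have hSk := gsinh_nonneg hl hk
  have hSh := gsinh_nonneg hl (hk.trans hkh)
  have h1 := gsinh_mul_gcosh_le hl hkh
  have hR0 : 0 ≤ R := by
    by_contra! hcon
    nlinarith [mul_pos (neg_pos.2 hcon) hCh]
  have h2 : gsinh l k ≤ R * gsinh l h := by
    have : gsinh l k * gcosh l h ≤ (R * gsinh l h) * gcosh l h := by nlinarith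
    exact le_of_mul_le_mul_right this hCh
  have hS : gsinh l (h + k) ≤ R * gsinh l (h + h) := by
    rw [gsinh_add, gsinh_add]; nlinarith
  have hC : gcosh l (h + k) ≤ R * gcosh l (h + h) := by
    rw [gcosh_add, gcosh_add]
    have := mul_le_mul_of_nonneg_left hR hCh.le
    have h7 : l * (gsinh l h * gsinh l k) ≤ l * (gsinh l h * (R * gsinh l h)) := by gcongr
    nlinarith
  have h3 := mul_le_mul_of_nonneg_left hS hα
  have h4 := mul_le_mul_of_nonneg_left hC hβ
  have h5 : 0 ≤ α * gsinh l (h + k) := mul_nonneg hα (gsinh_nonneg hl (by linarith))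
  have h6 : 0 ≤ β * gcosh l (h + k) := mul_nonneg hβ (gcosh_pos hl _).le
  rw [abs_le]; constructor <;> nlinarith

end Scalar

lemma norm_sub_sq_add_norm_add_sq (x y : ℂ) :
    ‖x - y‖ ^ 2 + ‖x + y‖ ^ 2 = 2 * (‖x‖ ^ 2 + ‖y‖ ^ 2) := by
  have := parallelogram_law_with_norm ℝ x y
  nlinarith

lemma norm_mul_ofReal_sq_le {A : ℂ} {x y R : ℝ} (h : |x| ≤ R * y) :
    ‖A * (x : ℂ)‖ ^ 2 ≤ R ^ 2 * ‖A * (y : ℂ)‖ ^ 2 := by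
  have h0 : x ^ 2 ≤ (R * y) ^ 2 := by
    rw [← sq_abs x]; exact pow_le_pow_left₀ (abs_nonneg _) h 2
  simp only [norm_mul, mul_pow, Complex.norm_real, Real.norm_eq_abs, sq_abs] at h0 ⊢
  nlinarith [mul_le_mul_of_nonneg_left h0 (sq_nonneg ‖A‖)]

lemma hasDerivAt_comb_shift (A B : ℂ) (l c x : ℝ) :
    HasDerivAt (fun y => A * gcosh l (y - c) + B * gsinh l (y - c))
      (B * gcosh l (x - c) + (l * A) * gsinh l (x - c)) x :=
  (hasDerivAt_comb A B l (x - c)).comp_sub_const x c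

/-! ### Estimates on one subdomain -/

section Blocks

variable {bc : External} {q : ℝ} {ι : Type} {e : HilbertBasis ι ℂ L2Y} {lam : ι → ℝ}
  {φ : ι → ℝ → ℂ} {L δ : ℝ}

lemma IsEigenbasis.gcosh_le (he : IsEigenbasis bc q e lam φ) (hL : 0 < L) (hδ : 0 < δ) (i : ι) :
    gcosh (lam i) (L / 2 - δ) ≤ rhoExt bc L δ q * gcosh (lam i) (L / 2 + δ) := by
  have h1 := rho_le_rho hL hδ (lambda1_nonneg bc q) (he.le i)
  rw [rho_eq L δ (he.nonneg i), div_le_iff₀ (gcosh_pos (he.nonneg i) _)] at h1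
  exact h1

/-- Estimates on a subdomain whose two vertical sides are interfaces. -/
lemma IsEigenbasis.interior_block (he : IsEigenbasis bc q e lam φ) (hL : 0 < L) (hδ : 0 < δ)
    (hδL : δ < L / 2) {m : Method} {a b : ℝ} (hb : b = a + L + 2 * δ) {u : ℝ → L2Y}
    (hr : Regular m a b u) (hs : SolvesPoisson bc q a b 0 u) :
    ‖leftTrace m a b u (a + L)‖ ^ 2 + ‖rightTrace m a b u (a + 2 * δ)‖ ^ 2 ≤
      rhoExt bc L δ q ^ 2 * (‖leftTrace m a b u a‖ ^ 2 + ‖rightTrace m a b u b‖ ^ 2) ∧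
    ∀ x ∈ Icc a b, ‖u x‖ ^ 2 ≤
      (1 / m.valCoeff) ^ 2 * (‖leftTrace m a b u a‖ ^ 2 + ‖rightTrace m a b u b‖ ^ 2) := by
  have hab : a < b := by linarith
  have hα := m.valCoeff_pos
  have hβ := m.derivCoeff_nonneg
  set h := L / 2 + δ with hh
  set k := L / 2 - δ with hk
  -- Modes are expanded about the midpoint `a + h`, so that `A` and `B` are the even and odd parts
  -- under the reflection exchanging the two interfaces.
  have key : ∀ i, ∃ A B : ℂ,
      (∀ x ∈ Icc a b, inner ℂ (e i) (u x) =
        A * gcosh (lam i) (x - (a + h)) + B * gsinh (lam i) (x - (a + h))) ∧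
      ∀ x ∈ Icc a b, inner ℂ (e i) (leftTrace m a b u x) = m.valCoeff *
          (A * gcosh (lam i) (x - (a + h)) + B * gsinh (lam i) (x - (a + h))) - m.derivCoeff *
          (B * gcosh (lam i) (x - (a + h)) + (lam i * A) * gsinh (lam i) (x - (a + h))) ∧
        inner ℂ (e i) (rightTrace m a b u x) = m.valCoeff *
          (A * gcosh (lam i) (x - (a + h)) + B * gsinh (lam i) (x - (a + h))) + m.derivCoeff *
          (B * gcosh (lam i) (x - (a + h)) + (lam i * A) * gsinh (lam i) (x - (a + h))) := by
    intro i
    obtain ⟨A, B, hAB⟩ := he.exists_inner_eq hab hr.continuousOn hs (a + h) i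
    exact ⟨A, B, hAB, fun x hx =>
      inner_traces hab hr (e i) hx (hasDerivAt_comb_shift A B (lam i) (a + h) x) hAB⟩
  choose A B hAB hT using key
  have hl : ∀ i, inner ℂ (e i) (leftTrace m a b u a) =
      A i * ((m.valCoeff * gcosh (lam i) h + m.derivCoeff * (lam i * gsinh (lam i) h) : ℝ) : ℂ) -
      B i * ((m.valCoeff * gsinh (lam i) h + m.derivCoeff * gcosh (lam i) h : ℝ) : ℂ) := by
    intro i
    rw [(hT i a ⟨le_rfl, hab.le⟩).1, show a - (a + h) = -h by ring, gcosh_neg, gsinh_neg]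
    push_cast; ring
  have hr' : ∀ i, inner ℂ (e i) (rightTrace m a b u b) =
      A i * ((m.valCoeff * gcosh (lam i) h + m.derivCoeff * (lam i * gsinh (lam i) h) : ℝ) : ℂ) +
      B i * ((m.valCoeff * gsinh (lam i) h + m.derivCoeff * gcosh (lam i) h : ℝ) : ℂ) := by
    intro i
    rw [(hT i b ⟨hab.le, le_rfl⟩).2, show b - (a + h) = h by rw [hb, hh]; ring]
    push_cast; ring
  have hor : ∀ i, inner ℂ (e i) (leftTrace m a b u (a + L)) =
      A i * ((m.valCoeff * gcosh (lam i) k - m.derivCoeff * (lam i * gsinh (lam i) k) : ℝ) : ℂ) +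
      B i * ((m.valCoeff * gsinh (lam i) k - m.derivCoeff * gcosh (lam i) k : ℝ) : ℂ) := by
    intro i
    rw [(hT i (a + L) ⟨by linarith, by linarith⟩).1,
      show a + L - (a + h) = k by rw [hh, hk]; ring]
    push_cast; ring
  have hol : ∀ i, inner ℂ (e i) (rightTrace m a b u (a + 2 * δ)) =
      A i * ((m.valCoeff * gcosh (lam i) k - m.derivCoeff * (lam i * gsinh (lam i) k) : ℝ) : ℂ) -
      B i * ((m.valCoeff * gsinh (lam i) k - m.derivCoeff * gcosh (lam i) k : ℝ) : ℂ) := by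
    intro i
    rw [(hT i (a + 2 * δ) ⟨by linarith, by linarith⟩).2,
      show a + 2 * δ - (a + h) = -k by rw [hh, hk]; ring, gcosh_neg, gsinh_neg]
    push_cast; ring
  constructor
  · refine norm_sq_add_norm_sq_le e fun i => ?_
    -- Incoming and outgoing data both have the form `X - Y`, `X + Y` with `X` even and `Y` odd, so
    -- the parallelogram law removes the cross terms on both sides.
    rw [hl, hr', hor, hol, norm_sub_sq_add_norm_add_sq, add_comm (‖_ + _‖ ^ 2),
      norm_sub_sq_add_norm_add_sq]
    have h1 := norm_mul_ofReal_sq_le (A := A i) (abs_even_factor_le (he.nonneg i)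
      (by linarith : 0 ≤ k) (by linarith : k ≤ h) hα.le hβ (he.gcosh_le hL hδ i))
    have h2 := norm_mul_ofReal_sq_le (A := B i) (abs_odd_factor_le (he.nonneg i)
      (by linarith : 0 ≤ k) (by linarith : k ≤ h) hα.le hβ (he.gcosh_le hL hδ i))
    linarith
  · intro x hx
    have := norm_sq_add_norm_sq_le e (u₁ := u x) (u₂ := 0) (v₁ := leftTrace m a b u a)
      (v₂ := rightTrace m a b u b) (C := (1 / m.valCoeff) ^ 2) fun i => by
        have hxh : |x - (a + h)| ≤ h := abs_le.2 ⟨by linarith [hx.1], by linarith [hx.2]⟩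
        have hl0 := he.nonneg i
        have hSh : 0 ≤ gsinh (lam i) h := gsinh_nonneg hl0 (by linarith)
        have hCh := (gcosh_pos hl0 h).le
        rw [hl, hr', norm_sub_sq_add_norm_add_sq, hAB i x hx, inner_zero_right]
        have h1 : ‖A i * (gcosh (lam i) (x - (a + h)) : ℂ)‖ ^ 2 ≤ (1 / m.valCoeff) ^ 2 * ‖A i *
            ((m.valCoeff * gcosh (lam i) h + m.derivCoeff * (lam i * gsinh (lam i) h) : ℝ) : ℂ)‖ ^ 2 := by
          refine norm_mul_ofReal_sq_le ((abs_gcosh_le hl0 hxh).trans ?_)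
          rw [one_div, ← div_eq_inv_mul, le_div_iff₀ hα, mul_comm]
          exact le_add_of_nonneg_right (by positivity)
        have h2 : ‖B i * (gsinh (lam i) (x - (a + h)) : ℂ)‖ ^ 2 ≤ (1 / m.valCoeff) ^ 2 * ‖B i *
            ((m.valCoeff * gsinh (lam i) h + m.derivCoeff * gcosh (lam i) h : ℝ) : ℂ)‖ ^ 2 := by
          refine norm_mul_ofReal_sq_le ((abs_gsinh_le hl0 hxh).trans ?_)
          rw [one_div, ← div_eq_inv_mul, le_div_iff₀ hα, mul_comm]
          exact le_add_of_nonneg_right (by positivity)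
        -- The factor `2` lost in bounding `‖X + Y‖²` by `2 (‖X‖² + ‖Y‖²)` is the factor `2` in the
        -- incoming data, which leaves the constant `1 / α`.
        have h3 := norm_sub_sq_add_norm_add_sq (A i * (gcosh (lam i) (x - (a + h)) : ℂ))
          (B i * (gsinh (lam i) (x - (a + h)) : ℂ))
        have h4 := sq_nonneg ‖A i * (gcosh (lam i) (x - (a + h)) : ℂ)
          - B i * (gsinh (lam i) (x - (a + h)) : ℂ)‖
        simp only [norm_zero]
        nlinarith
    simpa using this

/-- Estimates on the leftmost subdomain of a chain. -/
lemma IsEigenbasis.left_block (he : IsEigenbasis bc q e lam φ) (hL : 0 < L) (hδ : 0 < δ)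
    (hδL : δ < L / 2) {m : Method} {a b : ℝ} (hb : b = a + L + 2 * δ) {u : ℝ → L2Y}
    (hr : Regular m a b u) (hs : SolvesPoisson bc q a b 0 u) (h0 : u a = 0) :
    ‖leftTrace m a b u (a + L)‖ ^ 2 ≤ rhoExt bc L δ q ^ 2 * ‖rightTrace m a b u b‖ ^ 2 ∧
    ∀ x ∈ Icc a b, ‖u x‖ ^ 2 ≤ (1 / m.valCoeff) ^ 2 * ‖rightTrace m a b u b‖ ^ 2 := by
  have hab : a < b := by linarith
  have hα := m.valCoeff_pos
  have hβ := m.derivCoeff_nonneg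
  set h := L / 2 + δ with hh
  set k := L / 2 - δ with hk
  -- Expanding about the Dirichlet end kills the even part, and a single coefficient remains.
  have key : ∀ i, ∃ B : ℂ, ∀ x ∈ Icc a b,
      inner ℂ (e i) (u x) = B * gsinh (lam i) (x - a) := by
    intro i
    obtain ⟨A, B, hAB⟩ := he.exists_inner_eq hab hr.continuousOn hs a i
    have hA : A = 0 := by simpa [h0] using (hAB a ⟨le_rfl, hab.le⟩).symm
    exact ⟨B, fun x hx => by rw [hAB x hx, hA, zero_mul, zero_add]⟩
  choose B hB using key
  have hT : ∀ i, ∀ x ∈ Icc a b, _ := fun i x hx =>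
    inner_traces hab hr (e i) hx (hasDerivAt_comb_shift 0 (B i) (lam i) a x)
      (fun y hy => by rw [hB i y hy, zero_mul, zero_add])
  have hr' : ∀ i, inner ℂ (e i) (rightTrace m a b u b) = B i * ((m.valCoeff *
      gsinh (lam i) (h + h) + m.derivCoeff * gcosh (lam i) (h + h) : ℝ) : ℂ) := by
    intro i
    rw [(hT i b ⟨hab.le, le_rfl⟩).2, show b - a = h + h by rw [hb, hh]; ring]
    push_cast; ring
  have hor : ∀ i, inner ℂ (e i) (leftTrace m a b u (a + L)) = B i * ((m.valCoeff *
      gsinh (lam i) (h + k) - m.derivCoeff * gcosh (lam i) (h + k) : ℝ) : ℂ) := by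
    intro i
    rw [(hT i (a + L) ⟨by linarith, by linarith⟩).1,
      show a + L - a = h + k by rw [hh, hk]; ring]
    push_cast; ring
  constructor
  · have := norm_sq_add_norm_sq_le e (u₁ := leftTrace m a b u (a + L)) (u₂ := 0)
      (v₁ := rightTrace m a b u b) (v₂ := 0) (C := rhoExt bc L δ q ^ 2) fun i => by
        rw [hor, hr', inner_zero_right]
        simpa using norm_mul_ofReal_sq_le (A := B i) (abs_end_factor_le (he.nonneg i)
          (by linarith : 0 ≤ k) (by linarith : k ≤ h) hα.le hβ (he.gcosh_le hL hδ i))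
    simpa using this
  · intro x hx
    have := norm_sq_add_norm_sq_le e (u₁ := u x) (u₂ := 0) (v₁ := rightTrace m a b u b)
      (v₂ := 0) (C := (1 / m.valCoeff) ^ 2) fun i => by
        have hl0 := he.nonneg i
        have hxh : |x - a| ≤ h + h := abs_le.2 ⟨by linarith [hx.1], by linarith [hx.2]⟩
        have hCh := (gcosh_pos hl0 (h + h)).le
        rw [hr', hB i x hx, inner_zero_right, norm_zero]
        have h2 : ‖B i * (gsinh (lam i) (x - a) : ℂ)‖ ^ 2 ≤ (1 / m.valCoeff) ^ 2 * ‖B i *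
            ((m.valCoeff * gsinh (lam i) (h + h) + m.derivCoeff * gcosh (lam i) (h + h) : ℝ) : ℂ)‖
              ^ 2 := by
          refine norm_mul_ofReal_sq_le ((abs_gsinh_le hl0 hxh).trans ?_)
          rw [one_div, ← div_eq_inv_mul, le_div_iff₀ hα, mul_comm]
          exact le_add_of_nonneg_right (by positivity)
        simpa using h2
    simpa using this

/-- Estimates on the rightmost subdomain of a chain. -/
lemma IsEigenbasis.right_block (he : IsEigenbasis bc q e lam φ) (hL : 0 < L) (hδ : 0 < δ)
    (hδL : δ < L / 2) {m : Method} {a b : ℝ} (hb : b = a + L + 2 * δ) {u : ℝ → L2Y}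
    (hr : Regular m a b u) (hs : SolvesPoisson bc q a b 0 u) (h0 : u b = 0) :
    ‖rightTrace m a b u (a + 2 * δ)‖ ^ 2 ≤ rhoExt bc L δ q ^ 2 * ‖leftTrace m a b u a‖ ^ 2 ∧
    ∀ x ∈ Icc a b, ‖u x‖ ^ 2 ≤ (1 / m.valCoeff) ^ 2 * ‖leftTrace m a b u a‖ ^ 2 := by
  have hab : a < b := by linarith
  have hα := m.valCoeff_pos
  have hβ := m.derivCoeff_nonneg
  set h := L / 2 + δ with hh
  set k := L / 2 - δ with hk
  have key : ∀ i, ∃ B : ℂ, ∀ x ∈ Icc a b,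
      inner ℂ (e i) (u x) = B * gsinh (lam i) (x - b) := by
    intro i
    obtain ⟨A, B, hAB⟩ := he.exists_inner_eq hab hr.continuousOn hs b i
    have hA : A = 0 := by simpa [h0] using (hAB b ⟨hab.le, le_rfl⟩).symm
    exact ⟨B, fun x hx => by rw [hAB x hx, hA, zero_mul, zero_add]⟩
  choose B hB using key
  have hT : ∀ i, ∀ x ∈ Icc a b, _ := fun i x hx =>
    inner_traces hab hr (e i) hx (hasDerivAt_comb_shift 0 (B i) (lam i) b x)
      (fun y hy => by rw [hB i y hy, zero_mul, zero_add])
  have hl' : ∀ i, inner ℂ (e i) (leftTrace m a b u a) = -B i * ((m.valCoeff *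
      gsinh (lam i) (h + h) + m.derivCoeff * gcosh (lam i) (h + h) : ℝ) : ℂ) := by
    intro i
    rw [(hT i a ⟨le_rfl, hab.le⟩).1, show a - b = -(h + h) by rw [hb, hh]; ring, gcosh_neg,
      gsinh_neg]
    push_cast; ring
  have hol : ∀ i, inner ℂ (e i) (rightTrace m a b u (a + 2 * δ)) = -B i * ((m.valCoeff *
      gsinh (lam i) (h + k) - m.derivCoeff * gcosh (lam i) (h + k) : ℝ) : ℂ) := by
    intro i
    rw [(hT i (a + 2 * δ) ⟨by linarith, by linarith⟩).2,
      show a + 2 * δ - b = -(h + k) by rw [hb, hh, hk]; ring, gcosh_neg, gsinh_neg]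
    push_cast; ring
  constructor
  · have := norm_sq_add_norm_sq_le e (u₁ := rightTrace m a b u (a + 2 * δ)) (u₂ := 0)
      (v₁ := leftTrace m a b u a) (v₂ := 0) (C := rhoExt bc L δ q ^ 2) fun i => by
        rw [hol, hl', inner_zero_right]
        simpa using norm_mul_ofReal_sq_le (A := -B i) (abs_end_factor_le (he.nonneg i)
          (by linarith : 0 ≤ k) (by linarith : k ≤ h) hα.le hβ (he.gcosh_le hL hδ i))
    simpa using this
  · intro x hx
    have := norm_sq_add_norm_sq_le e (u₁ := u x) (u₂ := 0) (v₁ := leftTrace m a b u a)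
      (v₂ := 0) (C := (1 / m.valCoeff) ^ 2) fun i => by
        have hl0 := he.nonneg i
        have hxh : |x - b| ≤ h + h := abs_le.2 ⟨by linarith [hx.1], by linarith [hx.2]⟩
        have hCh := (gcosh_pos hl0 (h + h)).le
        rw [hl', hB i x hx, inner_zero_right, norm_zero]
        have h2 : ‖B i * (gsinh (lam i) (x - b) : ℂ)‖ ^ 2 ≤ (1 / m.valCoeff) ^ 2 * ‖B i *
            ((m.valCoeff * gsinh (lam i) (h + h) + m.derivCoeff * gcosh (lam i) (h + h) : ℝ) : ℂ)‖
              ^ 2 := by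
          refine norm_mul_ofReal_sq_le ((abs_gsinh_le hl0 hxh).trans ?_)
          rw [one_div, ← div_eq_inv_mul, le_div_iff₀ hα, mul_comm]
          exact le_add_of_nonneg_right (by positivity)
        simpa using h2
    simpa using this

/-- A single subdomain with zero data on both vertical sides carries only the zero solution. -/
lemma IsEigenbasis.eq_zero_of_ends (he : IsEigenbasis bc q e lam φ) {a b : ℝ} (hab : a < b)
    {u : ℝ → L2Y} (hc : ContinuousOn u (Icc a b)) (hs : SolvesPoisson bc q a b 0 u)
    (ha : u a = 0) (hb : u b = 0) : ∀ x ∈ Icc a b, u x = 0 := by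
  intro x hx
  have hz : ∀ i, inner ℂ (e i) (u x) = 0 := by
    intro i
    obtain ⟨A, B, hAB⟩ := he.exists_inner_eq hab hc hs a i
    have hA : A = 0 := by simpa [ha] using (hAB a ⟨le_rfl, hab.le⟩).symm
    have hB : B = 0 := by
      have := hAB b ⟨hab.le, le_rfl⟩
      rw [hb, hA, inner_zero_right, zero_mul, zero_add] at this
      refine (mul_eq_zero.1 this.symm).resolve_right ?_
      exact_mod_cast (gsinh_pos (he.nonneg i) (sub_pos.2 hab)).ne'
    rw [hAB x hx, hA, hB]; simp
  have := hasSum_norm_inner_sq e (u x)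
  simp only [hz, norm_zero, ne_eq, OfNat.ofNat_ne_zero, not_false_eq_true, zero_pow] at this
  simpa using this.unique hasSum_zero

end Blocks

/-! ### Superposition, restriction and congruence of solutions and traces -/

section Linearity

variable {m : Method} {a b : ℝ} {u w : ℝ → L2Y}

lemma Regular.add_smul (hu : Regular m a b u) (hw : Regular m a b w) (c : ℂ) :
    Regular m a b (fun x => u x + c • w x) := by
  cases m with
  | PSM =>
    have h1 : ContinuousOn u (Icc a b) := hu
    have h2 : ContinuousOn w (Icc a b) := hw
    exact h1.add (h2.const_smul c)
  | OSM p hp =>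
    have h1 : ContDiffOn ℝ 1 u (Icc a b) := hu
    have h2 : ContDiffOn ℝ 1 w (Icc a b) := hw
    exact h1.add (h2.const_smul c)

lemma Regular.mono {a' b' : ℝ} (hu : Regular m a b u) (h : Icc a' b' ⊆ Icc a b) :
    Regular m a' b' u := by
  cases m with
  | PSM => exact ContinuousOn.mono (show ContinuousOn u (Icc a b) from hu) h
  | OSM p hp => exact ContDiffOn.mono (show ContDiffOn ℝ 1 u (Icc a b) from hu) h

lemma traces_add_smul (hab : a < b) (hu : Regular m a b u) (hw : Regular m a b w) (c : ℂ)
    {x : ℝ} (hx : x ∈ Icc a b) :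
    leftTrace m a b (fun x => u x + c • w x) x = leftTrace m a b u x + c • leftTrace m a b w x ∧
    rightTrace m a b (fun x => u x + c • w x) x
      = rightTrace m a b u x + c • rightTrace m a b w x := by
  cases m with
  | PSM => exact ⟨rfl, rfl⟩
  | OSM p hp =>
    have h1 : ContDiffOn ℝ 1 u (Icc a b) := hu
    have h2 : ContDiffOn ℝ 1 w (Icc a b) := hw
    have d1 := (h1.differentiableOn (by norm_num)) x hx
    have d2 := (h2.differentiableOn (by norm_num)) x hx
    have hud : UniqueDiffWithinAt ℝ (Icc a b) x := uniqueDiffOn_Icc hab x hx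
    have hd : derivWithin (fun x => u x + c • w x) (Icc a b) x
        = derivWithin u (Icc a b) x + c • derivWithin w (Icc a b) x :=
      (d1.hasDerivWithinAt.add (d2.hasDerivWithinAt.const_smul c)).derivWithin hud
    simp only [leftTrace, rightTrace, hd, smul_add, smul_sub, smul_comm p c]
    constructor <;> abel

lemma traces_of_subset {a' b' : ℝ} (hab : a < b) (hu : Regular m a' b' u)
    (h : Icc a b ⊆ Icc a' b') {x : ℝ} (hx : x ∈ Icc a b) :
    leftTrace m a b u x = leftTrace m a' b' u x ∧
    rightTrace m a b u x = rightTrace m a' b' u x := by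
  cases m with
  | PSM => exact ⟨rfl, rfl⟩
  | OSM p hp =>
    have h1 : ContDiffOn ℝ 1 u (Icc a' b') := hu
    have d1 := (h1.differentiableOn (by norm_num)) x (h hx)
    have hd : derivWithin u (Icc a b) x = derivWithin u (Icc a' b') x :=
      (d1.hasDerivWithinAt.mono h).derivWithin (uniqueDiffOn_Icc hab x hx)
    simp only [leftTrace, rightTrace, hd, and_self]

lemma traces_congr {u' : ℝ → L2Y} (h : EqOn u u' (Icc a b)) {x : ℝ} (hx : x ∈ Icc a b) :
    leftTrace m a b u x = leftTrace m a b u' x ∧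
    rightTrace m a b u x = rightTrace m a b u' x := by
  cases m with
  | PSM => exact ⟨h hx, h hx⟩
  | OSM p hp =>
    simp only [leftTrace, rightTrace, derivWithin_congr h (h hx), h hx, and_self]

lemma SolvesPoisson.add_smul {bc : External} {q : ℝ} {f f' : ℝ → L2Y}
    (hu : SolvesPoisson bc q a b f u) (hw : SolvesPoisson bc q a b f' w) (c : ℂ) :
    SolvesPoisson bc q a b (fun x => f x + c • f' x) (fun x => u x + c • w x) := by
  intro ψ hψ
  obtain ⟨V, hV⟩ := hu ψ hψ
  obtain ⟨W, hW⟩ := hw ψ hψ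
  have c0 := hψ.differentiable.continuous
  have c2 := hψ.continuous_deriv_deriv
  refine ⟨fun x => V x + c * W x, fun x hx => ⟨?_, ?_⟩⟩
  · simp only [pair_add c0, pair_smul c0]
    exact (hV x hx).1.add ((hW x hx).1.const_mul c)
  · simp only [pair_add c0, pair_smul c0, pair_add c2, pair_smul c2]
    convert! (hV x hx).2.add ((hW x hx).2.const_mul c) using 1
    ring

lemma SolvesPoisson.mono {bc : External} {q a' b' : ℝ} {f : ℝ → L2Y}
    (hu : SolvesPoisson bc q a b f u) (h : Ioo a' b' ⊆ Ioo a b) :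
    SolvesPoisson bc q a' b' f u := by
  intro ψ hψ
  obtain ⟨V, hV⟩ := hu ψ hψ
  exact ⟨V, fun x hx => hV x (h hx)⟩

end Linearity

/-! ### From one subdomain to the chain -/

section Chain

variable {m : Method} {bc : External} {q L δ : ℝ}

lemma aPt_succ (L : ℝ) (j : ℕ) : aPt L (j + 1) = aPt L j + L := by
  simp only [aPt]; push_cast; ring

lemma bPt_eq (L δ : ℝ) (j : ℕ) : bPt L δ j = aPt L j + L + 2 * δ := by
  simp only [aPt, bPt]; ring

lemma bPt_eq_succ (L δ : ℝ) (j : ℕ) : bPt L δ j = aPt L (j + 1) + 2 * δ := by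
  rw [bPt_eq, aPt_succ]

lemma aPt_lt_bPt (hL : 0 < L) (hδ : 0 < δ) (j : ℕ) : aPt L j < bPt L δ j := by
  rw [bPt_eq]; linarith

lemma aPt_succ_mem (hL : 0 < L) (hδ : 0 < δ) (j : ℕ) :
    aPt L (j + 1) ∈ Icc (aPt L j) (bPt L δ j) := by
  rw [bPt_eq, aPt_succ]; constructor <;> linarith

lemma bPt_mem_succ (hL : 0 < L) (hδ : 0 < δ) (j : ℕ) :
    bPt L δ j ∈ Icc (aPt L (j + 1)) (bPt L δ (j + 1)) := by
  rw [bPt_eq L δ (j + 1), bPt_eq, aPt_succ]; constructor <;> linarith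

lemma ownTraces_add_smul (hL : 0 < L) (hδ : 0 < δ) {N : ℕ} {v w : ℕ → ℝ → L2Y}
    (hv : ∀ j < N, Regular m (aPt L j) (bPt L δ j) (v j))
    (hw : ∀ j < N, Regular m (aPt L j) (bPt L δ j) (w j)) (c : ℂ) :
    ownTraces m L δ N (fun j x => v j x + c • w j x)
      = ownTraces m L δ N v + c • ownTraces m L δ N w := by
  ext1 s
  rcases s with j | j
  · have hj : (j : ℕ) + 1 < N := by omega
    exact (traces_add_smul (aPt_lt_bPt hL hδ _) (hv _ hj) (hw _ hj) c
      ⟨le_rfl, (aPt_lt_bPt hL hδ _).le⟩).1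
  · have hj : (j : ℕ) < N := by omega
    exact (traces_add_smul (aPt_lt_bPt hL hδ _) (hv _ hj) (hw _ hj) c
      ⟨(aPt_lt_bPt hL hδ _).le, le_rfl⟩).2

lemma neighbourTraces_add_smul (hL : 0 < L) (hδ : 0 < δ) {N : ℕ} {v w : ℕ → ℝ → L2Y}
    (hv : ∀ j < N, Regular m (aPt L j) (bPt L δ j) (v j))
    (hw : ∀ j < N, Regular m (aPt L j) (bPt L δ j) (w j)) (c : ℂ) :
    neighbourTraces m L δ N (fun j x => v j x + c • w j x)
      = neighbourTraces m L δ N v + c • neighbourTraces m L δ N w := by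
  ext1 s
  rcases s with j | j
  · have hj : (j : ℕ) < N := by omega
    exact (traces_add_smul (aPt_lt_bPt hL hδ _) (hv _ hj) (hw _ hj) c (aPt_succ_mem hL hδ _)).1
  · have hj : (j : ℕ) + 1 < N := by omega
    exact (traces_add_smul (aPt_lt_bPt hL hδ _) (hv _ hj) (hw _ hj) c (bPt_mem_succ hL hδ _)).2

lemma neighbourTraces_congr (hL : 0 < L) (hδ : 0 < δ) {N : ℕ} {v w : ℕ → ℝ → L2Y}
    (h : ∀ j < N, EqOn (v j) (w j) (Icc (aPt L j) (bPt L δ j))) :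
    neighbourTraces m L δ N v = neighbourTraces m L δ N w := by
  ext1 s
  rcases s with j | j
  · exact (traces_congr (h j (by omega)) (aPt_succ_mem hL hδ _)).1
  · exact (traces_congr (h (j + 1) (by omega)) (bPt_mem_succ hL hδ _)).2

lemma SolvesLocal.add_smul (hL : 0 < L) (hδ : 0 < δ) {N : ℕ} {f f' : ℝ → L2Y}
    {g g' : TraceSpace N} {v w : ℕ → ℝ → L2Y} (hv : SolvesLocal m bc q L δ N f g v)
    (hw : SolvesLocal m bc q L δ N f' g' w) (c : ℂ) :
    SolvesLocal m bc q L δ N (fun x => f x + c • f' x) (g + c • g')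
      (fun j x => v j x + c • w j x) where
  regular j hj := (hv.regular j hj).add_smul (hw.regular j hj) c
  poisson j hj := (hv.poisson j hj).add_smul (hw.poisson j hj) c
  left_end := by rw [hv.left_end, hw.left_end, smul_zero, add_zero]
  right_end := by rw [hv.right_end, hw.right_end, smul_zero, add_zero]
  traces := by rw [ownTraces_add_smul hL hδ hv.regular hw.regular, hv.traces, hw.traces]

lemma norm_ownTraces_sq (m : Method) (L δ : ℝ) (M : ℕ) (v : ℕ → ℝ → L2Y) :
    ‖ownTraces m L δ (M + 1) v‖ ^ 2 =
      ∑ j ∈ Finset.range M, ‖leftTrace m (aPt L (j + 1)) (bPt L δ (j + 1)) (v (j + 1))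
        (aPt L (j + 1))‖ ^ 2 +
      ∑ j ∈ Finset.range M, ‖rightTrace m (aPt L j) (bPt L δ j) (v j) (bPt L δ j)‖ ^ 2 := by
  rw [PiLp.norm_sq_eq_of_L2, Fintype.sum_sum_type, Finset.sum_range, Finset.sum_range]
  rfl

lemma norm_neighbourTraces_sq (m : Method) (L δ : ℝ) (M : ℕ) (v : ℕ → ℝ → L2Y) :
    ‖neighbourTraces m L δ (M + 1) v‖ ^ 2 =
      ∑ j ∈ Finset.range M, ‖leftTrace m (aPt L j) (bPt L δ j) (v j) (aPt L (j + 1))‖ ^ 2 +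
      ∑ j ∈ Finset.range M, ‖rightTrace m (aPt L (j + 1)) (bPt L δ (j + 1)) (v (j + 1))
        (bPt L δ j)‖ ^ 2 := by
  rw [PiLp.norm_sq_eq_of_L2, Fintype.sum_sum_type, Finset.sum_range, Finset.sum_range]
  rfl

/-- Regroups sums over interfaces as a sum over subdomains; the outermost sides carry no interface,
hence `x 0 = 0` and `y M = 0`. -/
lemma sum_range_add_sum_range {M : ℕ} {x y x' y' : ℕ → ℝ} (hx0 : x 0 = 0) (hyM : y M = 0)
    (hx : ∀ j < M, x (j + 1) = x' (j + 1)) (hy : ∀ j < M, y j = y' j) :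
    ∑ j ∈ Finset.range M, x' (j + 1) + ∑ j ∈ Finset.range M, y' j
      = ∑ j ∈ Finset.range (M + 1), (x j + y j) := by
  rw [Finset.sum_add_distrib, Finset.sum_range_succ', Finset.sum_range_succ y, hx0, hyM, add_zero,
    add_zero]
  congr 1
  · exact Finset.sum_congr rfl fun j hj => (hx j (Finset.mem_range.1 hj)).symm
  · exact Finset.sum_congr rfl fun j hj => (hy j (Finset.mem_range.1 hj)).symm

/-- Solutions of the homogeneous subdomain problems are controlled by their interface data, and
the data handed to the neighbours are smaller by the factor `rhoExt`. -/
lemma IsEigenbasis.local_estimates {ι : Type} {e : HilbertBasis ι ℂ L2Y} {lam : ι → ℝ}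
    {φ : ι → ℝ → ℂ} (he : IsEigenbasis bc q e lam φ) (hL : 0 < L) (hδ : 0 < δ) (hδL : δ < L / 2)
    {N : ℕ} (hN : 1 ≤ N) {g : TraceSpace N} {v : ℕ → ℝ → L2Y}
    (hv : SolvesLocal m bc q L δ N 0 g v) :
    ‖neighbourTraces m L δ N v‖ ≤ rhoExt bc L δ q * ‖g‖ ∧
    ∀ j < N, ∀ x ∈ Icc (aPt L j) (bPt L δ j), ‖v j x‖ ≤ 1 / m.valCoeff * ‖g‖ := by
  obtain ⟨M, rfl⟩ : ∃ M, N = M + 1 := ⟨N - 1, by omega⟩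
  have hρ : 0 < rhoExt bc L δ q := rho_pos _ _ _
  have hα := m.valCoeff_pos
  let lt : ℕ → L2Y := fun j => leftTrace m (aPt L j) (bPt L δ j) (v j) (aPt L j)
  let rt : ℕ → L2Y := fun j => rightTrace m (aPt L j) (bPt L δ j) (v j) (bPt L δ j)
  let ort : ℕ → L2Y := fun j => leftTrace m (aPt L j) (bPt L δ j) (v j) (aPt L (j + 1))
  -- At `j = 0` the truncated index `j - 1` gives a meaningless trace, which `Lout` replaces by `0`.
  let olt : ℕ → L2Y := fun j => rightTrace m (aPt L j) (bPt L δ j) (v j) (bPt L δ (j - 1))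
  let Lin : ℕ → ℝ := fun j => if j = 0 then 0 else ‖lt j‖ ^ 2
  let Rin : ℕ → ℝ := fun j => if j = M then 0 else ‖rt j‖ ^ 2
  let Lout : ℕ → ℝ := fun j => if j = 0 then 0 else ‖olt j‖ ^ 2
  let Rout : ℕ → ℝ := fun j => if j = M then 0 else ‖ort j‖ ^ 2
  have hown : ‖g‖ ^ 2 = ∑ j ∈ Finset.range (M + 1), (Lin j + Rin j) := by
    rw [← hv.traces, norm_ownTraces_sq]
    exact sum_range_add_sum_range (x := Lin) (y := Rin) (x' := fun j => ‖lt j‖ ^ 2)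
      (y' := fun j => ‖rt j‖ ^ 2) (by simp [Lin]) (by simp [Rin]) (fun j _ => by simp [Lin])
      (fun j hj => by simp [Rin, hj.ne])
  have hnei : ‖neighbourTraces m L δ (M + 1) v‖ ^ 2
      = ∑ j ∈ Finset.range (M + 1), (Lout j + Rout j) := by
    rw [norm_neighbourTraces_sq, add_comm]
    exact sum_range_add_sum_range (x := Lout) (y := Rout) (x' := fun j => ‖olt j‖ ^ 2)
      (y' := fun j => ‖ort j‖ ^ 2) (by simp [Lout]) (by simp [Rout]) (fun j _ => by simp [Lout])
      (fun j hj => by simp [Rout, hj.ne])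
  have hblock : ∀ j ∈ Finset.range (M + 1), Lout j + Rout j ≤ rhoExt bc L δ q ^ 2 * (Lin j + Rin j) ∧
      ∀ x ∈ Icc (aPt L j) (bPt L δ j), ‖v j x‖ ^ 2 ≤ (1 / m.valCoeff) ^ 2 * (Lin j + Rin j) := by
    intro j hj
    have hj' := Finset.mem_range.1 hj
    have hr := hv.regular j hj'
    have hs := hv.poisson j hj'
    have hort : ort j = leftTrace m (aPt L j) (bPt L δ j) (v j) (aPt L j + L) := by
      simp only [ort, aPt_succ]
    have holt : j ≠ 0 →
        olt j = rightTrace m (aPt L j) (bPt L δ j) (v j) (aPt L j + 2 * δ) := by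
      intro h0
      obtain ⟨i, rfl⟩ := Nat.exists_eq_succ_of_ne_zero h0
      simp only [olt, Nat.succ_eq_add_one, Nat.add_sub_cancel, bPt_eq_succ L δ i]
    -- The four cases are a chain of one subdomain, the leftmost one, the rightmost one, and an
    -- interior one.
    rcases eq_or_ne j 0 with h0 | h0 <;> rcases eq_or_ne j M with hM | hM
    · subst h0
      have hb : v 0 (bPt L δ 0) = 0 := by simpa [← hM] using hv.right_end
      have := he.eq_zero_of_ends (aPt_lt_bPt hL hδ 0) hr.continuousOn hs hv.left_end hb
      refine ⟨by simp [Lout, Rout, Lin, Rin, ← hM], fun x hx => ?_⟩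
      rw [this x hx]; simp [Lin, Rin, ← hM]
    · subst h0
      have := he.left_block hL hδ hδL (bPt_eq L δ 0) hr hs hv.left_end
      rw [← hort] at this
      simpa [Lout, Rout, Lin, Rin, hM, rt] using this
    · subst hM
      have := he.right_block hL hδ hδL (bPt_eq L δ j) hr hs (by simpa using hv.right_end)
      rw [← holt h0] at this
      simpa [Lout, Rout, Lin, Rin, h0, lt] using this
    · have := he.interior_block hL hδ hδL (bPt_eq L δ j) hr hs
      rw [← holt h0, ← hort] at this
      simp only [Lout, Rout, Lin, Rin, h0, hM, if_false]
      exact ⟨by rw [add_comm]; exact this.1, this.2⟩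
  have hnn : ∀ j ∈ Finset.range (M + 1), 0 ≤ Lin j + Rin j := fun j _ =>
    add_nonneg (by simp only [Lin]; split_ifs <;> positivity)
      (by simp only [Rin]; split_ifs <;> positivity)
  constructor
  · refine (pow_le_pow_iff_left₀ (norm_nonneg _) (by positivity) two_ne_zero).1 ?_
    rw [mul_pow, hown, hnei, Finset.mul_sum]
    exact Finset.sum_le_sum fun j hj => (hblock j hj).1
  · intro j hj x hx
    have hj' := Finset.mem_range.2 hj
    refine (pow_le_pow_iff_left₀ (norm_nonneg _) (by positivity) two_ne_zero).1 ?_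
    rw [mul_pow, hown]
    refine ((hblock j hj').2 x hx).trans ?_
    gcongr
    exact Finset.single_le_sum hnn hj'

end Chain

/-! ### Building `L²`-valued functions from their coefficients -/

section Synthesis

variable {ι : Type} (e : HilbertBasis ι ℂ L2Y)

open Classical in
/-- The element of `L²(0,1)` with prescribed square-summable coefficients. -/
noncomputable def synth (ζ : ι → ℂ) : L2Y :=
  if h : Memℓp ζ 2 then e.repr.symm ⟨ζ, h⟩ else 0

lemma inner_synth {ζ : ι → ℂ} (h : Summable fun i => ‖ζ i‖ ^ 2) (i : ι) :
    inner ℂ (e i) (synth e ζ) = ζ i := by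
  have hm : Memℓp ζ 2 := (memℓp_gen_iff (by norm_num)).2 (by simpa using h)
  rw [synth, dif_pos hm, ← HilbertBasis.repr_apply_apply, LinearIsometryEquiv.apply_symm_apply]

lemma eq_of_inner_eq {u v : L2Y} (h : ∀ i, inner ℂ (e i) u = inner ℂ (e i) v) : u = v := by
  apply e.repr.injective
  ext i
  rw [HilbertBasis.repr_apply_apply, HilbertBasis.repr_apply_apply, h i]

lemma summable_norm_sq_of_le {ζ : ι → ℂ} {G : ι → ℝ} (hG : Summable fun i => G i ^ 2)
    (h : ∀ i, ‖ζ i‖ ≤ G i) : Summable fun i => ‖ζ i‖ ^ 2 :=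
  hG.of_nonneg_of_le (fun _ => by positivity) fun i => pow_le_pow_left₀ (norm_nonneg _) (h i) 2

lemma summable_inner_mul_inner_of_sq {x y : ι → ℝ} (hx : Summable fun i => x i ^ 2)
    (hy : Summable fun i => y i ^ 2) (hx0 : ∀ i, 0 ≤ x i) (hy0 : ∀ i, 0 ≤ y i) :
    Summable fun i => x i * y i :=
  (hx.add hy).of_nonneg_of_le (fun i => mul_nonneg (hx0 i) (hy0 i)) fun i => by
    nlinarith [sq_nonneg (x i - y i), mul_nonneg (hx0 i) (hy0 i)]

/-- A family with continuous coefficients that are dominated in `ℓ²` is continuous. -/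
lemma continuousOn_synth {ζ : ι → ℝ → ℂ} {s : Set ℝ} {G : ι → ℝ}
    (hG : Summable fun i => G i ^ 2) (h : ∀ i, ∀ x ∈ s, ‖ζ i x‖ ≤ G i)
    (hc : ∀ i, ContinuousOn (ζ i) s) : ContinuousOn (fun x => synth e (fun i => ζ i x)) s := by
  intro x₀ hx₀
  have hsum : ∀ x ∈ s, Summable fun i => ‖ζ i x‖ ^ 2 :=
    fun x hx => summable_norm_sq_of_le hG fun i => h i x hx
  have hnorm : ∀ x ∈ s, ‖synth e (fun i => ζ i x) - synth e (fun i => ζ i x₀)‖ ^ 2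
      = ∑' i, ‖ζ i x - ζ i x₀‖ ^ 2 := by
    intro x hx
    rw [← (hasSum_norm_inner_sq e _).tsum_eq]
    exact tsum_congr fun i => by
      rw [inner_sub_right, inner_synth e (hsum x hx), inner_synth e (hsum x₀ hx₀)]
  have hlim : Filter.Tendsto (fun x => ∑' i, ‖ζ i x - ζ i x₀‖ ^ 2) (nhdsWithin x₀ s)
      (nhds (∑' _ : ι, (0 : ℝ))) := by
    -- By Parseval the squared distance is a series whose terms tend to zero and are at most `(2 * G
    -- i)²`.
    refine tendsto_tsum_of_dominated_convergence (bound := fun i => 4 * G i ^ 2)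
      (hG.mul_left 4) (fun i => ?_) ?_
    · have h1 : Filter.Tendsto (fun x => ζ i x - ζ i x₀) (nhdsWithin x₀ s) (nhds 0) := by
        have h2 : Filter.Tendsto (ζ i) (nhdsWithin x₀ s) (nhds (ζ i x₀)) := hc i x₀ hx₀
        simpa using h2.sub_const (ζ i x₀)
      simpa using h1.norm.pow 2
    · filter_upwards [self_mem_nhdsWithin] with x hx i
      have h1 := norm_sub_le (ζ i x) (ζ i x₀)
      have h2 := h i x hx
      have h3 := h i x₀ hx₀
      rw [norm_pow, norm_norm]
      calc ‖ζ i x - ζ i x₀‖ ^ 2 ≤ (2 * G i) ^ 2 :=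
            pow_le_pow_left₀ (norm_nonneg _) (by linarith) 2
        _ = 4 * G i ^ 2 := by ring
  rw [tsum_zero] at hlim
  rw [ContinuousWithinAt, tendsto_iff_norm_sub_tendsto_zero]
  have h2 : Filter.Tendsto (fun x => ‖synth e (fun i => ζ i x) - synth e (fun i => ζ i x₀)‖ ^ 2)
      (nhdsWithin x₀ s) (nhds 0) :=
    hlim.congr' (by filter_upwards [self_mem_nhdsWithin] with x hx using (hnorm x hx).symm)
  have h3 := h2.sqrt
  rw [Real.sqrt_zero] at h3
  exact h3.congr fun x => Real.sqrt_sq (norm_nonneg _)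

/-- A family with coefficients that are continuously differentiable, with derivatives dominated in
`ℓ²`, is continuously differentiable. -/
lemma contDiffOn_synth {ζ ζ' : ι → ℝ → ℂ} {a b : ℝ} (hab : a < b) {G G' : ι → ℝ}
    (hG : Summable fun i => G i ^ 2) (hG' : Summable fun i => G' i ^ 2)
    (h : ∀ i, ∀ x ∈ Icc a b, ‖ζ i x‖ ≤ G i) (h' : ∀ i, ∀ x ∈ Icc a b, ‖ζ' i x‖ ≤ G' i)
    (hd : ∀ i x, HasDerivAt (ζ i) (ζ' i x) x) (hc : ∀ i, ContinuousOn (ζ' i) (Icc a b)) :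
    ContDiffOn ℝ 1 (fun x => synth e (fun i => ζ i x)) (Icc a b) := by
  set w : ℝ → L2Y := fun x => synth e (fun i => ζ' i (projIcc a b hab.le x))
  have hw : Continuous w := by
    have h1 := continuousOn_iff_continuous_domRestrict.1 (continuousOn_synth e hG' h' hc)
    exact h1.comp continuous_projIcc
  -- The primitive of the synthesized derivative is `C¹` by construction. Its coefficients have the
  -- same initial values and derivatives as `ζ i`, so it coincides with the synthesized function.
  set U : ℝ → L2Y := fun x => synth e (fun i => ζ i a) + ∫ t in a..x, w t
  have hU : ∀ x, HasDerivAt U (w x) x := fun x =>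
    (intervalIntegral.integral_hasDerivAt_right (hw.intervalIntegrable _ _)
      (hw.stronglyMeasurableAtFilter _ _) hw.continuousAt).const_add _
  have hUC : ContDiff ℝ 1 U := by
    rw [contDiff_one_iff_deriv]
    refine ⟨fun x => (hU x).differentiableAt, ?_⟩
    rw [show deriv U = w from funext fun x => (hU x).deriv]
    exact hw
  refine hUC.contDiffOn.congr fun x hx => eq_of_inner_eq e fun i => ?_
  rw [inner_synth e (summable_norm_sq_of_le hG fun i => h i x hx)]
  have hder : ∀ y, HasDerivAt (fun y => inner ℂ (e i) (U y)) (inner ℂ (e i) (w y)) y := fun y =>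
    ((innerSL ℂ (e i)).restrictScalars ℝ).hasFDerivAt.comp_hasDerivAt y (hU y)
  have hconst := constant_of_has_deriv_right_zero (a := a) (b := b)
    (f := fun y => inner ℂ (e i) (U y) - ζ i y)
    (fun y _ => ((hder y).sub (hd i y)).continuousAt.continuousWithinAt)
    (fun y hy => by
      have hy' : y ∈ Icc a b := Ico_subset_Icc_self hy
      have h1 := ((hder y).sub (hd i y)).hasDerivWithinAt (s := Ici y)
      have h2 : inner ℂ (e i) (w y) = ζ' i y := by
        simp only [w]
        rw [projIcc_of_mem _ hy',
          inner_synth e (summable_norm_sq_of_le hG' fun i => h' i y hy')]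
      rwa [h2, sub_self] at h1) x hx
  have ha : inner ℂ (e i) (U a) = ζ i a := by
    simp only [U, intervalIntegral.integral_same, add_zero]
    exact inner_synth e (summable_norm_sq_of_le hG fun i => h i a ⟨le_rfl, hab.le⟩) i
  simp only [ha, sub_self] at hconst
  exact (sub_eq_zero.1 hconst).symm

end Synthesis

/-! ### Modal series are weak solutions -/

section Modal

variable {bc : External} {q : ℝ} {ι : Type} {e : HilbertBasis ι ℂ L2Y} {lam : ι → ℝ}
  {φ : ι → ℝ → ℂ}

lemma summable_norm_pair_sq (e : HilbertBasis ι ℂ L2Y) {ψ : ℝ → ℂ} (hψ : Continuous ψ) :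
    Summable fun i => ‖pair ψ (e i)‖ ^ 2 := by
  obtain ⟨w, hw⟩ := exists_pair_eq_inner hψ
  refine (hasSum_norm_inner_sq e w).summable.congr fun i => ?_
  rw [hw, norm_inner_symm]

lemma hasSum_pair (e : HilbertBasis ι ℂ L2Y) {ψ : ℝ → ℂ} (hψ : Continuous ψ) (v : L2Y) :
    HasSum (fun i => inner ℂ (e i) v * pair ψ (e i)) (pair ψ v) := by
  obtain ⟨w, hw⟩ := exists_pair_eq_inner hψ
  simpa only [hw, mul_comm] using e.hasSum_inner_mul_inner w v

lemma norm_comb_le {l : ℝ} (hl : 0 ≤ l) (A B : ℂ) {x h : ℝ} (hx : |x| ≤ h) :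
    ‖A * gcosh l x + B * gsinh l x‖ ≤ ‖A‖ * gcosh l h + ‖B‖ * gsinh l h := by
  refine (norm_add_le _ _).trans ?_
  rw [norm_mul, norm_mul, Complex.norm_real, Complex.norm_real]
  gcongr
  · exact abs_gcosh_le hl hx
  · exact abs_gsinh_le hl hx

lemma norm_comb'_le {l : ℝ} (hl : 0 ≤ l) (A B : ℂ) {x h : ℝ} (hx : |x| ≤ h) :
    ‖B * gcosh l x + (l * A) * gsinh l x‖ ≤ ‖A‖ * (l * gsinh l h) + ‖B‖ * gcosh l h := by
  refine (norm_comb_le hl B (l * A) hx).trans (le_of_eq ?_)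
  rw [norm_mul, Complex.norm_real, Real.norm_of_nonneg hl]; ring

/-- A family with modal coefficients `A i gcosh + B i gsinh` dominated in `ℓ²` solves the
homogeneous equation. -/
lemma IsEigenbasis.solvesPoisson (he : IsEigenbasis bc q e lam φ) (hq : 0 < q) {c h : ℝ}
    (hh : 0 < h) {A B : ι → ℂ}
    (hM : Summable fun i => (‖A i‖ * gcosh (lam i) h + ‖B i‖ * gsinh (lam i) h) ^ 2)
    {u : ℝ → L2Y} (hu : ∀ x ∈ Icc (c - h) (c + h), ∀ i, inner ℂ (e i) (u x) =
      A i * gcosh (lam i) (x - c) + B i * gsinh (lam i) (x - c)) :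
    SolvesPoisson bc q (c - h) (c + h) 0 u := by
  intro ψ hψ
  have c0 := hψ.differentiable.continuous
  have c2 := hψ.continuous_deriv_deriv
  set M : ι → ℝ := fun i => ‖A i‖ * gcosh (lam i) h + ‖B i‖ * gsinh (lam i) h
  -- `D` lists the moduli of the coefficients of `ψ - ψ''`, hence lies in `ℓ²`: the regularity and
  -- boundary conditions of the test function pay for one factor `lam i`. The products `M i * D i`
  -- are then summable and dominate the pairing series and its two derivatives up to constants.
  set D : ι → ℝ := fun i => (1 + lam i) * ‖pair ψ (e i)‖
  have hM0 : ∀ i, 0 ≤ M i := fun i => add_nonneg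
    (mul_nonneg (norm_nonneg _) (gcosh_pos (he.nonneg i) _).le)
    (mul_nonneg (norm_nonneg _) (gsinh_nonneg (he.nonneg i) hh.le))
  have hD0 : ∀ i, 0 ≤ D i := fun i =>
    mul_nonneg (by linarith [he.nonneg i]) (norm_nonneg _)
  have hD : Summable fun i => D i ^ 2 := by
    have hcw : Continuous fun y => ψ y - deriv (deriv ψ) y := c0.sub c2
    refine (summable_norm_pair_sq e hcw).congr fun i => ?_
    have h1 : pair (fun y => ψ y - deriv (deriv ψ) y) (e i) = ((1 + lam i : ℝ) : ℂ) * pair ψ (e i) := by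
      have h2 : pair (fun y => ψ y - deriv (deriv ψ) y) (e i)
          = pair ψ (e i) - pair (deriv (deriv ψ)) (e i) := by
        rw [pair, pair, pair, ← integral_sub]
        · simp only [sub_mul]
        · exact (memLp_of_continuous c0).integrable_mul (Lp.memLp (e i))
        · exact (memLp_of_continuous c2).integrable_mul (Lp.memLp (e i))
      rw [h2, he.pair_deriv_deriv hq hψ]; push_cast; ring
    rw [h1, norm_mul, Complex.norm_real, Real.norm_of_nonneg (by linarith [he.nonneg i])]
  have hMD := summable_inner_mul_inner_of_sq hM hD hM0 hD0
  have hx' : ∀ x ∈ Ioo (c - h) (c + h), |x - c| ≤ h := fun x hx =>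
    abs_le.2 ⟨by linarith [hx.1], by linarith [hx.2]⟩
  have hbd : ∀ i, ∀ x ∈ Ioo (c - h) (c + h), ‖(A i * gcosh (lam i) (x - c)
      + B i * gsinh (lam i) (x - c)) * pair ψ (e i)‖ ≤ M i * D i := fun i x hx => by
    rw [norm_mul]
    refine mul_le_mul (norm_comb_le (he.nonneg i) _ _ (hx' x hx)) ?_ (norm_nonneg _) (hM0 i)
    exact le_mul_of_one_le_left (norm_nonneg _) (by linarith [he.nonneg i])
  have hbd2 : ∀ i, ∀ x ∈ Ioo (c - h) (c + h), ‖(lam i * (A i * gcosh (lam i) (x - c)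
      + B i * gsinh (lam i) (x - c))) * pair ψ (e i)‖ ≤ M i * D i := fun i x hx => by
    have hl := he.nonneg i
    rw [norm_mul, norm_mul, Complex.norm_real, Real.norm_of_nonneg hl, mul_comm (lam i), mul_assoc]
    refine mul_le_mul (norm_comb_le hl _ _ (hx' x hx)) ?_ (by positivity) (hM0 i)
    exact mul_le_mul_of_nonneg_right (by linarith) (norm_nonneg _)
  have hbd1 : ∀ i, ∀ x ∈ Ioo (c - h) (c + h), ‖(B i * gcosh (lam i) (x - c)
      + (lam i * A i) * gsinh (lam i) (x - c)) * pair ψ (e i)‖ ≤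
        (h + 1 / h + 1) * (M i * D i) := fun i x hx => by
    have hl := he.nonneg i
    have hC := gcosh_pos hl h
    have hS := gsinh_nonneg hl hh.le
    have h1 := gsinh_le_mul_gcosh hl hh.le
    have h2 := gcosh_le_mul_gsinh hl hh
    have hh' : 0 < 1 / h := by positivity
    have h3 : lam i * gsinh (lam i) h ≤ (h + 1 / h + 1) * (1 + lam i) * gcosh (lam i) h := by
      calc lam i * gsinh (lam i) h ≤ lam i * (h * gcosh (lam i) h) := by gcongr
        _ = h * lam i * gcosh (lam i) h := by ring
        _ ≤ (h + 1 / h + 1) * (1 + lam i) * gcosh (lam i) h := by gcongr <;> linarith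
    have h4 : gcosh (lam i) h ≤ (h + 1 / h + 1) * (1 + lam i) * gsinh (lam i) h := by
      refine h2.trans (mul_le_mul_of_nonneg_right ?_ hS)
      nlinarith [mul_nonneg hh'.le hl, mul_nonneg hh.le hl]
    rw [norm_mul]
    calc _ ≤ (‖A i‖ * (lam i * gsinh (lam i) h) + ‖B i‖ * gcosh (lam i) h) * ‖pair ψ (e i)‖ := by
          gcongr; exact norm_comb'_le hl _ _ (hx' x hx)
      _ ≤ (‖A i‖ * ((h + 1 / h + 1) * (1 + lam i) * gcosh (lam i) h)
          + ‖B i‖ * ((h + 1 / h + 1) * (1 + lam i) * gsinh (lam i) h)) * ‖pair ψ (e i)‖ := by gcongr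
      _ = (h + 1 / h + 1) * (M i * D i) := by simp only [M, D]; ring
  have hu' : ∀ x ∈ Ioo (c - h) (c + h), HasSum (fun i => (A i * gcosh (lam i) (x - c)
      + B i * gsinh (lam i) (x - c)) * pair ψ (e i)) (pair ψ (u x)) := fun x hx => by
    simpa only [hu x (Ioo_subset_Icc_self hx)] using hasSum_pair e c0 (u x)
  -- Twofold termwise differentiation, justified by the uniform bounds `hbd1` and `hbd2`.
  refine ⟨fun x => ∑' i, (B i * gcosh (lam i) (x - c)
      + (lam i * A i) * gsinh (lam i) (x - c)) * pair ψ (e i), fun x hx => ⟨?_, ?_⟩⟩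
  · have hd := hasDerivAt_tsum_of_isPreconnected (𝕜 := ℝ) (hMD.mul_left (h + 1 / h + 1)) isOpen_Ioo
      isPreconnected_Ioo (g := fun i x => (A i * gcosh (lam i) (x - c)
        + B i * gsinh (lam i) (x - c)) * pair ψ (e i))
      (fun i y _ => (hasDerivAt_comb_shift (A i) (B i) (lam i) c y).mul_const _) hbd1 hx
      (hu' x hx).summable hx
    refine hd.congr_of_eventuallyEq ?_
    filter_upwards [isOpen_Ioo.mem_nhds hx] with y hy using (hu' y hy).tsum_eq.symm
  · have hd := hasDerivAt_tsum_of_isPreconnected (𝕜 := ℝ) hMD isOpen_Ioo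
      isPreconnected_Ioo (g := fun i x => (B i * gcosh (lam i) (x - c)
        + (lam i * A i) * gsinh (lam i) (x - c)) * pair ψ (e i))
      (g' := fun i x => (lam i * (A i * gcosh (lam i) (x - c)
        + B i * gsinh (lam i) (x - c))) * pair ψ (e i))
      (fun i y _ => by
        convert! (hasDerivAt_comb_shift (B i) (lam i * A i) (lam i) c y).mul_const
          (pair ψ (e i)) using 1
        ring) hbd2 hx
      (Summable.of_norm ((hMD.mul_left (h + 1 / h + 1)).of_nonneg_of_le (fun _ => norm_nonneg _)
        fun i => hbd1 i x hx)) hx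
    refine hd.congr_deriv (Eq.symm ?_)
    rw [Pi.zero_apply, pair_zero c0, sub_zero, ← (hasSum_pair e c2 (u x)).tsum_eq, ← tsum_neg]
    refine tsum_congr fun i => ?_
    rw [he.pair_deriv_deriv hq hψ, hu x (Ioo_subset_Icc_self hx)]; ring

/-- Existence of solutions with prescribed modal coefficients. -/
lemma IsEigenbasis.exists_modal (he : IsEigenbasis bc q e lam φ) (hq : 0 < q) (m : Method)
    {c h : ℝ} (hh : 0 < h) {A B : ι → ℂ} {G : ι → ℝ} (hG : Summable fun i => G i ^ 2)
    (h1 : ∀ i, m.valCoeff * (‖A i‖ * gcosh (lam i) h) ≤ G i)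
    (h2 : ∀ i, m.valCoeff * (‖B i‖ * gsinh (lam i) h) ≤ G i)
    (h3 : ∀ i, m.derivCoeff * (‖A i‖ * (lam i * gsinh (lam i) h)) ≤ G i)
    (h4 : ∀ i, m.derivCoeff * (‖B i‖ * gcosh (lam i) h) ≤ G i) :
    ∃ u : ℝ → L2Y, Regular m (c - h) (c + h) u ∧ SolvesPoisson bc q (c - h) (c + h) 0 u ∧
      ∀ x ∈ Icc (c - h) (c + h), ∀ i, inner ℂ (e i) (u x) =
        A i * gcosh (lam i) (x - c) + B i * gsinh (lam i) (x - c) := by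
  have hα := m.valCoeff_pos
  have hx' : ∀ x ∈ Icc (c - h) (c + h), |x - c| ≤ h := fun x hx =>
    abs_le.2 ⟨by linarith [hx.1], by linarith [hx.2]⟩
  have hM0 : ∀ i, 0 ≤ ‖A i‖ * gcosh (lam i) h + ‖B i‖ * gsinh (lam i) h := fun i => add_nonneg
    (mul_nonneg (norm_nonneg _) (gcosh_pos (he.nonneg i) _).le)
    (mul_nonneg (norm_nonneg _) (gsinh_nonneg (he.nonneg i) hh.le))
  have hM : Summable fun i => (‖A i‖ * gcosh (lam i) h + ‖B i‖ * gsinh (lam i) h) ^ 2 := by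
    refine (hG.mul_left ((2 / m.valCoeff) ^ 2)).of_nonneg_of_le (fun _ => by positivity)
      fun i => ?_
    rw [← mul_pow]
    refine pow_le_pow_left₀ (hM0 i) ?_ 2
    rw [div_mul_eq_mul_div, le_div_iff₀ hα]
    linarith [h1 i, h2 i]
  have hζ : ∀ i, ∀ x ∈ Icc (c - h) (c + h), ‖A i * gcosh (lam i) (x - c)
      + B i * gsinh (lam i) (x - c)‖ ≤ ‖A i‖ * gcosh (lam i) h + ‖B i‖ * gsinh (lam i) h :=
    fun i x hx => norm_comb_le (he.nonneg i) _ _ (hx' x hx)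
  have hcoef : ∀ x ∈ Icc (c - h) (c + h), ∀ i, inner ℂ (e i)
      (synth e fun i => A i * gcosh (lam i) (x - c) + B i * gsinh (lam i) (x - c)) =
        A i * gcosh (lam i) (x - c) + B i * gsinh (lam i) (x - c) := fun x hx i =>
    inner_synth e (summable_norm_sq_of_le hM fun i => hζ i x hx) i
  have hcont : ∀ (A B : ℂ) (l : ℝ),
      Continuous fun x => A * (gcosh l (x - c) : ℂ) + B * gsinh l (x - c) := fun A B l =>
    continuous_iff_continuousAt.2 fun x => (hasDerivAt_comb_shift A B l c x).continuousAt
  refine ⟨fun x => synth e fun i => A i * gcosh (lam i) (x - c) + B i * gsinh (lam i) (x - c),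
    ?_, he.solvesPoisson hq hh hM hcoef, hcoef⟩
  cases m with
  | PSM => exact continuousOn_synth e hM hζ fun i => (hcont _ _ _).continuousOn
  | OSM p hp =>
    simp only [Method.derivCoeff, one_mul] at h3 h4
    refine contDiffOn_synth e (by linarith) hM (hG.mul_left 4 |>.congr fun i => by
      rw [show 4 * G i ^ 2 = (2 * G i) ^ 2 by ring]) hζ (fun i x hx => ?_)
      (fun i x => hasDerivAt_comb_shift (A i) (B i) (lam i) c x)
      fun i => (hcont _ _ _).continuousOn
    refine (norm_comb'_le (he.nonneg i) _ _ (hx' x hx)).trans ?_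
    linarith [h3 i, h4 i]

end Modal

/-! ### Solvability of the subdomain problems -/

section Existence

variable {bc : External} {q : ℝ} {ι : Type} {e : HilbertBasis ι ℂ L2Y} {lam : ι → ℝ}
  {φ : ι → ℝ → ℂ} {m : Method}

lemma summable_norm_inner_add_sq (e : HilbertBasis ι ℂ L2Y) (l r : L2Y) :
    Summable fun i => (‖inner ℂ (e i) l‖ + ‖inner ℂ (e i) r‖) ^ 2 := by
  refine (((hasSum_norm_inner_sq e l).summable.add
    (hasSum_norm_inner_sq e r).summable).mul_left 2).of_nonneg_of_le (fun _ => by positivity)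
    fun i => ?_
  nlinarith [sq_nonneg (‖inner ℂ (e i) l‖ - ‖inner ℂ (e i) r‖)]

lemma evenCoeff_pos (m : Method) {l h : ℝ} (hl : 0 ≤ l) (hh : 0 < h) :
    0 < m.valCoeff * gcosh l h + m.derivCoeff * (l * gsinh l h) :=
  add_pos_of_pos_of_nonneg (mul_pos m.valCoeff_pos (gcosh_pos hl h))
    (mul_nonneg m.derivCoeff_nonneg (mul_nonneg hl (gsinh_nonneg hl hh.le)))

lemma oddCoeff_pos (m : Method) {l h : ℝ} (hl : 0 ≤ l) (hh : 0 < h) :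
    0 < m.valCoeff * gsinh l h + m.derivCoeff * gcosh l h :=
  add_pos_of_pos_of_nonneg (mul_pos m.valCoeff_pos (gsinh_pos hl hh))
    (mul_nonneg m.derivCoeff_nonneg (gcosh_pos hl h).le)

/-- A modal amplitude is a datum divided by a sum `D` of nonnegative terms, so each term, multiplied
by the amplitude, is at most the datum, uniformly in the mode. This yields the `ℓ²` domination
without asymptotics in `lam i`. -/
lemma coeff_mul_norm_div_le {α x s D G : ℝ} {z : ℂ} (hs : 0 ≤ s)
    (hD : α * x + s = D) (hDpos : 0 < D) (hz : ‖z‖ ≤ G) : α * (‖z / (D : ℂ)‖ * x) ≤ G := by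
  rw [norm_div, Complex.norm_real, Real.norm_of_nonneg hDpos.le]
  calc α * (‖z‖ / D * x) = ‖z‖ * (α * x / D) := by ring
    _ ≤ ‖z‖ * 1 := by
      refine mul_le_mul_of_nonneg_left ?_ (norm_nonneg z)
      rw [div_le_one hDpos]; linarith
    _ ≤ G := by linarith

/-- Solvability on a subdomain whose two vertical sides are interfaces. -/
lemma IsEigenbasis.exists_interior (he : IsEigenbasis bc q e lam φ) (hq : 0 < q) (m : Method)
    {a b : ℝ} (hab : a < b) (l r : L2Y) : ∃ u : ℝ → L2Y, Regular m a b u ∧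
      SolvesPoisson bc q a b 0 u ∧ leftTrace m a b u a = l ∧ rightTrace m a b u b = r := by
  set h := (b - a) / 2 with hh
  have hpos : 0 < h := by rw [hh]; linarith
  set c := (a + b) / 2 with hc
  have ea : c - h = a := by rw [hc, hh]; ring
  have eb : c + h = b := by rw [hc, hh]; ring
  have hl0 := he.nonneg
  have hα := m.valCoeff_pos
  have hβ := m.derivCoeff_nonneg
  set E : ι → ℝ := fun i => m.valCoeff * gcosh (lam i) h + m.derivCoeff * (lam i * gsinh (lam i) h)
  set O : ι → ℝ := fun i => m.valCoeff * gsinh (lam i) h + m.derivCoeff * gcosh (lam i) h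
  have hE : ∀ i, 0 < E i := fun i => evenCoeff_pos m (hl0 i) hpos
  have hO : ∀ i, 0 < O i := fun i => oddCoeff_pos m (hl0 i) hpos
  -- Solution of `A E - B O = l`, `A E + B O = r` for each mode; positivity of `E` and `O` gives
  -- solvability.
  set A : ι → ℂ := fun i => ((inner ℂ (e i) r + inner ℂ (e i) l) / 2) / (E i : ℂ)
  set B : ι → ℂ := fun i => ((inner ℂ (e i) r - inner ℂ (e i) l) / 2) / (O i : ℂ)
  have hA : ∀ i, ‖(inner ℂ (e i) r + inner ℂ (e i) l) / 2‖
      ≤ ‖inner ℂ (e i) l‖ + ‖inner ℂ (e i) r‖ := fun i => by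
    rw [norm_div, Complex.norm_two]
    linarith [norm_add_le (inner ℂ (e i) r) (inner ℂ (e i) l), norm_nonneg (inner ℂ (e i) l),
      norm_nonneg (inner ℂ (e i) r)]
  have hB : ∀ i, ‖(inner ℂ (e i) r - inner ℂ (e i) l) / 2‖
      ≤ ‖inner ℂ (e i) l‖ + ‖inner ℂ (e i) r‖ := fun i => by
    rw [norm_div, Complex.norm_two]
    linarith [norm_sub_le (inner ℂ (e i) r) (inner ℂ (e i) l), norm_nonneg (inner ℂ (e i) l),
      norm_nonneg (inner ℂ (e i) r)]
  have hC0 := fun i => (gcosh_pos (hl0 i) h).le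
  have hS0 := fun i => gsinh_nonneg (hl0 i) hpos.le
  obtain ⟨u, hr, hs, hcoef⟩ := he.exists_modal hq m hpos (c := c) (A := A) (B := B)
    (summable_norm_inner_add_sq e l r)
    (fun i => coeff_mul_norm_div_le (mul_nonneg hβ (mul_nonneg (hl0 i) (hS0 i)))
      rfl (hE i) (hA i))
    (fun i => coeff_mul_norm_div_le (mul_nonneg hβ (hC0 i)) rfl (hO i) (hB i))
    (fun i => coeff_mul_norm_div_le (mul_nonneg hα.le (hC0 i))
      (add_comm _ _) (hE i) (hA i))
    (fun i => coeff_mul_norm_div_le (mul_nonneg hα.le (hS0 i)) (add_comm _ _) (hO i)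
      (hB i))
  rw [ea, eb] at hr hs hcoef
  have hT := fun i x hx => inner_traces hab hr (e i) hx
    (hasDerivAt_comb_shift (A i) (B i) (lam i) c x) (fun y hy => hcoef y hy i)
  have hEA : ∀ i, A i * (E i : ℂ) = (inner ℂ (e i) r + inner ℂ (e i) l) / 2 := fun i =>
    div_mul_cancel₀ _ (by exact_mod_cast (hE i).ne')
  have hOB : ∀ i, B i * (O i : ℂ) = (inner ℂ (e i) r - inner ℂ (e i) l) / 2 := fun i =>
    div_mul_cancel₀ _ (by exact_mod_cast (hO i).ne')
  refine ⟨u, hr, hs, eq_of_inner_eq e fun i => ?_, eq_of_inner_eq e fun i => ?_⟩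
  · rw [(hT i a ⟨le_rfl, hab.le⟩).1, show a - c = -h by linarith, gcosh_neg, gsinh_neg]
    have h1 := hEA i
    have h2 := hOB i
    simp only [E, O] at h1 h2
    push_cast at h1 h2 ⊢
    linear_combination h1 - h2
  · rw [(hT i b ⟨hab.le, le_rfl⟩).2, show b - c = h by linarith]
    have h1 := hEA i
    have h2 := hOB i
    simp only [E, O] at h1 h2
    push_cast at h1 h2 ⊢
    linear_combination h1 + h2

/-- Solvability with a zero value at one end and interface data at the other one. -/
lemma IsEigenbasis.exists_odd (he : IsEigenbasis bc q e lam φ) (hq : 0 < q) (m : Method)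
    (c : ℝ) {H : ℝ} (hH : 0 < H) (r : L2Y) : ∃ u : ℝ → L2Y, Regular m (c - H) (c + H) u ∧
      SolvesPoisson bc q (c - H) (c + H) 0 u ∧
      ∃ B : ι → ℂ, (∀ i, B i * ((m.valCoeff * gsinh (lam i) H + m.derivCoeff * gcosh (lam i) H : ℝ)
        : ℂ) = inner ℂ (e i) r) ∧
      ∀ x ∈ Icc (c - H) (c + H), ∀ i, inner ℂ (e i) (u x) =
        0 * gcosh (lam i) (x - c) + B i * gsinh (lam i) (x - c) := by
  have hl0 := he.nonneg
  have hα := m.valCoeff_pos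
  have hβ := m.derivCoeff_nonneg
  set O : ι → ℝ := fun i => m.valCoeff * gsinh (lam i) H + m.derivCoeff * gcosh (lam i) H
  have hO : ∀ i, 0 < O i := fun i => oddCoeff_pos m (hl0 i) hH
  have hC0 := fun i => (gcosh_pos (hl0 i) H).le
  have hS0 := fun i => gsinh_nonneg (hl0 i) hH.le
  obtain ⟨u, hr, hs, hcoef⟩ := he.exists_modal hq m hH (c := c) (A := fun _ => 0)
    (B := fun i => inner ℂ (e i) r / (O i : ℂ)) (G := fun i => ‖inner ℂ (e i) r‖)
    (hasSum_norm_inner_sq e r).summable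
    (fun i => by simp)
    (fun i => coeff_mul_norm_div_le (mul_nonneg hβ (hC0 i)) rfl (hO i) le_rfl)
    (fun i => by simp)
    (fun i => coeff_mul_norm_div_le (mul_nonneg hα.le (hS0 i)) (add_comm _ _) (hO i)
      le_rfl)
  exact ⟨u, hr, hs, _, fun i => div_mul_cancel₀ _ (by exact_mod_cast (hO i).ne'), hcoef⟩

lemma IsEigenbasis.exists_left (he : IsEigenbasis bc q e lam φ) (hq : 0 < q) (m : Method)
    {a b : ℝ} (hab : a < b) (r : L2Y) : ∃ u : ℝ → L2Y, Regular m a b u ∧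
      SolvesPoisson bc q a b 0 u ∧ u a = 0 ∧ rightTrace m a b u b = r := by
  obtain ⟨u, hr, hs, B, hB, hcoef⟩ := he.exists_odd hq m a (sub_pos.2 hab) r
  have hsub : Icc a b ⊆ Icc (a - (b - a)) (a + (b - a)) := Icc_subset_Icc (by linarith) (by linarith)
  have hr' := hr.mono hsub
  refine ⟨u, hr', hs.mono (Ioo_subset_Ioo (by linarith) (by linarith)),
    eq_of_inner_eq e fun i => ?_, eq_of_inner_eq e fun i => ?_⟩
  · rw [hcoef a (hsub ⟨le_rfl, hab.le⟩) i]; simp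
  · rw [(inner_traces hab hr' (e i) ⟨hab.le, le_rfl⟩ (hasDerivAt_comb_shift 0 (B i) (lam i) a b)
      (fun y hy => hcoef y (hsub hy) i)).2, ← hB i]
    push_cast; ring

lemma IsEigenbasis.exists_right (he : IsEigenbasis bc q e lam φ) (hq : 0 < q) (m : Method)
    {a b : ℝ} (hab : a < b) (l : L2Y) : ∃ u : ℝ → L2Y, Regular m a b u ∧
      SolvesPoisson bc q a b 0 u ∧ u b = 0 ∧ leftTrace m a b u a = l := by
  -- The solution is odd about `b`, and its left trace at `a` is the negative of its right trace at
  -- the mirror point; hence the datum `-l`.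
  obtain ⟨u, hr, hs, B, hB, hcoef⟩ := he.exists_odd hq m b (sub_pos.2 hab) (-l)
  have hsub : Icc a b ⊆ Icc (b - (b - a)) (b + (b - a)) := Icc_subset_Icc (by linarith) (by linarith)
  have hr' := hr.mono hsub
  refine ⟨u, hr', hs.mono (Ioo_subset_Ioo (by linarith) (by linarith)),
    eq_of_inner_eq e fun i => ?_, eq_of_inner_eq e fun i => ?_⟩
  · rw [hcoef b (hsub ⟨hab.le, le_rfl⟩) i]; simp
  · have h1 := hB i
    rw [inner_neg_right] at h1
    rw [(inner_traces hab hr' (e i) ⟨le_rfl, hab.le⟩ (hasDerivAt_comb_shift 0 (B i) (lam i) b a)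
      (fun y hy => hcoef y (hsub hy) i)).1, show a - b = -(b - a) by ring, gcosh_neg, gsinh_neg,
      ← neg_eq_iff_eq_neg.2 h1]
    push_cast; ring

lemma solvesPoisson_zero (bc : External) (q a b : ℝ) : SolvesPoisson bc q a b 0 (fun _ => 0) := by
  intro ψ hψ
  refine ⟨fun _ => 0, fun x _ => ?_⟩
  simp only [pair_zero hψ.differentiable.continuous, pair_zero hψ.continuous_deriv_deriv,
    Pi.zero_apply, neg_zero, sub_zero]
  exact ⟨hasDerivAt_const _ _, hasDerivAt_const _ _⟩

lemma regular_zero (m : Method) (a b : ℝ) : Regular m a b (fun _ => 0) := by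
  cases m with
  | PSM => exact continuousOn_const
  | OSM p hp => exact contDiffOn_const

/-- The homogeneous subdomain problems are solvable for all interface data. -/
lemma IsEigenbasis.exists_solvesLocal (he : IsEigenbasis bc q e lam φ) (hq : 0 < q) {L δ : ℝ}
    (hL : 0 < L) (hδ : 0 < δ) {N : ℕ} (hN : 1 ≤ N) (g : TraceSpace N) :
    ∃ v : ℕ → ℝ → L2Y, SolvesLocal m bc q L δ N 0 g v := by
  obtain ⟨M, rfl⟩ : ∃ M, N = M + 1 := ⟨N - 1, by omega⟩
  -- The datum on the left side of subdomain `j` has index `j - 1`. Data are extended by zero so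
  -- that a solution is chosen for every natural `j`; those beyond the chain play no role.
  let gl : ℕ → L2Y := fun j => if hj : j < M then g (Sum.inl ⟨j, hj⟩) else 0
  let gr : ℕ → L2Y := fun j => if hj : j < M then g (Sum.inr ⟨j, hj⟩) else 0
  have key : ∀ j, ∃ u : ℝ → L2Y, Regular m (aPt L j) (bPt L δ j) u ∧
      SolvesPoisson bc q (aPt L j) (bPt L δ j) 0 u ∧
      (j = 0 → u (aPt L j) = 0) ∧ (j = M → u (bPt L δ j) = 0) ∧
      (j ≠ 0 → leftTrace m (aPt L j) (bPt L δ j) u (aPt L j) = gl (j - 1)) ∧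
      (j ≠ M → rightTrace m (aPt L j) (bPt L δ j) u (bPt L δ j) = gr j) := by
    intro j
    have hab := aPt_lt_bPt hL hδ j
    rcases eq_or_ne j 0 with h0 | h0 <;> rcases eq_or_ne j M with hM | hM
    · exact ⟨fun _ => 0, regular_zero _ _ _, solvesPoisson_zero _ _ _ _, fun _ => rfl,
        fun _ => rfl, fun h => absurd h0 h, fun h => absurd hM h⟩
    · obtain ⟨u, h1, h2, h3, h4⟩ := he.exists_left hq m hab (gr j)
      exact ⟨u, h1, h2, fun _ => h3, fun h => absurd h hM, fun h => absurd h0 h, fun _ => h4⟩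
    · obtain ⟨u, h1, h2, h3, h4⟩ := he.exists_right hq m hab (gl (j - 1))
      exact ⟨u, h1, h2, fun h => absurd h h0, fun _ => h3, fun _ => h4, fun h => absurd hM h⟩
    · obtain ⟨u, h1, h2, h3, h4⟩ := he.exists_interior hq m hab (gl (j - 1)) (gr j)
      exact ⟨u, h1, h2, fun h => absurd h h0, fun h => absurd h hM, fun _ => h3, fun _ => h4⟩
  choose v h1 h2 h3 h4 h5 h6 using key
  refine ⟨v, fun j _ => h1 j, fun j _ => h2 j, h3 0 rfl, h4 _ (by simp), ?_⟩
  ext1 s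
  rcases s with ⟨j, hj⟩ | ⟨j, hj⟩
  · have hj' : j < M := by simpa using hj
    have := h5 (j + 1) (by simp)
    simp only [Nat.add_sub_cancel, gl, dif_pos hj'] at this
    exact this
  · have hj' : j < M := by simpa using hj
    have := h6 j hj'.ne
    simp only [gr, dif_pos hj'] at this
    exact this

end Existence

/-! ### Well-posedness, the iteration operator, its norm and spectral radius -/

section Iteration

variable {bc : External} {q : ℝ} {ι : Type} {e : HilbertBasis ι ℂ L2Y} {lam : ι → ℝ}
  {φ : ι → ℝ → ℂ} {m : Method} {L δ : ℝ} {N : ℕ}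

lemma IsEigenbasis.eqOn_of_solvesLocal (he : IsEigenbasis bc q e lam φ) (hL : 0 < L) (hδ : 0 < δ)
    (hδL : δ < L / 2) (hN : 1 ≤ N) {g : TraceSpace N} {v w : ℕ → ℝ → L2Y}
    (hv : SolvesLocal m bc q L δ N 0 g v) (hw : SolvesLocal m bc q L δ N 0 g w) :
    ∀ j < N, EqOn (w j) (v j) (Icc (aPt L j) (bPt L δ j)) := by
  intro j hj x hx
  have hd := hw.add_smul hL hδ hv (-1)
  simp only [neg_smul, one_smul, Pi.zero_apply, neg_zero, add_zero, add_neg_cancel] at hd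
  have := (he.local_estimates hL hδ hδL hN hd).2 j hj x hx
  rw [norm_zero, mul_zero, norm_le_zero_iff] at this
  rwa [add_neg_eq_zero] at this

lemma IsEigenbasis.wellPosed (he : IsEigenbasis bc q e lam φ) (hq : 0 < q) (hL : 0 < L)
    (hδ : 0 < δ) (hδL : δ < L / 2) (hN : 1 ≤ N) : WellPosed m bc q L δ N := by
  intro g
  obtain ⟨v, hv⟩ := he.exists_solvesLocal (m := m) hq hL hδ hN g
  exact ⟨v, hv, fun w hw => he.eqOn_of_solvesLocal hL hδ hδL hN hv hw⟩

lemma IsEigenbasis.existsUnique_iterationOperator (he : IsEigenbasis bc q e lam φ) (hq : 0 < q)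
    (hL : 0 < L) (hδ : 0 < δ) (hδL : δ < L / 2) (hN : 1 ≤ N) :
    ∃! T : TraceSpace N →L[ℂ] TraceSpace N, IsIterationOperator m bc q L δ N T := by
  -- Any choice of solutions will do: by uniqueness the traces handed over depend only on the data,
  -- which also makes them linear in `g`.
  choose v hv using fun g => he.exists_solvesLocal (m := m) hq hL hδ hN g
  have huniq : ∀ (g : TraceSpace N) (w : ℕ → ℝ → L2Y), SolvesLocal m bc q L δ N 0 g w →
      neighbourTraces m L δ N (v g) = neighbourTraces m L δ N w := fun g w hw =>
    neighbourTraces_congr hL hδ (he.eqOn_of_solvesLocal hL hδ hδL hN hw (hv g))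
  have hcomb : ∀ (g g' : TraceSpace N) (c : ℂ), neighbourTraces m L δ N (v (g + c • g')) =
      neighbourTraces m L δ N (v g) + c • neighbourTraces m L δ N (v g') := by
    intro g g' c
    have h := (hv g).add_smul hL hδ (hv g') c
    simp only [Pi.zero_apply, smul_zero, add_zero] at h
    rw [huniq _ _ h, neighbourTraces_add_smul hL hδ (hv g).regular (hv g').regular]
  have hzero : neighbourTraces m L δ N (v 0) = 0 := by
    have := hcomb 0 0 1
    simpa using this
  refine ⟨LinearMap.mkContinuous
    { toFun := fun g => neighbourTraces m L δ N (v g)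
      map_add' := fun g g' => by simpa using hcomb g g' 1
      map_smul' := fun c g => by simpa [hzero] using hcomb 0 g c }
    (rhoExt bc L δ q) fun g => (he.local_estimates hL hδ hδL hN (hv g)).1, ?_, ?_⟩
  · exact fun g w hw => huniq g w hw
  · intro T hT
    ext1 g
    exact hT g (v g) (hv g)

lemma IsEigenbasis.norm_iterationOperator_le (he : IsEigenbasis bc q e lam φ) (hq : 0 < q)
    (hL : 0 < L) (hδ : 0 < δ) (hδL : δ < L / 2) (hN : 1 ≤ N)
    {T : TraceSpace N →L[ℂ] TraceSpace N} (hT : IsIterationOperator m bc q L δ N T) :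
    ‖T‖ ≤ rhoExt bc L δ q := by
  refine T.opNorm_le_bound (rho_pos _ _ _).le fun g => ?_
  obtain ⟨v, hv⟩ := he.exists_solvesLocal (m := m) hq hL hδ hN g
  rw [hT g v hv]
  exact (he.local_estimates hL hδ hδL hN hv).1

/-- The trivial space needs separate treatment because it occurs: for `N = 1` there are no
interfaces. Its spectrum is empty. -/
lemma spectralRadius_le_ofReal_norm {H : Type*} [NormedAddCommGroup H] [NormedSpace ℂ H]
    [CompleteSpace H] (T : H →L[ℂ] H) : spectralRadius ℂ T ≤ ENNReal.ofReal ‖T‖ := by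
  rcases subsingleton_or_nontrivial H with hs | hs
  · have : Subsingleton (H →L[ℂ] H) := ⟨fun a b => by ext x; exact Subsingleton.elim _ _⟩
    rw [spectralRadius]
    simp [spectrum.of_subsingleton]
  · rw [ofReal_norm]
    exact spectrum.spectralRadius_le_nnnorm T

lemma IsEigenbasis.contractionFactor_le (he : IsEigenbasis bc q e lam φ) (hq : 0 < q)
    (hL : 0 < L) (hδ : 0 < δ) (hδL : δ < L / 2) (hN : 1 ≤ N) :
    contractionFactor m bc q L δ N ≤ ENNReal.ofReal (rhoExt bc L δ q) :=
  iSup₂_le fun T hT => (spectralRadius_le_ofReal_norm T).trans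
    (ENNReal.ofReal_le_ofReal (he.norm_iterationOperator_le hq hL hδ hδL hN hT))

end Iteration

/-! ### Errors of an actual run -/

section Run

variable {bc : External} {q : ℝ} {m : Method} {L δ : ℝ} {N : ℕ} {f u : ℝ → L2Y}
  {U : ℕ → ℕ → ℝ → L2Y}

lemma aPt_zero_le (hL : 0 < L) (j : ℕ) : aPt L 0 ≤ aPt L j := by
  simp only [aPt, Nat.cast_zero, zero_mul]; positivity

lemma bPt_le_last (hL : 0 < L) {j : ℕ} (hj : j < N) : bPt L δ j ≤ bPt L δ (N - 1) := by
  have : (j : ℝ) ≤ ((N - 1 : ℕ) : ℝ) := by exact_mod_cast (by omega : j ≤ N - 1)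
  simp only [bPt]
  gcongr

/-- An exact solution solves the subdomain problems with its own transmission data. -/
lemma IsExactSolution.solvesLocal (hL : 0 < L) (hδ : 0 < δ)
    (hu : IsExactSolution m bc q L δ N f u) :
    SolvesLocal m bc q L δ N f (neighbourTraces m L δ N (fun _ => u)) (fun _ => u) where
  regular j hj := hu.regular.mono (Icc_subset_Icc (aPt_zero_le hL j) (bPt_le_last hL hj))
  poisson j hj := hu.poisson.mono (Ioo_subset_Ioo (aPt_zero_le hL j) (bPt_le_last hL hj))
  left_end := hu.left_end
  right_end := hu.right_end
  traces := by
    have hsub : ∀ j, j < N → Icc (aPt L j) (bPt L δ j) ⊆ Icc (aPt L 0) (bPt L δ (N - 1)) :=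
      fun j hj => Icc_subset_Icc (aPt_zero_le hL j) (bPt_le_last hL hj)
    have hlt := fun j => aPt_lt_bPt hL hδ j
    ext1 s
    rcases s with j | j
    · have hj : (j : ℕ) + 1 < N := by omega
      exact (traces_of_subset (hlt _) hu.regular (hsub _ hj) ⟨le_rfl, (hlt _).le⟩).1.trans
        (traces_of_subset (hlt _) hu.regular (hsub j (by omega)) (aPt_succ_mem hL hδ _)).1.symm
    · have hj : (j : ℕ) + 1 < N := by omega
      exact (traces_of_subset (hlt _) hu.regular (hsub j (by omega)) ⟨(hlt _).le, le_rfl⟩).2.trans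
        (traces_of_subset (hlt _) hu.regular (hsub _ hj) (bPt_mem_succ hL hδ _)).2.symm

/-- The error solves the homogeneous subdomain problems with the data of the previous error. -/
lemma IsSchwarzRun.error_solvesLocal (hL : 0 < L) (hδ : 0 < δ)
    (hu : IsExactSolution m bc q L δ N f u) (hU : IsSchwarzRun m bc q L δ N f U) (n : ℕ) :
    SolvesLocal m bc q L δ N 0 (neighbourTraces m L δ N (fun j x => u x - U n j x))
      (fun j x => u x - U (n + 1) j x) := by
  have hreg : ∀ j < N, Regular m (aPt L j) (bPt L δ j) (U n j) := by
    cases n with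
    | zero => exact hU.initial
    | succ n => exact (hU.step n).regular
  have hex := hu.solvesLocal hL hδ
  have h := hex.add_smul hL hδ (hU.step n) (-1)
  rw [← neighbourTraces_add_smul hL hδ hex.regular hreg] at h
  simp only [neg_smul, one_smul, ← sub_eq_add_neg, sub_self] at h
  exact h

lemma IsEigenbasis.run_estimates {ι : Type} {e : HilbertBasis ι ℂ L2Y} {lam : ι → ℝ}
    {φ : ι → ℝ → ℂ} (he : IsEigenbasis bc q e lam φ) (hL : 0 < L) (hδ : 0 < δ) (hδL : δ < L / 2)
    (hN : 1 ≤ N) (hu : IsExactSolution m bc q L δ N f u) (hU : IsSchwarzRun m bc q L δ N f U)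
    {n : ℕ} (hn : 1 ≤ n) :
    ‖errorTraces m L δ N u U (n + 1)‖ ≤ rhoExt bc L δ q * ‖errorTraces m L δ N u U n‖ ∧
    ∀ j < N, ∀ x ∈ Icc (aPt L j) (bPt L δ j), ‖u x - U n j x‖ ≤
      1 / m.valCoeff / rhoExt bc L δ q * rhoExt bc L δ q ^ n * ‖errorTraces m L δ N u U 1‖ := by
  have hρ : 0 < rhoExt bc L δ q := rho_pos _ _ _
  have hα := m.valCoeff_pos
  -- The initial guess need not solve any equation, so the error is a homogeneous solution only from
  -- iteration `1` on. This gives the power `n - 1`; dividing the constant by `rhoExt`, which is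
  -- positive, restores the power `n`.
  have hloc : ∀ n, 1 ≤ n → SolvesLocal m bc q L δ N 0 (errorTraces m L δ N u U n)
      (fun j x => u x - U n j x) := by
    intro n hn
    obtain ⟨k, rfl⟩ : ∃ k, n = k + 1 := ⟨n - 1, by omega⟩
    have h := hU.error_solvesLocal hL hδ hu k
    rw [errorTraces, h.traces]
    exact h
  have hstep : ∀ n, 1 ≤ n → ‖errorTraces m L δ N u U (n + 1)‖
      ≤ rhoExt bc L δ q * ‖errorTraces m L δ N u U n‖ := by
    intro n hn
    rw [errorTraces, (hU.error_solvesLocal hL hδ hu n).traces]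
    exact (he.local_estimates hL hδ hδL hN (hloc n hn)).1
  refine ⟨hstep n hn, fun j hj x hx => ?_⟩
  have hpow : ∀ k, ‖errorTraces m L δ N u U (k + 1)‖
      ≤ rhoExt bc L δ q ^ k * ‖errorTraces m L δ N u U 1‖ := by
    intro k
    induction k with
    | zero => simp
    | succ k ih =>
      calc _ ≤ rhoExt bc L δ q * ‖errorTraces m L δ N u U (k + 1)‖ := hstep (k + 1) (by omega)
        _ ≤ rhoExt bc L δ q * (rhoExt bc L δ q ^ k * ‖errorTraces m L δ N u U 1‖) := by gcongr
        _ = _ := by ring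
  obtain ⟨k, rfl⟩ : ∃ k, n = k + 1 := ⟨n - 1, by omega⟩
  calc ‖u x - U (k + 1) j x‖ ≤ 1 / m.valCoeff * ‖errorTraces m L δ N u U (k + 1)‖ :=
        (he.local_estimates hL hδ hδL hN (hloc (k + 1) hn)).2 j hj x hx
    _ ≤ 1 / m.valCoeff * (rhoExt bc L δ q ^ k * ‖errorTraces m L δ N u U 1‖) := by
        gcongr; exact hpow k
    _ = _ := by rw [pow_succ]; field_simp

end Run

/-! ### The case NN: eigenvalues of long chains approach `1` -/

/-- The quantization condition for the slowest mode of a long chain has a solution. -/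
lemma exists_quantized_angle {r σ D E : ℝ} (hr0 : 0 ≤ r) (hr1 : r < 1) (hσ : -1 < σ) (hD : 0 < D)
    (hE : 0 < E) : ∃ (M : ℕ) (θ : ℝ), 1 ≤ M ∧ θ ∈ Ioo 0 (Real.pi / 2) ∧ r < Real.cos θ ∧
      D * Real.cos ((θ + Real.arctan (σ * Real.tan θ)) * M) * Real.cos θ
        - E * Real.sin ((θ + Real.arctan (σ * Real.tan θ)) * M) * Real.sin θ = 0 := by
  have hpi := Real.pi_pos
  -- Any angle up to `θ₀` has cosine at least `(1 + r) / 2 > r`.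
  set θ₀ := Real.arccos ((1 + r) / 2)
  have h0 : 0 < θ₀ := Real.arccos_pos.2 (by linarith)
  have h0' : θ₀ < Real.pi / 2 := Real.arccos_lt_pi_div_two.2 (by linarith)
  have hcos : Real.cos θ₀ = (1 + r) / 2 := Real.cos_arccos (by linarith) (by linarith)
  set κ : ℝ → ℝ := fun θ => θ + Real.arctan (σ * Real.tan θ) with hκ
  have hκ0 : 0 < κ θ₀ := by
    -- Since `σ > -1`, the arctangent exceeds `-θ₀`: the phase advance per subdomain is positive, so
    -- a long enough half-chain accumulates `π / 2`.
    have ht : 0 < Real.tan θ₀ := Real.tan_pos_of_pos_of_lt_pi_div_two h0 h0'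
    have h1 : Real.arctan (-Real.tan θ₀) < Real.arctan (σ * Real.tan θ₀) :=
      Real.arctan_strictMono (by nlinarith)
    rw [Real.arctan_neg, Real.arctan_tan (by linarith) h0'] at h1
    simp only [hκ]; linarith
  have hκc : ContinuousOn κ (Icc 0 θ₀) := by
    have ht : ContinuousOn Real.tan (Icc 0 θ₀) :=
      Real.continuousOn_tan_Ioo.mono fun x hx => ⟨by linarith [hx.1], by linarith [hx.2]⟩
    exact continuousOn_id.add (Real.continuous_arctan.comp_continuousOn (continuousOn_const.mul ht))
  obtain ⟨n, hn⟩ := exists_nat_ge (Real.pi / 2 / κ θ₀)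
  set M : ℕ := n + 1 with hM
  have hMn : (n : ℝ) ≤ M := by rw [hM]; push_cast; linarith
  have hM0 : Real.pi / 2 ≤ κ θ₀ * M := by
    rw [div_le_iff₀ hκ0] at hn
    nlinarith
  have hκM : ContinuousOn (fun θ => κ θ * M) (Icc 0 θ₀) := hκc.mul continuousOn_const
  have hz : κ 0 * M = 0 := by simp [hκ]
  -- At `θ₁` the accumulated phase is exactly `π / 2`, where the quantization function is negative;
  -- at `0` it equals `D > 0`. The root lies between them.
  obtain ⟨θ₁, hθ₁, he₁⟩ := intermediate_value_Icc h0.le hκM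
    (show Real.pi / 2 ∈ Icc _ _ from ⟨by rw [hz]; positivity, hM0⟩)
  simp only at he₁
  have hθ₁0 : 0 < θ₁ := by
    refine lt_of_le_of_ne hθ₁.1 fun h => ?_
    rw [← h, hz] at he₁; linarith
  set G : ℝ → ℝ := fun θ => D * Real.cos (κ θ * M) * Real.cos θ
    - E * Real.sin (κ θ * M) * Real.sin θ with hG
  have hGc : ContinuousOn G (Icc 0 θ₁) := by
    have h1 := hκM.mono (Icc_subset_Icc_right hθ₁.2)
    exact ((continuousOn_const.mul (Real.continuous_cos.comp_continuousOn h1)).mul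
      Real.continuous_cos.continuousOn).sub ((continuousOn_const.mul
        (Real.continuous_sin.comp_continuousOn h1)).mul Real.continuous_sin.continuousOn)
  have hG0 : G 0 = D := by simp only [hG]; rw [hz]; simp
  have hs₁ : 0 < Real.sin θ₁ := Real.sin_pos_of_pos_of_lt_pi hθ₁0 (by linarith [hθ₁.2])
  have hG1 : G θ₁ < 0 := by
    simp only [hG]; rw [he₁, Real.cos_pi_div_two, Real.sin_pi_div_two]
    nlinarith [mul_pos hE hs₁]
  obtain ⟨θ, hθ, hGθ⟩ := intermediate_value_Ioo' hθ₁0.le hGc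
    (show (0 : ℝ) ∈ Ioo (G θ₁) (G 0) from ⟨hG1, by rw [hG0]; exact hD⟩)
  have hθ' : θ ≤ θ₀ := hθ.2.le.trans hθ₁.2
  refine ⟨M, θ, by omega, ⟨hθ.1, by linarith⟩, ?_, hGθ⟩
  have := Real.cos_le_cos_of_nonneg_of_le_pi hθ.1.le (by linarith) hθ'
  linarith

/-- The constant function `1` in `L²(0,1)`. -/
noncomputable def oneL2 : L2Y := (memLp_of_continuous (continuous_const (y := (1 : ℂ)))).toLp

lemma oneL2_ne_zero : oneL2 ≠ 0 := by
  intro h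
  have h1 := (memLp_of_continuous (continuous_const (y := (1 : ℂ)))).coeFn_toLp
  have h2 : oneL2 =ᵐ[volume.restrict (Ioo (0 : ℝ) 1)] 0 := by
    rw [h]; exact Lp.coeFn_zero _ _ _
  have h3 : ∀ᵐ _ ∂volume.restrict (Ioo (0 : ℝ) 1), False := by
    filter_upwards [h1, h2] with y hy1 hy2
    rw [oneL2, hy1] at hy2
    exact one_ne_zero hy2
  rw [Filter.eventually_false_iff_eq_bot, ae_eq_bot, Measure.restrict_eq_zero] at h3
  simp at h3

/-- A function that is affine in `x` and constant in `y`. -/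
noncomputable def affineMode (A B c : ℝ) (x : ℝ) : L2Y := (A + B * (x - c)) • oneL2

lemma hasDerivAt_affineMode (A B c x : ℝ) : HasDerivAt (affineMode A B c) (B • oneL2) x := by
  have h : HasDerivAt (fun x => A + B * (x - c)) B x := by
    simpa using (((hasDerivAt_id x).sub_const c).const_mul B).const_add A
  exact h.smul_const oneL2

lemma regular_affineMode (m : Method) (a b A B c : ℝ) : Regular m a b (affineMode A B c) := by
  have h : ContDiff ℝ 1 (affineMode A B c) := by
    rw [contDiff_one_iff_deriv]
    refine ⟨fun x => (hasDerivAt_affineMode A B c x).differentiableAt, ?_⟩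
    rw [show deriv (affineMode A B c) = fun _ => B • oneL2 from
      funext fun x => (hasDerivAt_affineMode A B c x).deriv]
    exact continuous_const
  cases m with
  | PSM => exact h.continuous.continuousOn
  | OSM p hp => exact h.contDiffOn

/-- The Neumann conditions give `∫ ψ'' = 0`, so a function constant in `y` feels no
second-derivative term and only linearity in `x` is required. -/
lemma solvesPoisson_affineMode (q a b A B c : ℝ) :
    SolvesPoisson .NN q a b 0 (affineMode A B c) := by
  intro ψ hψ
  have c0 := hψ.differentiable.continuous
  have c2 := hψ.continuous_deriv_deriv
  have hsm : ∀ {ψ : ℝ → ℂ}, Continuous ψ → ∀ x,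
      pair ψ (affineMode A B c x) = ((A + B * (x - c) : ℝ) : ℂ) * pair ψ oneL2 := by
    intro ψ hψ x
    rw [affineMode, RCLike.real_smul_eq_coe_smul (K := ℂ), pair_smul hψ]; rfl
  have hzero : pair (deriv (deriv ψ)) oneL2 = 0 := by
    have h1 : pair (deriv (deriv ψ)) oneL2 = ∫ y in Ioo (0 : ℝ) 1, deriv (deriv ψ) y := by
      refine integral_congr_ae ?_
      filter_upwards [(memLp_of_continuous (continuous_const (y := (1 : ℂ)))).coeFn_toLp] with y hy
      rw [oneL2, hy, mul_one]
    have hb : deriv ψ 0 = 0 := hψ.2.1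
    have ht : deriv ψ 1 = 0 := hψ.2.2
    rw [h1, ← integral_Ioc_eq_integral_Ioo, ← intervalIntegral.integral_of_le zero_le_one,
      intervalIntegral.integral_eq_sub_of_hasDerivAt
        (fun y _ => (hψ.differentiable_deriv y).hasDerivAt) (c2.intervalIntegrable _ _), hb, ht,
      sub_zero]
  refine ⟨fun _ => (B : ℂ) * pair ψ oneL2, fun x _ => ⟨?_, ?_⟩⟩
  · simp only [hsm c0]
    have h : HasDerivAt (fun x => A + B * (x - c)) B x := by
      simpa using (((hasDerivAt_id x).sub_const c).const_mul B).const_add A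
    exact h.ofReal_comp.mul_const _
  · rw [hsm c2, hzero, Pi.zero_apply, pair_zero c0]
    simpa using hasDerivAt_const x ((B : ℂ) * pair ψ oneL2)

lemma traces_affineMode (m : Method) {a b : ℝ} (hab : a < b) (A B c : ℝ) {x : ℝ}
    (hx : x ∈ Icc a b) :
    leftTrace m a b (affineMode A B c) x
      = (m.valCoeff * (A + B * (x - c)) - m.derivCoeff * B) • oneL2 ∧
    rightTrace m a b (affineMode A B c) x
      = (m.valCoeff * (A + B * (x - c)) + m.derivCoeff * B) • oneL2 := by
  cases m with
  | PSM => simp [leftTrace, rightTrace, Method.valCoeff, Method.derivCoeff, affineMode]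
  | OSM p hp =>
    have hd : derivWithin (affineMode A B c) (Icc a b) x = B • oneL2 :=
      (hasDerivAt_affineMode A B c x).hasDerivWithinAt.derivWithin (uniqueDiffOn_Icc hab x hx)
    simp only [leftTrace, rightTrace, hd, Method.valCoeff, Method.derivCoeff, one_mul, sub_smul,
      add_smul, mul_smul, affineMode, and_self]

/-- With Neumann conditions on both horizontal sides, long chains have iteration operators with
eigenvalues close to `1`. -/
lemma exists_large_eigenvalue (m : Method) {q L δ r : ℝ} (hL : 0 < L) (hδ : 0 < δ)
    (hδL : δ < L / 2) (hr0 : 0 ≤ r) (hr1 : r < 1) : ∃ (N : ℕ) (μ : ℝ), 1 ≤ N ∧ r < μ ∧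
      ∃ (g : TraceSpace N) (v : ℕ → ℝ → L2Y), g ≠ 0 ∧ SolvesLocal m .NN q L δ N 0 g v ∧
        neighbourTraces m L δ N v = (μ : ℂ) • g := by
  have hα := m.valCoeff_pos
  have hβ := m.derivCoeff_nonneg
  set α := m.valCoeff
  set β := m.derivCoeff
  set h := L / 2 + δ with hh
  set k := L / 2 - δ with hk
  have hk0 : 0 < k := by linarith
  have hkh : k < h := by linarith
  set D := α * h + β with hDdef
  have hD : 0 < D := by positivity
  -- Ratio of the outgoing to the incoming odd factor at frequency zero; the even factors are both
  -- `α`.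
  set σ := (α * k - β) / D
  have hσD : σ * D = α * k - β := div_mul_cancel₀ _ hD.ne'
  have hσ : -1 < σ := by
    rw [lt_div_iff₀ hD]
    nlinarith [mul_pos hα hk0, mul_pos hα (hk0.trans hkh)]
  obtain ⟨M, θ, hM, hθ, hrθ, hq⟩ := exists_quantized_angle hr0 hr1 hσ hD
    (mul_pos hα (hk0.trans hkh))
  set η := Real.arctan (σ * Real.tan θ) with hη
  set κ := θ + η with hκ
  have hcη : 0 < Real.cos η := Real.cos_arctan_pos _
  have hcθ : 0 < Real.cos θ := Real.cos_pos_of_mem_Ioo ⟨by linarith [hθ.1, Real.pi_pos], hθ.2⟩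
  -- `μ` and `η` are the polar coordinates of `(cos θ, σ sin θ)`, so that an outgoing trace becomes
  -- `μ` times a shifted cosine. As `cos η ≤ 1`, `μ ≥ cos θ > r`.
  set μ := Real.cos θ / Real.cos η
  have hμc : μ * Real.cos η = Real.cos θ := div_mul_cancel₀ _ hcη.ne'
  have hμs : μ * Real.sin η = σ * Real.sin θ := by
    have h1 : Real.sin η = Real.cos η * (σ * Real.tan θ) := by
      rw [← Real.tan_arctan (σ * Real.tan θ), ← hη, mul_comm, Real.tan_mul_cos hcη.ne']
    have h2 : Real.tan θ * Real.cos θ = Real.sin θ := Real.tan_mul_cos hcθ.ne'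
    rw [h1, ← mul_assoc, hμc, ← h2]; ring
  have hrμ : r < μ := hrθ.trans_le (by
    rw [le_div_iff₀ hcη]
    exact mul_le_of_le_one_right hcθ.le (Real.cos_le_one η))
  -- The phase vanishes in the middle subdomain `M`, so the two outer boundary conditions become the
  -- same equation. The step `κ = θ + η` makes the outgoing phase `z j + η` equal to the neighbour's
  -- incoming phase `z (j + 1) - θ`.
  let z : ℕ → ℝ := fun j => κ * ((j : ℝ) - M)
  have hz : ∀ j, z (j + 1) = z j + κ := fun j => by simp only [z]; push_cast; ring
  -- Midpoint value and slope are chosen so that the incoming traces are `α D cos (z j ± θ)`.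
  let v : ℕ → ℝ → L2Y := fun j => affineMode (D * Real.cos (z j) * Real.cos θ)
    (-(α * Real.sin (z j) * Real.sin θ)) (aPt L j + h)
  have hlt := fun j => aPt_lt_bPt hL hδ j
  have hown_r : ∀ j, rightTrace m (aPt L j) (bPt L δ j) (v j) (bPt L δ j)
      = (α * D * Real.cos (z j + θ)) • oneL2 := by
    intro j
    rw [(traces_affineMode m (hlt j) _ _ _ ⟨(hlt j).le, le_rfl⟩).2,
      show bPt L δ j - (aPt L j + h) = h by rw [bPt_eq, hh]; ring, Real.cos_add]
    congr 1
    rw [hDdef]; ring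
  have hown_l : ∀ j, leftTrace m (aPt L j) (bPt L δ j) (v j) (aPt L j)
      = (α * D * Real.cos (z j - θ)) • oneL2 := by
    intro j
    rw [(traces_affineMode m (hlt j) _ _ _ ⟨le_rfl, (hlt j).le⟩).1,
      show aPt L j - (aPt L j + h) = -h by ring, Real.cos_sub]
    congr 1
    rw [hDdef]; ring
  have hnei_l : ∀ j, leftTrace m (aPt L j) (bPt L δ j) (v j) (aPt L (j + 1))
      = (μ * (α * D * Real.cos (z j + η))) • oneL2 := by
    intro j
    rw [(traces_affineMode m (hlt j) _ _ _ (aPt_succ_mem hL hδ j)).1,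
      show aPt L (j + 1) - (aPt L j + h) = k by rw [aPt_succ, hh, hk]; ring, Real.cos_add]
    congr 1
    linear_combination (-(α * D * Real.cos (z j))) * hμc + (α * D * Real.sin (z j)) * hμs
      + (α * Real.sin (z j) * Real.sin θ) * hσD
  have hnei_r : ∀ j, rightTrace m (aPt L (j + 1)) (bPt L δ (j + 1)) (v (j + 1)) (bPt L δ j)
      = (μ * (α * D * Real.cos (z (j + 1) - η))) • oneL2 := by
    intro j
    rw [(traces_affineMode m (hlt (j + 1)) _ _ _ (bPt_mem_succ hL hδ j)).2,
      show bPt L δ j - (aPt L (j + 1) + h) = -k by rw [bPt_eq_succ, hh, hk]; ring, Real.cos_sub]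
    congr 1
    linear_combination (-(α * D * Real.cos (z (j + 1)))) * hμc
      - (α * D * Real.sin (z (j + 1))) * hμs
      - (α * Real.sin (z (j + 1)) * Real.sin θ) * hσD
  refine ⟨2 * M + 1, μ, by omega, hrμ, ownTraces m L δ (2 * M + 1) v, v, ?_, ?_, ?_⟩
  · intro h0
    -- The datum on the right side of the middle subdomain is `α D cos θ > 0`; it exists because `M
    -- ≥ 1`.
    have h1 : rightTrace m (aPt L M) (bPt L δ M) (v M) (bPt L δ M) = 0 :=
      congrArg (fun g : TraceSpace (2 * M + 1) => g (Sum.inr ⟨M, by omega⟩)) h0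
    rw [hown_r] at h1
    have hzM : z M = 0 := by simp [z]
    rw [hzM, zero_add] at h1
    exact (smul_ne_zero (by positivity) oneL2_ne_zero) h1
  · refine ⟨fun j _ => regular_affineMode _ _ _ _ _ _,
      fun j _ => solvesPoisson_affineMode _ _ _ _ _ _, ?_, ?_, rfl⟩
    · have : D * Real.cos (z 0) * Real.cos θ + -(α * Real.sin (z 0) * Real.sin θ) *
          (aPt L 0 - (aPt L 0 + h)) = 0 := by
        have e : z 0 = -(κ * M) := by simp only [z]; push_cast; ring
        rw [e, Real.cos_neg, Real.sin_neg]
        linear_combination hq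
      simp only [v, affineMode]
      rw [this, zero_smul]
    · have e1 : 2 * M + 1 - 1 = 2 * M := by omega
      rw [e1]
      have : D * Real.cos (z (2 * M)) * Real.cos θ + -(α * Real.sin (z (2 * M)) * Real.sin θ) *
          (bPt L δ (2 * M) - (aPt L (2 * M) + h)) = 0 := by
        have e : z (2 * M) = κ * M := by simp only [z]; push_cast; ring
        have e2 : bPt L δ (2 * M) - (aPt L (2 * M) + h) = h := by rw [bPt_eq, hh]; ring
        rw [e, e2]
        linear_combination hq
      simp only [v, affineMode]
      rw [this, zero_smul]
  · ext1 s
    rcases s with j | j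
    · change leftTrace m (aPt L j) (bPt L δ j) (v j) (aPt L (j + 1)) = (μ : ℂ) • leftTrace m
        (aPt L (j + 1)) (bPt L δ (j + 1)) (v (j + 1)) (aPt L (j + 1))
      rw [hnei_l, hown_l, hz, show z j + κ - θ = z j + η by rw [hκ]; ring, mul_smul,
        RCLike.real_smul_eq_coe_smul (K := ℂ) μ]; rfl
    · change rightTrace m (aPt L (j + 1)) (bPt L δ (j + 1)) (v (j + 1)) (bPt L δ j) = (μ : ℂ) •
        rightTrace m (aPt L j) (bPt L δ j) (v j) (bPt L δ j)
      rw [hnei_r, hown_r, hz, show z j + κ - η = z j + θ by rw [hκ]; ring, mul_smul,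
        RCLike.real_smul_eq_coe_smul (K := ℂ) μ]; rfl

/-- An eigenvalue belongs to the spectrum, since an inverse of `μ - T` would send `0` back to the
nonzero eigenvector. -/
lemma enorm_le_spectralRadius {H : Type*} [NormedAddCommGroup H] [NormedSpace ℂ H]
    {T : H →L[ℂ] H} {g : H} (hg : g ≠ 0) {μ : ℂ} (h : T g = μ • g) :
    ‖μ‖ₑ ≤ spectralRadius ℂ T := by
  have hmem : μ ∈ spectrum ℂ T := by
    rw [spectrum.mem_iff]
    rintro ⟨S, hS⟩
    have h1 : (algebraMap ℂ (H →L[ℂ] H) μ - T) g = 0 := by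
      simp [h, Algebra.algebraMap_eq_smul_one]
    have h2 : ((↑S⁻¹ : H →L[ℂ] H) * (S : H →L[ℂ] H)) g = 0 := by
      change (↑S⁻¹ : H →L[ℂ] H) ((S : H →L[ℂ] H) g) = 0
      rw [hS, h1, map_zero]
    rw [Units.inv_mul] at h2
    exact hg h2
  exact le_iSup₂ (f := fun (k : ℂ) (_ : k ∈ spectrum ℂ T) => (‖k‖₊ : ℝ≥0∞)) μ hmem

lemma not_weaklyScalable_NN (m : Method) {q L δ : ℝ} (hq : 0 < q) (hL : 0 < L) (hδ : 0 < δ)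
    (hδL : δ < L / 2) : ¬ WeaklyScalable m .NN q L δ := by
  rintro ⟨c, hc1, hc⟩
  obtain ⟨r, hcr, hr1⟩ := ENNReal.lt_iff_exists_nnreal_btwn.1 hc1
  obtain ⟨N, μ, hN, hμ, g, v, hg, hv, hT⟩ := exists_large_eigenvalue m (q := q) hL hδ hδL r.2
    (by exact_mod_cast hr1)
  obtain ⟨ι, e, lam, φ, h⟩ := exists_eigenbasis hq .NN
  have he : IsEigenbasis .NN q e lam φ :=
    ⟨fun i => (h i).1, fun i => (h i).2.1, fun i => (h i).2.2.1, fun i => (h i).2.2.2⟩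
  obtain ⟨T, hTop, -⟩ := he.existsUnique_iterationOperator (m := m) hq hL hδ hδL hN
  have h1 : ‖(μ : ℂ)‖ₑ ≤ spectralRadius ℂ T :=
    enorm_le_spectralRadius hg ((hTop g v hv).trans hT)
  have h2 : spectralRadius ℂ T ≤ c := (le_iSup₂ (f := fun (T : TraceSpace N →L[ℂ] TraceSpace N)
    (_ : IsIterationOperator m .NN q L δ N T) => spectralRadius ℂ T) T hTop).trans (hc N hN)
  have h3 : (r : ℝ≥0∞) ≤ ‖(μ : ℂ)‖ₑ := by
    rw [← ofReal_norm, Complex.norm_real, Real.norm_of_nonneg (r.2.trans hμ.le),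
      ← ENNReal.ofReal_coe_nnreal]
    exact ENNReal.ofReal_le_ofReal hμ.le
  exact absurd hcr (not_lt.2 (h3.trans (h1.trans h2)))

end SchwarzChain

/-! ### Assembly of the theorem -/

theorem theorem3 (L δ q : ℝ) (hL : 0 < L) (hδ : 0 < δ) (hq : 0 < q) :
    -- `μ₁(q)`, `τ₁(q)`, `ν₁(q)` are the unique roots in the respective intervals
    (SchwarzChain.muRoots q = {SchwarzChain.mu1 q} ∧
      SchwarzChain.tauRoots q = {SchwarzChain.tau1 q} ∧
      SchwarzChain.nuRoots q = {SchwarzChain.nu1 q}) ∧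
    -- `lambda1` is the smallest eigenvalue in each configuration
    (∀ bc : SchwarzChain.External,
      IsLeast (SchwarzChain.eigenvalues bc q) (SchwarzChain.lambda1 bc q)) ∧
    -- the contraction factors are bounded by `ρ` at the smallest eigenvalue, for every `N`
    (δ < L / 2 → ∀ (m : SchwarzChain.Method) (bc : SchwarzChain.External),
      (∀ N : ℕ, 1 ≤ N →
        SchwarzChain.WellPosed m bc q L δ N ∧
        (∃! T : SchwarzChain.TraceSpace N →L[ℂ] SchwarzChain.TraceSpace N,
          SchwarzChain.IsIterationOperator m bc q L δ N T) ∧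
        (∀ T : SchwarzChain.TraceSpace N →L[ℂ] SchwarzChain.TraceSpace N,
          SchwarzChain.IsIterationOperator m bc q L δ N T →
            ‖T‖ ≤ SchwarzChain.rhoExt bc L δ q) ∧
        SchwarzChain.contractionFactor m bc q L δ N
          ≤ ENNReal.ofReal (SchwarzChain.rhoExt bc L δ q)) ∧
      (∃ C : ℝ, ∀ N : ℕ, 1 ≤ N → ∀ (f u : ℝ → SchwarzChain.L2Y)
        (U : ℕ → ℕ → ℝ → SchwarzChain.L2Y),
        SchwarzChain.IsExactSolution m bc q L δ N f u →
        SchwarzChain.IsSchwarzRun m bc q L δ N f U →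
        ∀ n : ℕ, 1 ≤ n →
          ‖SchwarzChain.errorTraces m L δ N u U (n + 1)‖
            ≤ SchwarzChain.rhoExt bc L δ q * ‖SchwarzChain.errorTraces m L δ N u U n‖ ∧
          ∀ j < N, ∀ x ∈ Set.Icc (SchwarzChain.aPt L j) (SchwarzChain.bPt L δ j),
            ‖u x - U n j x‖ ≤ C * SchwarzChain.rhoExt bc L δ q ^ n *
              ‖SchwarzChain.errorTraces m L δ N u U 1‖) ∧
      -- weak scalability in all cases except NN
      (SchwarzChain.WeaklyScalable m bc q L δ ↔ bc ≠ SchwarzChain.External.NN)) ∧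
    -- the two chains of inequalities
    (SchwarzChain.rhoExt .DD L δ q < SchwarzChain.rhoExt .DR L δ q ∧
      SchwarzChain.rhoExt .DR L δ q < SchwarzChain.rhoExt .DN L δ q ∧
      SchwarzChain.rhoExt .DN L δ q < SchwarzChain.rhoExt .NR L δ q ∧
      SchwarzChain.rhoExt .NR L δ q < SchwarzChain.rhoExt .NN L δ q ∧
      SchwarzChain.rhoExt .NN L δ q = 1) ∧
    (SchwarzChain.rhoExt .DD L δ q < SchwarzChain.rhoExt .RR L δ q ∧
      SchwarzChain.rhoExt .RR L δ q < SchwarzChain.rhoExt .NN L δ q) := by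
  refine ⟨⟨SchwarzChain.muRoots_eq hq, SchwarzChain.tauRoots_eq hq, SchwarzChain.nuRoots_eq hq⟩,
    SchwarzChain.isLeast_eigenvalues hq, fun hδL m bc => ?_, SchwarzChain.rhoExt_chain hL hδ hq⟩
  obtain ⟨ι, e, lam, φ, h⟩ := SchwarzChain.exists_eigenbasis hq bc
  have he : SchwarzChain.IsEigenbasis bc q e lam φ :=
    ⟨fun i => (h i).1, fun i => (h i).2.1, fun i => (h i).2.2.1, fun i => (h i).2.2.2⟩
  refine ⟨fun N hN => ⟨he.wellPosed hq hL hδ hδL hN,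
      he.existsUnique_iterationOperator hq hL hδ hδL hN,
      fun T hT => he.norm_iterationOperator_le hq hL hδ hδL hN hT,
      he.contractionFactor_le hq hL hδ hδL hN⟩,
    ⟨_, fun N hN f u U hu hU n hn => he.run_estimates hL hδ hδL hN hu hU hn⟩, ?_, ?_⟩
  · rintro hw rfl
    exact SchwarzChain.not_weaklyScalable_NN m hq hL hδ hδL hw
  · intro hbc
    exact ⟨ENNReal.ofReal (SchwarzChain.rhoExt bc L δ q),
      ENNReal.ofReal_lt_one.2 (SchwarzChain.rhoExt_lt_one hL hδ hq hbc),
      fun N hN => he.contractionFactor_le hq hL hδ hδL hN⟩
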